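/- For $|q|<1$ let $$G_0(q)=(q;q)_\infty\sum_{n\ge 0}(-1)^n\frac{q^{n(3n+1)/2}}{(q;q)_n^3},\qquad (q;q)_n=\prod_{j=1}^n(1-q^j),\quad (q;q)_\infty=\prod_{j\ge1}(1-q^j).$$ Let $V=2\,\mathrm{Im}\,\mathrm{Li}_2(e^{\pi i/3})=2.0298832\ldots$ be the hyperbolic volume of the complement of the figure-eight knot $4_1$, where $\mathrm{Li}_2(z)=\sum_{n\ge1}z^n/n^2$, and let $\langle 4_1\rangle_N=\sum_{n=0}^{N-1}\bigl|(\zeta_N;\zeta_N)_n\bigr|^2$, $\zeta_N=e^{2\pi i/N}$, be its Kashaev invariant. There is a unique formal power series $\Phi(h)=\sum_{j\ge0}A_jh^j\in\mathbb C[[h]]$ such that the completed series $\widehat\Phi(h)=e^{iV/h}\Phi(h)$ satisfies $$\langle 4_1\rangle_N\sim N^{3/2}\,\widehat\Phi\Bigl(\frac{2\pi i}{N}\Bigr)\qquad(N\to\infty)$$ to all orders in $1/N$; that is, for every $K\ge0$, $$\langle 4_1\rangle_N=N^{3/2}e^{NV/2\pi}\Bigl(\sum_{j<K}A_j\Bigl(\frac{2\pi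 i}{N}\Bigr)^j+O(N^{-K})\Bigr).$$ For this series one has $$G_0\bigl(e^{2\pi i\tau}\bigr)\sim\sqrt{\tau}\,\bigl(\widehat\Phi(2\pi i\tau)-i\,\widehat\Phi(-2\pi i\tau)\bigr)$$ to all orders in $\tau$ as $\tau\to0$ along any ray in the open upper half-plane; that is, for every $\theta\in(0,\pi)$ and every $K\ge0$, as $\tau\to0$ with $\arg\tau=\theta$, $$G_0\bigl(e^{2\pi i\tau}\bigr)=\sqrt{\tau}\,\Bigl(e^{V/2\pi\tau}\sum_{j<K}A_j(2\pi i\tau)^j-i\,e^{-V/2\pi\tau}\sum_{j<K}A_j(-2\pi i\tau)^j\Bigr)+O\Bigl(|\tau|^{1/2}\bigl(|e^{V/2\pi\tau}|+|e^{-V/2\pi\tau}|\bigr)|\tau|^{K}\Bigr),$$ where $\sqrt\tau$ is the principal square root and the implied constant may depend on $\theta$ and $K$. -/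

import Mathlib

namespace FigureEight

/-- The finite `q`-Pochhammer symbol `(q;q)_n = ∏_{j=1}^n (1 - q^j)`. -/
noncomputable def qPoch (q : ℂ) (n : ℕ) : ℂ :=
  ∏ j ∈ Finset.range n, (1 - q ^ (j + 1))

/-- The infinite `q`-Pochhammer symbol `(q;q)_∞ = ∏_{j ≥ 1} (1 - q^j)`, for `|q| < 1`. -/
noncomputable def qPochInf (q : ℂ) : ℂ :=
  ∏' j : ℕ, (1 - q ^ (j + 1))

/-- `G_0(q) = (q;q)_∞ ∑_{n ≥ 0} (-1)^n q^{n(3n+1)/2} / (q;q)_n^3`, for `|q| < 1`.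
The number `n(3n+1)` is always even, so the division is exact. -/
noncomputable def G0 (q : ℂ) : ℂ :=
  qPochInf q * ∑' n : ℕ, (-1) ^ n * q ^ (n * (3 * n + 1) / 2) / qPoch q n ^ 3

/-- The dilogarithm `Li_2(z) = ∑_{n ≥ 1} z^n / n^2`, for `|z| ≤ 1`. -/
noncomputable def dilog (z : ℂ) : ℂ :=
  ∑' n : ℕ, z ^ (n + 1) / ((n : ℂ) + 1) ^ 2

/-- The hyperbolic volume `V = 2 Im Li_2(e^{πi/3}) = 2.0298832...` of the complement of `4_1`. -/
noncomputable def V : ℝ :=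
  2 * (dilog (Complex.exp (Real.pi * Complex.I / 3))).im

/-- The Kashaev invariant `⟨4_1⟩_N = ∑_{n=0}^{N-1} |(ζ_N;ζ_N)_n|^2`, `ζ_N = e^{2πi/N}`. -/
noncomputable def kashaev (N : ℕ) : ℝ :=
  ∑ n ∈ Finset.range N, ‖qPoch (Complex.exp (2 * Real.pi * Complex.I / N)) n‖ ^ 2

/-- The exponential prefactor `e^{iV/h}` of a completed series. -/
noncomputable def expFactor (h : ℂ) : ℂ :=
  Complex.exp (Complex.I * V / h)

/-- The truncation to `K` terms of the completed series `e^{iV/h} Φ(h)`: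
`e^{iV/h} ∑_{j<K} A_j h^j` if `Φ(h) = ∑_j A_j h^j`. -/
noncomputable def completedTrunc (Φ : PowerSeries ℂ) (K : ℕ) (h : ℂ) : ℂ :=
  expFactor h * ∑ j ∈ Finset.range K, PowerSeries.coeff j Φ * h ^ j

/-- `Φ` is the asymptotic series of the Kashaev invariant of `4_1`:
`⟨4_1⟩_N ∼ N^{3/2} e^{iV/h} Φ(h)` with `h = 2πi/N`, to all orders in `1/N`, as `N → ∞`. -/
def IsKashaevSeries (Φ : PowerSeries ℂ) : Prop :=
  ∀ K : ℕ,
    (fun N : ℕ => (kashaev N : ℂ) -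
        (((N : ℝ) ^ (3 / 2 : ℝ) : ℝ) : ℂ) *
          completedTrunc Φ K (2 * Real.pi * Complex.I / N))
      =O[Filter.atTop]
    (fun N : ℕ => (N : ℝ) ^ (3 / 2 : ℝ) * ‖expFactor (2 * Real.pi * Complex.I / N)‖
        * ((N : ℝ)⁻¹) ^ K)

/-- `G_0(e^{2πiτ}) ∼ √τ (e^{iV/h} Φ(h) - i e^{-iV/h} Φ(-h))` with `h = 2πiτ`, to all orders in `τ`,
as `τ` tends to `0` along the ray of argument `θ`. Since the two completed series have different
exponential growth on a general ray, the error after `K` terms is `O(|τ|^K)` relative to the sum of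
the sizes of the two exponential prefactors. The square root is the principal one. -/
def HasRayExpansion (Φ : PowerSeries ℂ) (θ : ℝ) : Prop :=
  ∀ K : ℕ, ∃ C : ℝ, ∃ r₀ > 0, ∀ r : ℝ, 0 < r → r < r₀ → ∀ τ : ℂ,
    τ = r * Complex.exp (θ * Complex.I) →
      ‖G0 (Complex.exp (2 * Real.pi * Complex.I * τ)) -
          τ ^ (1 / 2 : ℂ) *
            (completedTrunc Φ K (2 * Real.pi * Complex.I * τ) -
              Complex.I * completedTrunc Φ K (-(2 * Real.pi * Complex.I * τ)))‖
        ≤ C * (‖τ ^ (1 / 2 : ℂ)‖ *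
            (‖expFactor (2 * Real.pi * Complex.I * τ)‖ +
              ‖expFactor (-(2 * Real.pi * Complex.I * τ))‖) * ‖τ‖ ^ K)

end FigureEight

/-!
Write `e(w) = e^{2πiw}` and `q = e(τ)`. Euler's identities turn the series `G_0` into the constant
term of `(z q^{1/2};q)_∞ / (z^{-1} q^{1/2};q)_∞`, so that `G_0(q)` is the integral of a function
`kernel τ v` over a period of `v = log z / 2πi` (`G0_eq_integral`). The reflection formula for the
`q`-Pochhammer symbol at a root of unity writes the terms of the Kashaev invariant as products of the
same shape (`norm_qPoch_sq_eq`). For both, the midpoint Euler–Maclaurin formula applied to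
`log (1 - e(w))` gives one and the same asymptotic expansion `exp (wkb K τ v)`, with `τ = 1 / N` in
the case of the Kashaev invariant (`exists_kernel_eq_exp`, `exists_norm_qPoch_sq_eq_exp`). The leading
term of the exponent is `phase v / τ`, where `phase v = Im Li₂(e(v)) / π`. Its maximum on a period is
attained at `v = 1/6`, and is equal to `V / 2π`.

Laplace's method at the saddle point `1/6` provides coefficients `A j` that depend neither on the
direction of integration nor on the ray of `τ` (`IsSaddleExpansion`, `exists_isSaddleExpansion`).
They therefore appear in all of the following expansions.

* The Kashaev invariant is, up to exponentially small terms, a midpoint sum over a window around the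
  saddle point, which agrees with the integral to all orders (`exists_kashaev_sub_le`). Since an
  asymptotic expansion determines its coefficients, the series `Φ` is unique. The Kashaev invariant
  is real, and hence so are the `A j`.
* On a ray in the open first quadrant, the integral over the real period is dominated by the saddle
  point at `1/6` (`exists_G0_sub_le_of_re_pos`). The second exponential is smaller than the error
  term. The second quadrant follows by complex conjugation, which exchanges the two exponentials.
* On the imaginary axis the kernel has modulus one on the real line. The functional equation
  `kernel_sub` controls it away from the real line, so that half of the period can be deformed into a
  path of steepest descent through `1/6` and two horizontal segments on which the kernel is small.
  The other half contributes the complex conjugate, and since the `A j` are real this is the term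
  `-i √τ e^{-V/2πτ} ∑ A_j (-τ)^j` (`exists_G0_sub_le_I`, `conj_twoSaddleSum`).
-/

open Filter Topology

namespace FigureEight

/-! ### Basic `q`-series identities -/

lemma qPoch_succ (q : ℂ) (n : ℕ) : qPoch q (n + 1) = qPoch q n * (1 - q ^ (n + 1)) := by
  simp [qPoch, Finset.prod_range_succ]

@[simp] lemma qPoch_zero (q : ℂ) : qPoch q 0 = 1 := by simp [qPoch]

lemma one_sub_pow_ne_zero {q : ℂ} (hq : ‖q‖ < 1) (n : ℕ) : 1 - q ^ (n + 1) ≠ 0 := by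
  intro h
  have h1 : ‖q ^ (n + 1)‖ = 1 := by rw [← sub_eq_zero.mp h]; simp
  rw [norm_pow] at h1
  have := pow_lt_one₀ (norm_nonneg q) hq (Nat.succ_ne_zero n)
  simp only [Nat.succ_eq_add_one] at this
  linarith

lemma qPoch_ne_zero {q : ℂ} (hq : ‖q‖ < 1) (n : ℕ) : qPoch q n ≠ 0 :=
  Finset.prod_ne_zero_iff.mpr fun j _ => one_sub_pow_ne_zero hq j

lemma summable_norm_mul_pow {q : ℂ} (hq : ‖q‖ < 1) (z : ℂ) : Summable fun j : ℕ => ‖z * q ^ j‖ := by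
  simp only [norm_mul, norm_pow]
  exact (summable_geometric_of_lt_one (norm_nonneg _) hq).mul_left _

lemma multipliable_one_sub_mul_pow {q : ℂ} (hq : ‖q‖ < 1) (z : ℂ) :
    Multipliable fun j : ℕ => 1 - z * q ^ j := by
  have := multipliable_one_add_of_summable (f := fun j : ℕ => -(z * q ^ j))
    (by simpa only [norm_neg] using summable_norm_mul_pow hq z)
  simpa [sub_eq_add_neg] using this

lemma tendsto_prod_one_sub_mul_pow {q : ℂ} (hq : ‖q‖ < 1) (z : ℂ) :
    Tendsto (fun n => ∏ j ∈ Finset.range n, (1 - z * q ^ j)) atTop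
      (𝓝 (∏' j : ℕ, (1 - z * q ^ j))) :=
  (multipliable_one_sub_mul_pow hq z).hasProd.tendsto_prod_nat

lemma tprod_one_sub_mul_pow_ne_zero {q : ℂ} (hq : ‖q‖ < 1) (z : ℂ) (hz : ∀ j : ℕ, z * q ^ j ≠ 1) :
    ∏' j : ℕ, (1 - z * q ^ j) ≠ 0 := by
  have := tprod_one_add_ne_zero_of_summable (f := fun j : ℕ => -(z * q ^ j))
    (fun j => by
      have := hz j
      intro h
      apply this
      linear_combination -h)
    (by simpa only [norm_neg] using summable_norm_mul_pow hq z)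
  simpa [sub_eq_add_neg] using this

lemma qPochInf_eq (q : ℂ) : qPochInf q = ∏' j : ℕ, (1 - q * q ^ j) := by
  simp [qPochInf, pow_succ']

lemma tendsto_qPoch {q : ℂ} (hq : ‖q‖ < 1) : Tendsto (qPoch q) atTop (𝓝 (qPochInf q)) := by
  rw [qPochInf_eq]
  refine (tendsto_prod_one_sub_mul_pow hq q).congr fun n => ?_
  simp [qPoch, pow_succ']

lemma qPochInf_ne_zero {q : ℂ} (hq : ‖q‖ < 1) : qPochInf q ≠ 0 := by
  rw [qPochInf_eq]
  refine tprod_one_sub_mul_pow_ne_zero hq q fun j h => ?_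
  apply one_sub_pow_ne_zero hq j
  rw [pow_succ', h, sub_self]

lemma exists_norm_inv_qPoch_le {q : ℂ} (hq : ‖q‖ < 1) :
    ∃ C : ℝ, 0 < C ∧ ∀ n, ‖(qPoch q n)⁻¹‖ ≤ C := by
  have h := ((tendsto_qPoch hq).inv₀ (qPochInf_ne_zero hq)).norm.bddAbove_range
  obtain ⟨C, hC⟩ := h
  refine ⟨max C 1, by positivity, fun n => (hC ⟨n, rfl⟩).trans (le_max_left _ _)⟩

/-- A convergent power series at the points `q ^ N * z` tends to its constant term. -/
lemma tendsto_tsum_mul_pow_mul {q : ℂ} (hq : ‖q‖ < 1) (a : ℕ → ℂ) (z : ℂ)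
    (ha : Summable fun n => ‖a n * z ^ n‖) :
    Tendsto (fun N : ℕ => ∑' n, a n * (z * q ^ N) ^ n) atTop (𝓝 (a 0)) := by
  have h : ∑' n : ℕ, (if n = 0 then a 0 else 0) = a 0 := by simp
  rw [← h]
  refine tendsto_tsum_of_dominated_convergence ha (fun n => ?_) (Eventually.of_forall fun N n => ?_)
  · rcases eq_or_ne n 0 with rfl | hn
    · simp
    · simp only [hn, if_false]
      have h1 : Tendsto (fun N : ℕ => (q ^ N)) atTop (𝓝 0) :=
        tendsto_pow_atTop_nhds_zero_of_norm_lt_one hq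
      have h2 : Tendsto (fun N : ℕ => a n * (z * q ^ N) ^ n) atTop (𝓝 (a n * (z * 0) ^ n)) :=
        ((h1.const_mul z).pow n).const_mul _
      simpa [hn] using h2
  · rw [mul_pow, ← mul_assoc, norm_mul]
    refine mul_le_of_le_one_right (norm_nonneg _) ?_
    rw [norm_pow, norm_pow]
    exact pow_le_one₀ (by positivity) (pow_le_one₀ (norm_nonneg _) hq.le)

lemma summable_norm_euler_inv {q : ℂ} (hq : ‖q‖ < 1) {z : ℂ} (hz : ‖z‖ < 1) :
    Summable fun n => ‖(qPoch q n)⁻¹ * z ^ n‖ := by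
  obtain ⟨C, -, hC⟩ := exists_norm_inv_qPoch_le hq
  refine Summable.of_nonneg_of_le (fun _ => norm_nonneg _) (fun n => ?_)
    ((summable_geometric_of_lt_one (norm_nonneg z) hz).mul_left C)
  rw [norm_mul, norm_pow]
  exact mul_le_mul_of_nonneg_right (hC n) (by positivity)

/-- Euler's expansion `1 / (z;q)_∞ = ∑ z^n / (q;q)_n`: both sides satisfy the same first order
`q`-difference equation. -/
lemma tsum_euler_inv {q : ℂ} (hq : ‖q‖ < 1) {z : ℂ} (hz : ‖z‖ < 1) :
    ∑' n, (qPoch q n)⁻¹ * z ^ n = (∏' j : ℕ, (1 - z * q ^ j))⁻¹ := by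
  set E : ℂ → ℂ := fun z => ∑' n, (qPoch q n)⁻¹ * z ^ n with hE
  have step : ∀ w : ℂ, ‖w‖ < 1 → E (w * q) = (1 - w) * E w := by
    intro w hw
    have hw' : ‖w * q‖ < 1 := by
      rw [norm_mul]; exact mul_lt_one_of_nonneg_of_lt_one_left (norm_nonneg _) hw hq.le
    have s1 := (summable_norm_euler_inv hq hw).of_norm
    have s2 := (summable_norm_euler_inv hq hw').of_norm
    have h1 : E w - E (w * q) = ∑' n, ((qPoch q n)⁻¹ * w ^ n - (qPoch q n)⁻¹ * (w * q) ^ n) :=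
      (s1.tsum_sub s2).symm
    have h2 : ∑' n, ((qPoch q n)⁻¹ * w ^ n - (qPoch q n)⁻¹ * (w * q) ^ n) = w * E w := by
      rw [(s1.sub s2).tsum_eq_zero_add, hE]
      simp only [pow_zero, sub_self, zero_add]
      rw [← tsum_mul_left]
      refine tsum_congr fun n => ?_
      have a1 := qPoch_ne_zero hq n
      have a2 := one_sub_pow_ne_zero hq n
      rw [qPoch_succ]
      field_simp
      ring
    linear_combination -h1 - h2
  have iter : ∀ N : ℕ, E (z * q ^ N) = (∏ j ∈ Finset.range N, (1 - z * q ^ j)) * E z := by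
    intro N
    induction N with
    | zero => simp
    | succ N ih =>
      have : ‖z * q ^ N‖ < 1 := by
        rw [norm_mul, norm_pow]
        exact mul_lt_one_of_nonneg_of_lt_one_left (norm_nonneg _) hz
          (pow_le_one₀ (norm_nonneg _) hq.le)
      rw [pow_succ, ← mul_assoc, step _ this, ih, Finset.prod_range_succ]
      ring
  have l1 : Tendsto (fun N => E (z * q ^ N)) atTop (𝓝 1) := by
    simpa using tendsto_tsum_mul_pow_mul hq (fun n => (qPoch q n)⁻¹) z
      (summable_norm_euler_inv hq hz)
  have l2 := ((tendsto_prod_one_sub_mul_pow hq z).mul_const (E z)).congr fun N => (iter N).symm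
  have := tendsto_nhds_unique l1 l2
  exact eq_inv_of_mul_eq_one_right this.symm

lemma summable_norm_euler {q : ℂ} (hq : ‖q‖ < 1) (z : ℂ) :
    Summable fun n : ℕ => ‖(-1) ^ n * q ^ (n * (n - 1) / 2) * (qPoch q n)⁻¹ * z ^ n‖ := by
  obtain ⟨C, hC0, hC⟩ := exists_norm_inv_qPoch_le hq
  have key : Summable fun n : ℕ => ‖q‖ ^ (n * (n - 1) / 2) * ‖z‖ ^ n := by
    refine summable_of_ratio_norm_eventually_le (r := 1 / 2) (by norm_num) ?_
    have h1 : Tendsto (fun n : ℕ => ‖q‖ ^ n * ‖z‖) atTop (𝓝 (0 * ‖z‖)) :=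
      (tendsto_pow_atTop_nhds_zero_of_lt_one (norm_nonneg _) hq).mul_const _
    rw [zero_mul] at h1
    filter_upwards [h1.eventually_le_const (by norm_num : (0 : ℝ) < 1 / 2)] with n hn
    rw [Nat.triangle_succ, Real.norm_of_nonneg (by positivity),
      Real.norm_of_nonneg (by positivity)]
    calc _ = (‖q‖ ^ n * ‖z‖) * (‖q‖ ^ (n * (n - 1) / 2) * ‖z‖ ^ n) := by ring
      _ ≤ _ := mul_le_mul_of_nonneg_right hn (by positivity)
  refine Summable.of_nonneg_of_le (fun _ => norm_nonneg _) (fun n => ?_) (key.mul_left C)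
  simp only [norm_mul, norm_pow, norm_neg, norm_one, one_pow, one_mul]
  have := mul_le_mul_of_nonneg_right (hC n) (by positivity : 0 ≤ ‖q‖ ^ (n * (n - 1) / 2) * ‖z‖ ^ n)
  linarith

/-- Euler's expansion `(z;q)_∞ = ∑ (-1)^n q^{n(n-1)/2} z^n / (q;q)_n`. -/
lemma tsum_euler {q : ℂ} (hq : ‖q‖ < 1) (z : ℂ) :
    ∑' n : ℕ, (-1) ^ n * q ^ (n * (n - 1) / 2) * (qPoch q n)⁻¹ * z ^ n =
      ∏' j : ℕ, (1 - z * q ^ j) := by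
  set F : ℂ → ℂ := fun z => ∑' n : ℕ, (-1) ^ n * q ^ (n * (n - 1) / 2) * (qPoch q n)⁻¹ * z ^ n
    with hF
  -- The functional equation `(w;q)_∞ = (1 - w) (wq;q)_∞`.
  have step : ∀ w : ℂ, F w = (1 - w) * F (w * q) := by
    intro w
    have s1 := (summable_norm_euler hq w).of_norm
    have s2 := (summable_norm_euler hq (w * q)).of_norm
    have h1 : F w - F (w * q) = ∑' n : ℕ, ((-1) ^ n * q ^ (n * (n - 1) / 2) * (qPoch q n)⁻¹ * w ^ n
        - (-1) ^ n * q ^ (n * (n - 1) / 2) * (qPoch q n)⁻¹ * (w * q) ^ n) :=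
      (s1.tsum_sub s2).symm
    rw [(s1.sub s2).tsum_eq_zero_add] at h1
    simp only [pow_zero, sub_self, zero_add] at h1
    have h2 : F w - F (w * q) = -w * F (w * q) := by
      rw [h1, hF]
      simp only
      rw [← tsum_mul_left]
      refine tsum_congr fun n => ?_
      have a1 := qPoch_ne_zero hq n
      have a2 := one_sub_pow_ne_zero hq n
      rw [qPoch_succ, Nat.triangle_succ]
      field_simp
      ring
    linear_combination h2
  have iter : ∀ N : ℕ, F z = (∏ j ∈ Finset.range N, (1 - z * q ^ j)) * F (z * q ^ N) := by
    intro N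
    induction N with
    | zero => simp
    | succ N ih =>
      rw [ih, step (z * q ^ N), Finset.prod_range_succ, pow_succ]
      ring_nf
  have l1 : Tendsto (fun N => F (z * q ^ N)) atTop (𝓝 1) := by
    simpa using tendsto_tsum_mul_pow_mul hq
      (fun n : ℕ => (-1) ^ n * q ^ (n * (n - 1) / 2) * (qPoch q n)⁻¹) z
      (summable_norm_euler hq z)
  have l2 := ((tendsto_prod_one_sub_mul_pow hq z).mul l1).congr fun N => (iter N).symm
  have := tendsto_nhds_unique l2 tendsto_const_nhds
  rw [mul_one] at this
  exact this.symm

/-- A limiting case of the `q`-Vandermonde summation, with an additional parameter `a` which makes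
the induction on `k` work. -/
lemma sum_pow_div_qPoch {q : ℂ} (hq : ‖q‖ < 1) (k a : ℕ) :
    ∑ n ∈ Finset.range (k + 1), q ^ (n * (n + a)) / (qPoch q n * qPoch q (n + a) * qPoch q (k - n)) =
      1 / (qPoch q k * qPoch q (k + a)) := by
  induction k generalizing a with
  | zero => simp
  | succ k ih =>
    have h0 := one_sub_pow_ne_zero hq k
    -- The factor `1 - q ^ (k + 1)` splits as `(1 - q ^ (k + 1 - n)) + q ^ (k + 1 - n) (1 - q ^ n)`.
    have key : (1 - q ^ (k + 1)) * ∑ n ∈ Finset.range (k + 1 + 1),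
        q ^ (n * (n + a)) / (qPoch q n * qPoch q (n + a) * qPoch q (k + 1 - n)) =
        1 / (qPoch q k * qPoch q (k + a)) +
          q ^ (k + 1 + a) * (1 / (qPoch q k * qPoch q (k + (a + 1)))) := by
      rw [← ih a, ← ih (a + 1), Finset.mul_sum, Finset.mul_sum]
      have split : ∀ n ∈ Finset.range (k + 1 + 1), (1 - q ^ (k + 1)) *
          (q ^ (n * (n + a)) / (qPoch q n * qPoch q (n + a) * qPoch q (k + 1 - n))) =
          (1 - q ^ (k + 1 - n)) * (q ^ (n * (n + a)) /
            (qPoch q n * qPoch q (n + a) * qPoch q (k + 1 - n))) +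
          q ^ (k + 1 - n) * (1 - q ^ n) * (q ^ (n * (n + a)) /
            (qPoch q n * qPoch q (n + a) * qPoch q (k + 1 - n))) := by
        intro n hn
        have : q ^ (k + 1) = q ^ (k + 1 - n) * q ^ n := by
          rw [← pow_add]; congr 1; have := Finset.mem_range.mp hn; omega
        rw [this]; ring
      rw [Finset.sum_congr rfl split, Finset.sum_add_distrib]
      congr 1
      · rw [Finset.sum_range_succ]
        simp only [Nat.sub_self, pow_zero, sub_self, zero_mul, add_zero]
        refine Finset.sum_congr rfl fun n hn => ?_
        have hn' := Finset.mem_range.mp hn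
        obtain ⟨m, rfl⟩ : ∃ m, k = n + m := ⟨k - n, by omega⟩
        have e1 : n + m + 1 - n = m + 1 := by omega
        have e2 : n + m - n = m := by omega
        rw [e1, e2, qPoch_succ q m]
        have := one_sub_pow_ne_zero hq m
        field_simp
      · rw [Finset.sum_range_succ']
        simp only [pow_zero, sub_self, mul_zero, zero_mul, add_zero]
        refine Finset.sum_congr rfl fun n hn => ?_
        have hn' := Finset.mem_range.mp hn
        obtain ⟨m, rfl⟩ : ∃ m, k = n + m := ⟨k - n, by omega⟩
        have e1 : n + m + 1 - (n + 1) = m := by omega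
        have e2 : n + m - n = m := by omega
        have e3 : n + 1 + a = n + (a + 1) := by omega
        rw [e1, e2, e3, qPoch_succ q n]
        have := one_sub_pow_ne_zero hq n
        have := qPoch_ne_zero hq n
        have := qPoch_ne_zero hq m
        have := qPoch_ne_zero hq (n + (a + 1))
        field_simp
        ring
    have a1 := qPoch_ne_zero hq k
    have a2 := qPoch_ne_zero hq (k + a)
    have a3 := one_sub_pow_ne_zero hq (k + a)
    have e3 : k + 1 + a = k + a + 1 := by omega
    have e4 : k + (a + 1) = k + a + 1 := by omega
    apply mul_left_cancel₀ h0
    rw [key, e3, e4, qPoch_succ q k, qPoch_succ q (k + a)]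
    field_simp
    ring

lemma two_mul_pentagonal (n : ℕ) : 2 * (n * (3 * n + 1) / 2) = n * (3 * n + 1) := by
  refine Nat.mul_div_cancel' ?_
  rcases Nat.even_or_odd n with h | h
  · exact (even_iff_two_dvd.mp (h.mul_right _))
  · refine even_iff_two_dvd.mp (Even.mul_left ?_ _)
    obtain ⟨m, rfl⟩ := h
    exact ⟨3 * m + 2, by ring⟩

lemma two_mul_triangle (n : ℕ) : 2 * (n * (n + 1) / 2) = n * (n + 1) :=
  Nat.mul_div_cancel' (even_iff_two_dvd.mp (Nat.even_mul_succ_self n))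

lemma pentagonal_exponent (n m : ℕ) : n * (3 * n + 1) / 2 + (m * (m - 1) / 2 + (n + 1) * m) =
    n * n + (n + m) * (n + m + 1) / 2 := by
  have h1 := two_mul_pentagonal n
  have h2 := two_mul_triangle (n + m)
  have h3 : 2 * (m * (m - 1) / 2) + m = m * m := by
    rcases m with _ | m
    · simp
    · have := two_mul_triangle m
      simp only [Nat.add_sub_cancel]
      rw [mul_comm (m + 1) m]
      linarith
  nlinarith

lemma qPochInf_eq_mul {q : ℂ} (hq : ‖q‖ < 1) (n : ℕ) :
    qPochInf q = qPoch q n * ∏' j : ℕ, (1 - q ^ (n + 1) * q ^ j) := by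
  rw [qPochInf_eq, ← Multipliable.prod_mul_tprod_nat_mul' (k := n)]
  · congr 1
    · simp [qPoch, pow_succ']
    · refine tprod_congr fun j => ?_
      ring
  · refine (multipliable_one_sub_mul_pow hq (q ^ (n + 1))).congr fun j => ?_
    ring

/-- The function `G_0` as an alternating series with `(q;q)_k²` in the denominator. The factor
`(q;q)_∞ / (q;q)_n = (q^{n+1};q)_∞` is expanded by Euler's identity, and the terms of the double
series with the same `k = n + m` are summed by `sum_pow_div_qPoch`. -/
lemma G0_eq_tsum {q : ℂ} (hq : ‖q‖ < 1) :
    G0 q = ∑' k : ℕ, (-1) ^ k * q ^ (k * (k + 1) / 2) * (qPoch q k)⁻¹ * (qPoch q k)⁻¹ := by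
  obtain ⟨C, hC0, hC⟩ := exists_norm_inv_qPoch_le hq
  set u : ℕ × ℕ → ℂ := fun p => (-1) ^ (p.1 + p.2) *
    q ^ (p.1 * p.1 + (p.1 + p.2) * (p.1 + p.2 + 1) / 2) *
    ((qPoch q p.1)⁻¹ * (qPoch q p.1)⁻¹ * (qPoch q p.2)⁻¹) with hu
  have hsum : Summable u := by
    have hg := summable_geometric_of_lt_one (norm_nonneg q) hq
    have hgg := (hg.mul_of_nonneg hg (fun _ => by positivity) (fun _ => by positivity)).mul_left
      (C * C * C)
    refine Summable.of_norm_bounded hgg fun p => ?_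
    rw [hu]
    simp only [norm_mul, norm_pow, norm_neg, norm_one, one_pow, one_mul]
    rw [mul_comm]
    have hle : p.1 + p.2 ≤ p.1 * p.1 + (p.1 + p.2) * (p.1 + p.2 + 1) / 2 := by
      have h2 := two_mul_triangle (p.1 + p.2)
      have h3 : (p.1 + p.2) ≤ (p.1 + p.2) * (p.1 + p.2) := Nat.le_mul_self _
      have h4 : (p.1 + p.2) * (p.1 + p.2 + 1) = (p.1 + p.2) * (p.1 + p.2) + (p.1 + p.2) := by ring
      omega
    refine mul_le_mul ?_ ?_ (by positivity) (by positivity)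
    · gcongr <;> exact hC _
    · rw [← pow_add]
      exact pow_le_pow_of_le_one (norm_nonneg _) hq.le hle
  have h1 : ∑' p, u p = G0 q := by
    rw [hsum.tsum_prod, G0, ← tsum_mul_left]
    refine tsum_congr fun n => ?_
    rw [qPochInf_eq_mul hq n, ← tsum_euler hq, mul_comm (qPoch q n), mul_assoc, ← tsum_mul_right]
    refine tsum_congr fun m => ?_
    have a1 := qPoch_ne_zero hq n
    have a2 := qPoch_ne_zero hq m
    rw [hu]
    simp only
    rw [← pentagonal_exponent, ← pow_mul]
    field_simp
    ring
  rw [← h1, ← Finset.HasAntidiagonal.sigmaAntidiagonalEquivProd.tsum_eq u]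
  have hsum' := (Finset.HasAntidiagonal.sigmaAntidiagonalEquivProd (A := ℕ)).summable_iff.mpr hsum
  refine (hsum'.tsum_sigma' (fun k => (hasSum_fintype _).summable)).trans ?_
  refine tsum_congr fun k => ?_
  rw [tsum_fintype]
  have := sum_pow_div_qPoch hq k 0
  simp only [add_zero] at this
  have h2 : ∑ b : Finset.HasAntidiagonal.antidiagonal k,
      (u ∘ Finset.HasAntidiagonal.sigmaAntidiagonalEquivProd) ⟨k, b⟩ =
      ∑ b ∈ Finset.HasAntidiagonal.antidiagonal k, u b := Finset.sum_coe_sort (Finset.HasAntidiagonal.antidiagonal k) u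
  rw [h2, Finset.Nat.sum_antidiagonal_eq_sum_range_succ_mk]
  have h3 : ∀ n ∈ Finset.range k.succ, u (n, k - n) = (-1) ^ k * q ^ (k * (k + 1) / 2) *
      (q ^ (n * n) / (qPoch q n * qPoch q n * qPoch q (k - n))) := by
    intro n hn
    have hn' := Finset.mem_range_succ_iff.mp hn
    rw [hu]
    simp only [Nat.add_sub_cancel' hn', pow_add]
    field_simp
  rw [Finset.sum_congr rfl h3, ← Finset.mul_sum, this]
  field_simp

/-! ### The integral representation of `G_0` -/

/-- The normalised exponential `e(w) = e^{2πiw}`. -/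
noncomputable def cyc (w : ℂ) : ℂ := Complex.exp (2 * Real.pi * Complex.I * w)

lemma cyc_add (v w : ℂ) : cyc (v + w) = cyc v * cyc w := by
  rw [cyc, cyc, cyc, ← Complex.exp_add]; ring_nf

lemma cyc_nat_mul (n : ℕ) (w : ℂ) : cyc (n * w) = cyc w ^ n := by
  rw [cyc, cyc, ← Complex.exp_nat_mul]; ring_nf

lemma cyc_ne_zero (w : ℂ) : cyc w ≠ 0 := Complex.exp_ne_zero _

@[simp] lemma cyc_zero : cyc 0 = 1 := by simp [cyc]

lemma cyc_int (n : ℤ) : cyc n = 1 := by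
  rw [cyc, mul_comm]
  exact Complex.exp_int_mul_two_pi_mul_I n

lemma cyc_add_int (w : ℂ) (n : ℤ) : cyc (w + n) = cyc w := by
  rw [cyc_add, cyc_int, mul_one]

lemma norm_cyc (w : ℂ) : ‖cyc w‖ = Real.exp (-(2 * Real.pi * w.im)) := by
  rw [cyc, Complex.norm_exp]
  congr 1
  simp [Complex.mul_re, Complex.mul_im]

lemma norm_cyc_ofReal (x : ℝ) : ‖cyc x‖ = 1 := by simp [norm_cyc]

lemma norm_cyc_lt_one {w : ℂ} (hw : 0 < w.im) : ‖cyc w‖ < 1 := by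
  rw [norm_cyc, Real.exp_lt_one_iff]
  have := Real.pi_pos
  have : 0 < 2 * Real.pi * w.im := by positivity
  linarith

lemma cyc_eq_one_iff {w : ℂ} : cyc w = 1 ↔ ∃ n : ℤ, w = n := by
  rw [cyc, Complex.exp_eq_one_iff]
  refine exists_congr fun n => ?_
  have : (2 * Real.pi * Complex.I : ℂ) ≠ 0 := by simp [Real.pi_ne_zero]
  rw [mul_comm (n : ℂ)]
  exact mul_right_inj' this

/-- The product `∏_{j ≥ 0} (1 - e(v + (j + 1/2) τ)) = (e(v) q^{1/2}; q)_∞` with `q = e(τ)`. -/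
noncomputable def halfPoch (τ v : ℂ) : ℂ := ∏' j : ℕ, (1 - cyc (v + (j + 1 / 2) * τ))

/-- The integrand `(e(v) q^{1/2}; q)_∞ / (e(-v) q^{1/2}; q)_∞` whose mean over the circle is
`G_0(q)`. -/
noncomputable def kernel (τ v : ℂ) : ℂ := halfPoch τ v / halfPoch τ (-v)

lemma cyc_half_shift (τ v : ℂ) (j : ℕ) :
    cyc (v + (j + 1 / 2) * τ) = cyc v * cyc (τ / 2) * cyc τ ^ j := by
  rw [← cyc_nat_mul, ← cyc_add, ← cyc_add]; ring_nf

lemma halfPoch_eq (τ v : ℂ) :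
    halfPoch τ v = ∏' j : ℕ, (1 - cyc v * cyc (τ / 2) * cyc τ ^ j) := by
  simp only [halfPoch, cyc_half_shift]

lemma halfPoch_eq_tsum {τ : ℂ} (hτ : 0 < τ.im) (v : ℂ) :
    halfPoch τ v = ∑' n : ℕ, (-1) ^ n * cyc τ ^ (n * (n - 1) / 2) * (qPoch (cyc τ) n)⁻¹ *
      (cyc v * cyc (τ / 2)) ^ n := by
  rw [halfPoch_eq, tsum_euler (norm_cyc_lt_one hτ)]

lemma norm_cyc_half_lt_one {τ : ℂ} (hτ : 0 < τ.im) : ‖cyc (τ / 2)‖ < 1 := by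
  refine norm_cyc_lt_one ?_
  have : (τ / 2).im = τ.im / 2 := by simp
  rw [this]; linarith

lemma integral_cyc_mul_cyc (n m : ℕ) :
    ∫ v in (0 : ℝ)..1, cyc v ^ n * cyc (-v) ^ m = if n = m then 1 else 0 := by
  have h : ∀ v : ℝ, cyc v ^ n * cyc (-v) ^ m =
      Complex.exp ((2 * Real.pi * Complex.I * ((n : ℂ) - m)) * v) := by
    intro v
    rw [← cyc_nat_mul, ← cyc_nat_mul, ← cyc_add, cyc]
    ring_nf
  simp only [h]
  split_ifs with hnm
  · subst hnm; simp
  · have hc : (2 * Real.pi * Complex.I * ((n : ℂ) - m)) ≠ 0 := by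
      have : (n : ℂ) - m ≠ 0 := sub_ne_zero.mpr (by exact_mod_cast hnm)
      simp [Real.pi_ne_zero, this]
    rw [integral_exp_mul_complex hc]
    have : Complex.exp (2 * Real.pi * Complex.I * ((n : ℂ) - m)) = 1 := by
      have := cyc_int ((n : ℤ) - m)
      rw [cyc] at this
      push_cast at this
      exact this
    simp [this]

/-- The constant term of `(z q^{1/2};q)_∞ / (z^{-1} q^{1/2};q)_∞`, computed from Euler's two
expansions, is the alternating series for `G_0`. -/
lemma G0_eq_integral {τ : ℂ} (hτ : 0 < τ.im) :
    G0 (cyc τ) = ∫ v in (0 : ℝ)..1, kernel τ v := by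
  have hq := norm_cyc_lt_one hτ
  have hQ := norm_cyc_half_lt_one hτ
  set q := cyc τ with hqdef
  set Q := cyc (τ / 2) with hQdef
  have hQQ : Q * Q = q := by rw [← cyc_add]; congr 1; ring
  set a : ℕ → ℂ := fun n => (-1) ^ n * q ^ (n * (n - 1) / 2) * (qPoch q n)⁻¹ * Q ^ n with ha
  set b : ℕ → ℂ := fun n => (qPoch q n)⁻¹ * Q ^ n with hb
  have sa : Summable fun n => ‖a n‖ := summable_norm_euler hq Q
  have sb : Summable fun n => ‖b n‖ := summable_norm_euler_inv hq hQ
  have sab : Summable fun p : ℕ × ℕ => ‖a p.1 * b p.2‖ := sa.mul_norm sb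
  set F : ℕ × ℕ → C(ℝ, ℂ) := fun p =>
    ⟨fun v : ℝ => a p.1 * b p.2 * (cyc v ^ p.1 * cyc (-v) ^ p.2), by unfold cyc; fun_prop⟩ with hF
  have hnorm : ∀ p (v : ℝ), ‖F p v‖ = ‖a p.1 * b p.2‖ := by
    intro p v
    have := norm_cyc_ofReal (-v)
    push_cast at this
    simp only [hF, ContinuousMap.coe_mk]
    rw [norm_mul, norm_mul (cyc v ^ p.1), norm_pow, norm_pow, norm_cyc_ofReal, this]
    simp
  have hker : ∀ v : ℝ, kernel τ v = ∑' p, F p v := by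
    intro v
    have h1 : halfPoch τ v = ∑' n, a n * cyc v ^ n := by
      rw [halfPoch_eq_tsum hτ]
      refine tsum_congr fun n => ?_
      rw [ha, mul_pow]; ring
    have h2 : (halfPoch τ (-v))⁻¹ = ∑' n, b n * cyc (-v) ^ n := by
      have hlt : ‖cyc (-v) * Q‖ < 1 := by
        have := norm_cyc_ofReal (-v)
        push_cast at this
        rw [norm_mul, this, one_mul]; exact hQ
      rw [halfPoch_eq, ← tsum_euler_inv hq hlt]
      refine tsum_congr fun n => ?_
      rw [hb, mul_pow]; ring
    rw [kernel, div_eq_mul_inv, h1, h2, tsum_mul_tsum_of_summable_norm]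
    · refine tsum_congr fun p => ?_
      simp only [hF, ContinuousMap.coe_mk]
      ring
    · refine sa.congr fun n => ?_
      rw [norm_mul (a n), norm_pow, norm_cyc_ofReal]; simp
    · refine sb.congr fun n => ?_
      have := norm_cyc_ofReal (-v)
      push_cast at this
      rw [norm_mul (b n), norm_pow, this]; simp
  have hsum := intervalIntegral.hasSum_intervalIntegral_of_summable_norm (a := 0) (b := 1) (f := F)
    (Summable.of_nonneg_of_le (fun _ => norm_nonneg _) (fun p => by
      rw [ContinuousMap.norm_le _ (norm_nonneg (a p.1 * b p.2))]
      intro v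
      exact (hnorm p v).le) sab)
  have hint : ∀ p, ∫ v in (0 : ℝ)..1, F p v = a p.1 * b p.2 * (if p.1 = p.2 then 1 else 0) := by
    intro p
    simp only [hF, ContinuousMap.coe_mk]
    rw [intervalIntegral.integral_const_mul, integral_cyc_mul_cyc]
  simp only [hker]
  rw [← hsum.tsum_eq, hsum.summable.tsum_prod, G0_eq_tsum hq]
  refine tsum_congr fun k => ?_
  simp only [hint]
  rw [tsum_eq_single k (fun m hm => by simp [hm.symm])]
  have h3 : k * (k + 1) / 2 = k * (k - 1) / 2 + k := by
    rw [← Nat.triangle_succ, Nat.add_sub_cancel, mul_comm]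
  have h4 : Q ^ k * Q ^ k = q ^ k := by rw [← mul_pow, hQQ]
  simp only [ha, hb, if_true, mul_one]
  rw [h3, pow_add, ← h4]
  ring

/-! ### The midpoint Euler–Maclaurin formula -/

/-- The coefficients of the midpoint Euler–Maclaurin formula: the Taylor coefficients of
`(x/2) / sinh (x/2)` in the variable `x ^ 2`. -/
noncomputable def emCoeff (k : ℕ) : ℂ :=
  PowerSeries.coeff k (PowerSeries.mk fun i => (1 / (4 ^ i * (2 * i + 1).factorial) : ℂ))⁻¹

lemma sum_emCoeff_mul (n : ℕ) :
    ∑ k ∈ Finset.range (n + 1), emCoeff k * (1 / (4 ^ (n - k) * (2 * (n - k) + 1).factorial) : ℂ) =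
      if n = 0 then 1 else 0 := by
  have h := PowerSeries.inv_mul_cancel
    (PowerSeries.mk fun i => (1 / (4 ^ i * (2 * i + 1).factorial) : ℂ)) (by simp)
  have h2 := congrArg (PowerSeries.coeff n) h
  rw [PowerSeries.coeff_mul, Finset.Nat.sum_antidiagonal_eq_sum_range_succ_mk,
    PowerSeries.coeff_one] at h2
  rw [← h2]
  refine Finset.sum_congr rfl fun k _ => ?_
  rw [PowerSeries.coeff_mk, emCoeff]

@[simp] lemma emCoeff_zero : emCoeff 0 = 1 := by simpa using sum_emCoeff_mul 0

/-- Taylor's formula with a crude remainder for a chain of functions `G 0, G 1, …` each of which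
is the derivative of the preceding one. -/
lemma norm_sub_taylor_le {a b x₀ B : ℝ} (hab : b - a ≤ 1) (hx₀ : x₀ ∈ Set.Icc a b) (n : ℕ)
    (G : ℕ → ℝ → ℂ) (hG : ∀ k < n, ∀ t ∈ Set.Icc a b, HasDerivAt (G k) (G (k + 1) t) t)
    (hB : ∀ t ∈ Set.Icc a b, ‖G n t‖ ≤ B) {x : ℝ} (hx : x ∈ Set.Icc a b) :
    ‖G 0 x - ∑ i ∈ Finset.range n, G i x₀ * ((x - x₀ : ℝ) : ℂ) ^ i / i.factorial‖ ≤ B := by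
  induction n generalizing G x with
  | zero => simpa using hB x hx
  | succ n ih =>
    have hB0 : 0 ≤ B := (norm_nonneg _).trans (hB x hx)
    set H : ℝ → ℂ := fun x =>
      G 0 x - ∑ i ∈ Finset.range (n + 1), G i x₀ * ((x - x₀ : ℝ) : ℂ) ^ i / i.factorial with hH
    have hder : ∀ t ∈ Set.Icc a b, HasDerivAt H (G 1 t -
        ∑ i ∈ Finset.range n, G (i + 1) x₀ * ((t - x₀ : ℝ) : ℂ) ^ i / i.factorial) t := by
      intro t ht
      refine (hG 0 (by omega) t ht).sub ?_
      have h1 : ∀ i : ℕ, HasDerivAt (fun x : ℝ => G i x₀ * ((x - x₀ : ℝ) : ℂ) ^ i / i.factorial)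
          (G i x₀ * (i * ((t - x₀ : ℝ) : ℂ) ^ (i - 1)) / i.factorial) t := by
        intro i
        have h2 : HasDerivAt (fun x : ℝ => ((x - x₀ : ℝ) : ℂ)) 1 t := by
          simpa using ((hasDerivAt_id t).sub_const x₀).ofReal_comp
        simpa using ((h2.pow i).const_mul (G i x₀)).div_const _
      have h3 := HasDerivAt.fun_sum (u := Finset.range (n + 1)) fun i _ => h1 i
      refine h3.congr_deriv ?_
      rw [Finset.sum_range_succ']
      simp only [Nat.cast_zero, zero_mul, mul_zero, zero_div, add_zero, Nat.add_sub_cancel]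
      refine Finset.sum_congr rfl fun i _ => ?_
      have : (i.factorial : ℂ) ≠ 0 := by exact_mod_cast i.factorial_ne_zero
      have : ((i : ℂ) + 1) ≠ 0 := by exact_mod_cast i.succ_ne_zero
      rw [Nat.factorial_succ]
      push_cast
      field_simp
    have hbd : ∀ t ∈ Set.Icc a b, ‖G 1 t -
        ∑ i ∈ Finset.range n, G (i + 1) x₀ * ((t - x₀ : ℝ) : ℂ) ^ i / i.factorial‖ ≤ B :=
      fun t ht => ih (fun k => G (k + 1)) (fun k hk t ht => hG (k + 1) (by omega) t ht) hB ht
    have hmv := (convex_Icc a b).norm_image_sub_le_of_norm_hasDerivWithin_le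
      (fun t ht => (hder t ht).hasDerivWithinAt) hbd hx₀ hx
    have hH0 : H x₀ = 0 := by
      rw [hH]
      simp only [sub_self]
      rw [Finset.sum_range_succ']
      simp
    rw [hH0, sub_zero] at hmv
    refine hmv.trans ?_
    have : ‖x - x₀‖ ≤ 1 := by
      rw [Real.norm_eq_abs, abs_le]
      constructor <;> linarith [hx.1, hx.2, hx₀.1, hx₀.2]
    exact mul_le_of_le_one_right hB0 this

lemma sum_range_two_mul (u : ℕ → ℂ) (m : ℕ) :
    ∑ i ∈ Finset.range (2 * m), u i = ∑ l ∈ Finset.range m, (u (2 * l) + u (2 * l + 1)) := by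
  induction m with
  | zero => simp
  | succ m ih =>
    rw [Nat.mul_succ, Finset.sum_range_succ, Finset.sum_range_succ, ih, Finset.sum_range_succ]
    ring

/-- The constant in the error term of the Euler–Maclaurin formula of order `K`. -/
noncomputable def emConst (K : ℕ) : ℝ := ∑ k ∈ Finset.range (K + 1), ‖emCoeff k‖ * 2

lemma emConst_nonneg (K : ℕ) : 0 ≤ emConst K := Finset.sum_nonneg fun _ _ => by positivity

/-- The Euler–Maclaurin formula on one cell: the value at the midpoint of the derivative of `G 0`
is a combination of differences of `G 0` and its even derivatives. -/
lemma euler_maclaurin_cell {a B : ℝ} (K : ℕ) (G : ℕ → ℝ → ℂ)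
    (hG : ∀ k < 2 * K + 2, ∀ t ∈ Set.Icc a (a + 1), HasDerivAt (G k) (G (k + 1) t) t)
    (hB : ∀ t ∈ Set.Icc a (a + 1), ‖G (2 * K + 2) t‖ ≤ B) :
    ‖G 1 (a + 1 / 2) -
      ∑ k ∈ Finset.range (K + 1), emCoeff k * (G (2 * k) (a + 1) - G (2 * k) a)‖ ≤
      emConst K * B := by
  set y := a + 1 / 2 with hy
  have hymem : y ∈ Set.Icc a (a + 1) := ⟨by linarith, by linarith⟩
  set d : ℕ → ℂ := fun l => (1 / (4 ^ l * (2 * l + 1).factorial) : ℂ) with hd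
  -- Taylor expansion at the midpoint, where the even orders cancel in the difference.
  have hdiff : ∀ k ∈ Finset.range (K + 1), ‖(G (2 * k) (a + 1) - G (2 * k) a) -
      ∑ l ∈ Finset.range (K + 1 - k), G (2 * (k + l) + 1) y * d l‖ ≤ 2 * B := by
    intro k hk
    have hk' := Finset.mem_range.mp hk
    have htay : ∀ x ∈ Set.Icc a (a + 1), ‖G (2 * k) x - ∑ i ∈ Finset.range (2 * (K + 1 - k)),
        G (2 * k + i) y * ((x - y : ℝ) : ℂ) ^ i / i.factorial‖ ≤ B := by
      intro x hx
      refine norm_sub_taylor_le (by linarith) hymem (2 * (K + 1 - k)) (fun i => G (2 * k + i))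
        (fun i hi t ht => hG _ (by omega) t ht) (fun t ht => ?_) hx
      have : 2 * k + 2 * (K + 1 - k) = 2 * K + 2 := by omega
      rw [this]
      exact hB t ht
    have h1 := htay (a + 1) ⟨by linarith, le_rfl⟩
    have h2 := htay a ⟨le_rfl, by linarith⟩
    have h3 : ∑ l ∈ Finset.range (K + 1 - k), G (2 * (k + l) + 1) y * d l =
        ∑ i ∈ Finset.range (2 * (K + 1 - k)),
          G (2 * k + i) y * ((a + 1 - y : ℝ) : ℂ) ^ i / i.factorial -
        ∑ i ∈ Finset.range (2 * (K + 1 - k)),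
          G (2 * k + i) y * ((a - y : ℝ) : ℂ) ^ i / i.factorial := by
      rw [sum_range_two_mul, sum_range_two_mul, ← Finset.sum_sub_distrib]
      refine Finset.sum_congr rfl fun l _ => ?_
      have e1 : ((a + 1 - y : ℝ) : ℂ) = 1 / 2 := by rw [hy]; push_cast; ring
      have e2 : ((a - y : ℝ) : ℂ) = -(1 / 2) := by rw [hy]; push_cast; ring
      have e3 : 2 * (k + l) + 1 = 2 * k + (2 * l + 1) := by ring
      have e4 : (2 : ℂ) ^ (2 * l) = 4 ^ l := by rw [pow_mul]; norm_num
      rw [e1, e2, e3, hd, Even.neg_pow ⟨l, by ring⟩, Odd.neg_pow ⟨l, rfl⟩]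
      simp only [one_div, inv_pow, pow_succ, e4, mul_inv]
      field_simp
      ring
    rw [h3]
    calc _ = ‖(G (2 * k) (a + 1) - ∑ i ∈ Finset.range (2 * (K + 1 - k)),
          G (2 * k + i) y * ((a + 1 - y : ℝ) : ℂ) ^ i / i.factorial) - (G (2 * k) a -
          ∑ i ∈ Finset.range (2 * (K + 1 - k)),
          G (2 * k + i) y * ((a - y : ℝ) : ℂ) ^ i / i.factorial)‖ := by congr 1; ring
      _ ≤ _ := (norm_sub_le _ _).trans (by linarith)
  -- The recursion for `emCoeff` removes all derivatives of higher order.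
  have hmain : ∑ k ∈ Finset.range (K + 1), emCoeff k *
      ∑ l ∈ Finset.range (K + 1 - k), G (2 * (k + l) + 1) y * d l = G 1 y := by
    have h1 := Finset.sum_range_diag_flip (K + 1)
      (fun k l => emCoeff k * (G (2 * (k + l) + 1) y * d l))
    simp only [← Finset.mul_sum] at h1
    rw [← h1]
    have h2 : ∀ n ∈ Finset.range (K + 1), ∑ k ∈ Finset.range (n + 1),
        emCoeff k * (G (2 * (k + (n - k)) + 1) y * d (n - k)) =
        G (2 * n + 1) y * (if n = 0 then 1 else 0) := by
      intro n _
      rw [← sum_emCoeff_mul, Finset.mul_sum]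
      refine Finset.sum_congr rfl fun k hk => ?_
      have : k + (n - k) = n := by have := Finset.mem_range.mp hk; omega
      rw [this, hd]
      ring
    rw [Finset.sum_congr rfl h2]
    simp
  rw [← hmain, ← Finset.sum_sub_distrib]
  refine (norm_sum_le _ _).trans ?_
  rw [emConst, Finset.sum_mul]
  refine Finset.sum_le_sum fun k hk => ?_
  rw [← mul_sub, norm_mul, norm_sub_rev, mul_assoc]
  exact mul_le_mul_of_nonneg_left (hdiff k hk) (norm_nonneg _)

/-- The Euler–Maclaurin formula for a sum over midpoints, for a chain of functions `G k` each of which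
is the derivative of the preceding one. The sum is over values of `G 1`; the term `k = 0` is the
increment of its primitive `G 0`. -/
lemma euler_maclaurin_sum {a : ℝ} (J K : ℕ) (G : ℕ → ℝ → ℂ) (B : ℕ → ℝ)
    (hG : ∀ k < 2 * K + 2, ∀ t ∈ Set.Icc a (a + J), HasDerivAt (G k) (G (k + 1) t) t)
    (hB : ∀ j < J, ∀ t ∈ Set.Icc (a + j) (a + j + 1), ‖G (2 * K + 2) t‖ ≤ B j) :
    ‖∑ j ∈ Finset.range J, G 1 (a + j + 1 / 2) -
      ∑ k ∈ Finset.range (K + 1), emCoeff k * (G (2 * k) (a + J) - G (2 * k) a)‖ ≤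
      emConst K * ∑ j ∈ Finset.range J, B j := by
  have hsplit : ∑ k ∈ Finset.range (K + 1), emCoeff k * (G (2 * k) (a + J) - G (2 * k) a) =
      ∑ j ∈ Finset.range J, ∑ k ∈ Finset.range (K + 1),
        emCoeff k * (G (2 * k) (a + j + 1) - G (2 * k) (a + j)) := by
    rw [Finset.sum_comm]
    refine Finset.sum_congr rfl fun k _ => ?_
    rw [← Finset.mul_sum]
    congr 1
    have := Finset.sum_range_sub (fun j : ℕ => G (2 * k) (a + j)) J
    simp only [Nat.cast_zero, add_zero] at this
    rw [← this]
    refine Finset.sum_congr rfl fun j _ => ?_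
    push_cast
    ring_nf
  rw [hsplit, ← Finset.sum_sub_distrib, Finset.mul_sum]
  refine (norm_sum_le _ _).trans (Finset.sum_le_sum fun j hj => ?_)
  have hj' := Finset.mem_range.mp hj
  have hj2 : (j : ℝ) + 1 ≤ J := by exact_mod_cast hj'
  refine euler_maclaurin_cell K G (fun k hk t ht => hG k hk t ⟨?_, ?_⟩) (hB j hj')
  · have : (0 : ℝ) ≤ j := j.cast_nonneg
    linarith [ht.1]
  · linarith [ht.2]

/-! ### The function `log (1 - e(w))` and its primitive -/

/-- The union of the upper half-plane and the strip `0 < Re w < 1`, on which the principal branch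
of `log (1 - e(w))` is holomorphic. -/
def logDomain : Set ℂ := {w | 0 < w.im ∨ (0 < w.re ∧ w.re < 1)}

/-- The function `log (1 - e(w))`, with the principal branch. -/
noncomputable def logOneSub (w : ℂ) : ℂ := Complex.log (1 - cyc w)

/-- The derivative of `log (1 - e(w))`. -/
noncomputable def logOneSubDeriv (w : ℂ) : ℂ :=
  -(2 * Real.pi * Complex.I) * cyc w / (1 - cyc w)

/-- The primitive of `log (1 - e(w))` on `logDomain` that vanishes at `+i∞`, as an integral along
a vertical ray; it is a multiple of the dilogarithm of `e(w)`. -/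
noncomputable def logPrim (w : ℂ) : ℂ :=
  -Complex.I * ∫ s in Set.Ioi (0 : ℝ), logOneSub (w + s * Complex.I)

/-- The sequence consisting of the primitive of `log (1 - e(w))`, this function, and its successive
derivatives. -/
noncomputable def logChain : ℕ → ℂ → ℂ
  | 0 => logPrim
  | k + 1 => iteratedDeriv k logOneSub

/-- The points of `logDomain` at distance at least `ρ` from the integers, with imaginary part at
least `-1`. -/
def logRegion (ρ : ℝ) : Set ℂ := {w | w ∈ logDomain ∧ -1 ≤ w.im ∧ ∀ n : ℤ, ρ ≤ ‖w - n‖}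

lemma isOpen_logDomain : IsOpen logDomain :=
  (isOpen_lt continuous_const Complex.continuous_im).union
    ((isOpen_lt continuous_const Complex.continuous_re).inter
      (isOpen_lt Complex.continuous_re continuous_const))

lemma cyc_eq (w : ℂ) : cyc w = Real.exp (-(2 * Real.pi * w.im)) *
    (Real.cos (2 * Real.pi * w.re) + Real.sin (2 * Real.pi * w.re) * Complex.I) := by
  rw [cyc]
  conv_lhs => rw [← Complex.re_add_im w]
  rw [show 2 * (Real.pi : ℂ) * Complex.I * (w.re + w.im * Complex.I) =
    ((-(2 * Real.pi * w.im) : ℝ) : ℂ) + ((2 * Real.pi * w.re : ℝ) : ℂ) * Complex.I by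
      push_cast; linear_combination 2 * Real.pi * w.im * Complex.I_mul_I, Complex.exp_add,
    Complex.exp_mul_I, ← Complex.ofReal_exp, ← Complex.ofReal_cos, ← Complex.ofReal_sin]

lemma cyc_re (w : ℂ) : (cyc w).re =
    Real.exp (-(2 * Real.pi * w.im)) * Real.cos (2 * Real.pi * w.re) := by
  rw [cyc_eq, Complex.re_ofReal_mul, Complex.add_re, Complex.re_ofReal_mul, Complex.I_re,
    Complex.ofReal_re, mul_zero, add_zero]

lemma cyc_im (w : ℂ) : (cyc w).im =
    Real.exp (-(2 * Real.pi * w.im)) * Real.sin (2 * Real.pi * w.re) := by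
  rw [cyc_eq, Complex.im_ofReal_mul, Complex.add_im, Complex.im_ofReal_mul, Complex.I_im,
    Complex.ofReal_im, mul_one, zero_add]

/-- On `logDomain`, the value `1 - e(w)` is not a non-positive real number: in the upper half-plane
`|e(w)| < 1`, and in the strip `e(w)` is not a positive real number. -/
lemma one_sub_cyc_mem_slitPlane {w : ℂ} (hw : w ∈ logDomain) : 1 - cyc w ∈ Complex.slitPlane := by
  rw [Complex.mem_slitPlane_iff]
  rcases hw with h | ⟨h1, h2⟩
  · left
    have h3 := norm_cyc_lt_one h
    have h4 := Complex.re_le_norm (cyc w)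
    simp only [Complex.sub_re, Complex.one_re]
    linarith
  · have hπ := Real.pi_pos
    have he := Real.exp_pos (-(2 * Real.pi * w.im))
    by_cases hs : Real.sin (2 * Real.pi * w.re) = 0
    · left
      have hc : Real.cos (2 * Real.pi * w.re) = -1 := by
        obtain ⟨n, hn⟩ := Real.sin_eq_zero_iff.mp hs
        have hn1 : (n : ℝ) = 2 * w.re := by
          have : Real.pi * n = Real.pi * (2 * w.re) := by linarith
          exact mul_left_cancel₀ hπ.ne' this
        have h3 : (0 : ℝ) < n := by linarith
        have h4 : (n : ℝ) < 2 := by linarith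
        have h5 : n = 1 := by
          have : 0 < n := by exact_mod_cast h3
          have : n < 2 := by exact_mod_cast h4
          omega
        rw [← hn, h5]; simp
      simp only [Complex.sub_re, Complex.one_re, cyc_re, hc]
      linarith
    · right
      simp only [Complex.sub_im, Complex.one_im, cyc_im]
      intro h
      have : Real.exp (-(2 * Real.pi * w.im)) * Real.sin (2 * Real.pi * w.re) = 0 := by linarith
      rcases mul_eq_zero.mp this with h | h
      · exact he.ne' h
      · exact hs h

lemma one_sub_cyc_ne_zero {w : ℂ} (hw : w ∈ logDomain) : 1 - cyc w ≠ 0 :=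
  Complex.slitPlane_ne_zero (one_sub_cyc_mem_slitPlane hw)

lemma exp_logOneSub {w : ℂ} (hw : w ∈ logDomain) : Complex.exp (logOneSub w) = 1 - cyc w :=
  Complex.exp_log (one_sub_cyc_ne_zero hw)

lemma hasDerivAt_cyc (w : ℂ) : HasDerivAt cyc (2 * Real.pi * Complex.I * cyc w) w := by
  have h : HasDerivAt (fun w : ℂ => 2 * Real.pi * Complex.I * w) (2 * Real.pi * Complex.I) w := by
    simpa using (hasDerivAt_id w).const_mul (2 * Real.pi * Complex.I : ℂ)
  exact h.cexp.congr_deriv (mul_comm _ _)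

lemma continuous_cyc : Continuous cyc := by unfold cyc; fun_prop

lemma hasDerivAt_logOneSub {w : ℂ} (hw : w ∈ logDomain) :
    HasDerivAt logOneSub (logOneSubDeriv w) w := by
  have := ((hasDerivAt_cyc w).const_sub 1).clog (one_sub_cyc_mem_slitPlane hw)
  refine this.congr_deriv ?_
  rw [logOneSubDeriv]; ring

lemma analyticAt_logOneSub {w : ℂ} (hw : w ∈ logDomain) : AnalyticAt ℂ logOneSub w :=
  DifferentiableOn.analyticAt (s := logDomain)
    (fun _ hz => (hasDerivAt_logOneSub hz).differentiableAt.differentiableWithinAt)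
    (isOpen_logDomain.mem_nhds hw)

lemma continuousOn_logOneSub : ContinuousOn logOneSub logDomain :=
  fun _ hw => (hasDerivAt_logOneSub hw).continuousAt.continuousWithinAt

lemma one_sub_cyc_ne_zero_of_ne {w : ℂ} (hw : ∀ n : ℤ, w ≠ n) : 1 - cyc w ≠ 0 := by
  intro h
  obtain ⟨n, hn⟩ := cyc_eq_one_iff.mp (sub_eq_zero.mp h).symm
  exact hw n hn

lemma exists_le_norm_one_sub_cyc (M : ℝ) {ρ : ℝ} (hρ : 0 < ρ) :
    ∃ c > 0, ∀ w : ℂ, -M ≤ w.im → (∀ n : ℤ, ρ ≤ ‖w - n‖) → c ≤ ‖1 - cyc w‖ := by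
  set K : Set ℂ := (Set.Icc 0 1 ×ℂ Set.Icc (-M) 1) ∩ {w | ∀ n : ℤ, ρ ≤ ‖w - n‖} with hK
  have hKc : IsCompact K := by
    refine (isCompact_Icc.reProdIm isCompact_Icc).inter_right ?_
    simp only [Set.ofPred_forall]
    exact isClosed_iInter fun n => isClosed_le continuous_const (by fun_prop)
  have hpos : ∀ w ∈ K, 0 < ‖1 - cyc w‖ := by
    intro w hw
    refine norm_pos_iff.mpr (one_sub_cyc_ne_zero_of_ne fun n hn => ?_)
    have := hw.2 n
    rw [hn, sub_self, norm_zero] at this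
    linarith
  obtain ⟨c, hc0, hc⟩ : ∃ c > 0, ∀ w ∈ K, c ≤ ‖1 - cyc w‖ := by
    rcases K.eq_empty_or_nonempty with h | h
    · exact ⟨1, one_pos, by simp [h]⟩
    · obtain ⟨w₀, hw₀, hmin⟩ := hKc.exists_isMinOn h
        (continuous_norm.comp (continuous_const.sub continuous_cyc)).continuousOn
      exact ⟨_, hpos w₀ hw₀, fun w hw => hmin hw⟩
  have hπ := Real.pi_gt_three
  refine ⟨min c (1 / 2), by positivity, fun w hw hwn => ?_⟩
  rcases le_or_gt 1 w.im with h1 | h1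
  · refine (min_le_right _ _).trans ?_
    have h2 : ‖cyc w‖ ≤ 1 / 2 := by
      rw [norm_cyc]
      have : Real.exp (-(2 * Real.pi * w.im)) ≤ Real.exp (-1) := by
        apply Real.exp_le_exp.mpr; nlinarith
      have := Real.exp_neg_one_lt_half
      linarith
    have := norm_sub_norm_le (1 : ℂ) (cyc w)
    rw [norm_one] at this
    linarith
  · refine (min_le_left _ _).trans ?_
    have hmem : w - (⌊w.re⌋ : ℤ) ∈ K := by
      refine ⟨?_, fun n => ?_⟩
      · rw [Complex.mem_reProdIm]
        simp only [Complex.sub_re, Complex.intCast_re, Complex.sub_im, Complex.intCast_im, sub_zero]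
        exact ⟨⟨by linarith [Int.floor_le w.re], by linarith [Int.lt_floor_add_one w.re]⟩,
          hw, h1.le⟩
      · have := hwn (⌊w.re⌋ + n)
        push_cast at this
        rwa [sub_sub]
    have := hc _ hmem
    have h2 : cyc (w - (⌊w.re⌋ : ℤ)) = cyc w := by
      have := cyc_add_int w (-⌊w.re⌋)
      push_cast at this
      rwa [← sub_eq_add_neg] at this
    rwa [h2] at this

lemma exists_norm_logOneSubDeriv_le (M : ℝ) {ρ : ℝ} (hρ : 0 < ρ) :
    ∃ C > 0, ∀ w : ℂ, -M ≤ w.im → (∀ n : ℤ, ρ ≤ ‖w - n‖) →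
      ‖logOneSubDeriv w‖ ≤ C * Real.exp (-(2 * Real.pi * w.im)) := by
  obtain ⟨c, hc0, hc⟩ := exists_le_norm_one_sub_cyc M hρ
  have hπ := Real.pi_pos
  refine ⟨2 * Real.pi / c, by positivity, fun w h1 h2 => ?_⟩
  have := hc w h1 h2
  rw [logOneSubDeriv, norm_div, norm_mul, norm_cyc, div_mul_eq_mul_div]
  have e : ‖-(2 * Real.pi * Complex.I : ℂ)‖ = 2 * Real.pi := by
    rw [norm_neg]; simp [abs_of_pos hπ]
  rw [e]
  gcongr

lemma norm_logOneSub_le {w : ℂ} (hw : 1 ≤ w.im) :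
    ‖logOneSub w‖ ≤ 2 * Real.exp (-(2 * Real.pi * w.im)) := by
  have hπ := Real.pi_gt_three
  have h2 : ‖-cyc w‖ ≤ 1 / 2 := by
    rw [norm_neg, norm_cyc]
    have : Real.exp (-(2 * Real.pi * w.im)) ≤ Real.exp (-1) := by
      apply Real.exp_le_exp.mpr; nlinarith
    have := Real.exp_neg_one_lt_half
    linarith
  have := Complex.norm_log_one_add_half_le_self h2
  rw [norm_neg, norm_cyc, ← sub_eq_add_neg] at this
  rw [logOneSub]
  have := Real.exp_pos (-(2 * Real.pi * w.im))
  linarith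

lemma add_mul_I_mem_logDomain {w : ℂ} (hw : w ∈ logDomain) {s : ℝ} (hs : 0 ≤ s) :
    w + s * Complex.I ∈ logDomain := by
  rcases hw with h | h
  · left; simp; linarith
  · right; simpa using h

lemma integrableOn_logOneSub {w : ℂ} (hw : w ∈ logDomain) :
    MeasureTheory.IntegrableOn (fun s : ℝ => logOneSub (w + s * Complex.I)) (Set.Ioi 0) := by
  have hc : ContinuousOn (fun s : ℝ => logOneSub (w + s * Complex.I)) (Set.Ici 0) :=
    continuousOn_logOneSub.comp (by fun_prop) fun s hs => add_mul_I_mem_logDomain hw hs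
  refine (MeasureTheory.integrable_norm_iff
    ((hc.mono Set.Ioi_subset_Ici_self).aestronglyMeasurable measurableSet_Ioi)).mp ?_
  refine integrable_of_isBigO_exp_neg (b := 1) one_pos hc.norm ?_
  · refine Asymptotics.IsBigO.of_bound (2 * Real.exp (-(2 * Real.pi * w.im))) ?_
    filter_upwards [eventually_ge_atTop (1 - w.im), eventually_ge_atTop 0] with s hs hs0
    rw [norm_norm]
    refine (norm_logOneSub_le (by simp; linarith)).trans ?_
    rw [Real.norm_of_nonneg (Real.exp_pos _).le, mul_assoc 2 (Real.exp _), ← Real.exp_add]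
    have := Real.pi_gt_three
    gcongr
    simp only [Complex.add_im, Complex.mul_im, Complex.ofReal_re, Complex.I_im, mul_one,
      Complex.ofReal_im, Complex.I_re, mul_zero, add_zero]
    nlinarith

/-- Near a point of `logDomain`, vertical rays stay in `logDomain` and away from the integers. -/
lemma exists_nhds_vertical {w₀ : ℂ} (hw : w₀ ∈ logDomain) : ∃ ε > 0, ∃ ρ > 0,
    ∀ w ∈ Metric.ball w₀ ε, w ∈ logDomain ∧ -(|w₀.im| + 1) ≤ w.im ∧
      ∀ s : ℝ, 0 ≤ s → ∀ n : ℤ, ρ ≤ ‖w + s * Complex.I - n‖ := by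
  obtain ⟨δ, hδ, hball⟩ := Metric.isOpen_iff.mp isOpen_logDomain w₀ hw
  have him : ∀ ε ≤ 1, ∀ w ∈ Metric.ball w₀ ε, -(|w₀.im| + 1) ≤ w.im := by
    intro ε hε w hw
    rw [mem_ball_iff_norm] at hw
    have h1 := (Complex.abs_im_le_norm (w - w₀)).trans hw.le
    rw [Complex.sub_im, abs_le] at h1
    linarith [neg_abs_le w₀.im]
  rcases hw with h | ⟨h1, h2⟩
  · refine ⟨min (min δ 1) (w₀.im / 2), by positivity, w₀.im / 2, by positivity, fun w hw =>
      ⟨hball (Metric.ball_subset_ball ((min_le_left _ _).trans (min_le_left _ _)) hw),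
        him _ ((min_le_left _ _).trans (min_le_right _ _)) w hw, fun s hs n => ?_⟩⟩
    have hw' := Metric.ball_subset_ball (min_le_right _ _) hw
    rw [mem_ball_iff_norm] at hw'
    have h3 := (Complex.abs_im_le_norm (w - w₀)).trans hw'.le
    rw [Complex.sub_im, abs_le] at h3
    refine le_trans ?_ (Complex.abs_im_le_norm _)
    refine le_trans ?_ (le_abs_self _)
    simp
    linarith
  · set m := min w₀.re (1 - w₀.re) with hm
    have hm0 : 0 < m := by rw [hm]; exact lt_min h1 (by linarith)
    refine ⟨min (min δ 1) (m / 2), by positivity, m / 2, by positivity, fun w hw =>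
      ⟨hball (Metric.ball_subset_ball ((min_le_left _ _).trans (min_le_left _ _)) hw),
        him _ ((min_le_left _ _).trans (min_le_right _ _)) w hw, fun s hs n => ?_⟩⟩
    have hw' := Metric.ball_subset_ball (min_le_right _ _) hw
    rw [mem_ball_iff_norm] at hw'
    have h3 := (Complex.abs_re_le_norm (w - w₀)).trans hw'.le
    rw [Complex.sub_re, abs_le] at h3
    have hm1 : m ≤ w₀.re := min_le_left _ _
    have hm2 : m ≤ 1 - w₀.re := min_le_right _ _
    refine le_trans ?_ (Complex.abs_re_le_norm _)
    simp only [Complex.sub_re, Complex.add_re, Complex.mul_re, Complex.ofReal_re, Complex.I_re,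
      mul_zero, Complex.ofReal_im, Complex.I_im, mul_one, sub_zero, Complex.intCast_re, add_zero]
    rcases le_or_gt n 0 with hn | hn
    · have : (n : ℝ) ≤ 0 := by exact_mod_cast hn
      exact le_trans (by linarith) (le_abs_self _)
    · have : (1 : ℝ) ≤ n := by exact_mod_cast hn
      exact le_trans (by linarith) (neg_le_abs _)

lemma tendsto_logOneSub_vertical (w : ℂ) :
    Tendsto (fun s : ℝ => logOneSub (w + s * Complex.I)) atTop (𝓝 0) := by
  have hπ := Real.pi_gt_three
  refine squeeze_zero_norm' (a := fun s => 2 * Real.exp (-(2 * Real.pi * w.im)) * Real.exp (-s))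
    ?_ ?_
  · filter_upwards [eventually_ge_atTop (1 - w.im), eventually_ge_atTop 0] with s hs hs0
    refine (norm_logOneSub_le (by simp; linarith)).trans ?_
    rw [mul_assoc 2 (Real.exp _), ← Real.exp_add]
    gcongr
    simp only [Complex.add_im, Complex.mul_im, Complex.ofReal_re, Complex.I_im, mul_one,
      Complex.ofReal_im, Complex.I_re, mul_zero, add_zero]
    nlinarith
  · simpa using (Real.tendsto_exp_neg_atTop_nhds_zero).const_mul
      (2 * Real.exp (-(2 * Real.pi * w.im)))

/-- Differentiation under the integral sign, followed by the fundamental theorem of calculus on the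
vertical ray. -/
lemma hasDerivAt_logPrim {w₀ : ℂ} (hw : w₀ ∈ logDomain) :
    HasDerivAt logPrim (logOneSub w₀) w₀ := by
  obtain ⟨ε, hε, ρ, hρ, hnear⟩ := exists_nhds_vertical hw
  obtain ⟨C, hC0, hC⟩ := exists_norm_logOneSubDeriv_le (|w₀.im| + 1) hρ
  have hπ := Real.pi_gt_three
  set D := C * Real.exp (2 * Real.pi * (|w₀.im| + 1)) with hD
  have hbound : ∀ w ∈ Metric.ball w₀ ε, ∀ s : ℝ, 0 ≤ s →
      ‖logOneSubDeriv (w + s * Complex.I)‖ ≤ D * Real.exp (-s) := by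
    intro w hw s hs
    obtain ⟨-, h2, h3⟩ := hnear w hw
    have him : (w + s * Complex.I).im = w.im + s := by simp
    refine (hC _ (by rw [him]; linarith) (h3 s hs)).trans ?_
    rw [hD, mul_assoc C (Real.exp _), ← Real.exp_add, him]
    gcongr
    nlinarith
  have hcont : ∀ w ∈ Metric.ball w₀ ε,
      ContinuousOn (fun s : ℝ => logOneSub (w + s * Complex.I)) (Set.Ioi 0) := fun w hw =>
    continuousOn_logOneSub.comp (by fun_prop)
      fun s hs => add_mul_I_mem_logDomain (hnear w hw).1 (le_of_lt hs)
  have hder : ∀ w ∈ Metric.ball w₀ ε, ∀ s : ℝ, 0 ≤ s →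
      HasDerivAt (fun w => logOneSub (w + s * Complex.I)) (logOneSubDeriv (w + s * Complex.I)) w :=
    fun w hw s hs => by
      have := hasDerivAt_logOneSub (add_mul_I_mem_logDomain (hnear w hw).1 hs)
      exact this.comp_add_const w _
  have hmain := hasDerivAt_integral_of_dominated_loc_of_deriv_le
    (μ := MeasureTheory.volume.restrict (Set.Ioi (0 : ℝ)))
    (F := fun w s => logOneSub (w + s * Complex.I))
    (F' := fun w s => logOneSubDeriv (w + s * Complex.I)) (x₀ := w₀)
    (bound := fun s => D * Real.exp (-s)) (Metric.ball_mem_nhds w₀ hε)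
    (by
      filter_upwards [Metric.ball_mem_nhds w₀ hε] with w hw
      exact (hcont w hw).aestronglyMeasurable measurableSet_Ioi)
    (integrableOn_logOneSub hw)
    (by
      refine ContinuousOn.aestronglyMeasurable (fun s hs => ?_) measurableSet_Ioi
      have h1 := add_mul_I_mem_logDomain hw (le_of_lt hs)
      have h2 := one_sub_cyc_ne_zero h1
      unfold logOneSubDeriv
      refine ContinuousAt.continuousWithinAt ?_
      have hc : Continuous fun s : ℝ => cyc (w₀ + s * Complex.I) :=
        continuous_cyc.comp (by fun_prop)
      exact (hc.continuousAt.const_mul _).div (hc.continuousAt.const_sub _) h2)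
    (by
      refine (MeasureTheory.ae_restrict_iff' measurableSet_Ioi).mpr (Eventually.of_forall ?_)
      exact fun s hs w hw => hbound w hw s (le_of_lt hs))
    (by
      have := integrableOn_exp_neg_Ioi 0
      exact this.const_mul D)
    (by
      refine (MeasureTheory.ae_restrict_iff' measurableSet_Ioi).mpr (Eventually.of_forall ?_)
      exact fun s hs w hw => hder w hw s (le_of_lt hs))
  have hval : ∫ s in Set.Ioi (0 : ℝ), logOneSubDeriv (w₀ + s * Complex.I) =
      Complex.I * logOneSub w₀ := by
    have h1 : ∀ s ∈ Set.Ici (0 : ℝ), HasDerivAt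
        (fun s : ℝ => -Complex.I * logOneSub (w₀ + s * Complex.I))
        (logOneSubDeriv (w₀ + s * Complex.I)) s := by
      intro s hs
      have h2 := hasDerivAt_logOneSub (add_mul_I_mem_logDomain hw hs)
      have h3 : HasDerivAt (fun s : ℝ => w₀ + s * Complex.I) Complex.I s := by
        simpa using ((Complex.ofRealCLM.hasDerivAt (x := s)).mul_const Complex.I).const_add w₀
      have h4 := (h2.comp s h3).const_mul (-Complex.I)
      refine h4.congr_deriv ?_
      linear_combination -(logOneSubDeriv (w₀ + s * Complex.I)) * Complex.I_mul_I
    have h5 := MeasureTheory.integral_Ioi_of_hasDerivAt_of_tendsto' h1 hmain.1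
      (m := -Complex.I * 0) ((tendsto_logOneSub_vertical w₀).const_mul _)
    rw [h5]
    simp
  have := hmain.2.const_mul (-Complex.I)
  rw [hval] at this
  refine this.congr_deriv ?_
  linear_combination -(logOneSub w₀) * Complex.I_mul_I

/-! ### The asymptotic expansion of the infinite product -/

lemma hasDerivAt_logChain (k : ℕ) {w : ℂ} (hw : w ∈ logDomain) :
    HasDerivAt (logChain k) (logChain (k + 1) w) w := by
  rcases k with _ | k
  · simpa [logChain] using hasDerivAt_logPrim hw
  · have h : DifferentiableAt ℂ (iteratedDeriv k logOneSub) w := by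
      rw [iteratedDeriv_eq_iterate]
      exact ((analyticAt_logOneSub hw).iterated_deriv k).differentiableAt
    have := h.hasDerivAt
    simp only [logChain]
    rwa [iteratedDeriv_succ]

lemma analyticAt_logChain (k : ℕ) {w : ℂ} (hw : w ∈ logDomain) : AnalyticAt ℂ (logChain k) w :=
  DifferentiableOn.analyticAt (s := logDomain)
    (fun _ hz => (hasDerivAt_logChain k hz).differentiableAt.differentiableWithinAt)
    (isOpen_logDomain.mem_nhds hw)

/-- All derivatives of `log (1 - e(w))` decay like `e(w)`, by Cauchy's estimates on small discs. -/
lemma exists_norm_logChain_le (k : ℕ) {ρ : ℝ} (hρ : 0 < ρ) :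
    ∃ C > 0, ∀ w ∈ logRegion ρ,
      ‖logChain (k + 2) w‖ ≤ C * Real.exp (-(2 * Real.pi * w.im)) := by
  set r := min ρ 1 / 2 with hr
  have hr0 : 0 < r := by positivity
  have hr1 : r ≤ 1 / 2 := by rw [hr]; linarith [min_le_right ρ 1]
  have hr2 : r ≤ ρ / 2 := by rw [hr]; linarith [min_le_left ρ 1]
  obtain ⟨C, hC0, hC⟩ := exists_norm_logOneSubDeriv_le 2 (half_pos hρ)
  have hπ := Real.pi_pos
  refine ⟨k.factorial * (C * Real.exp (2 * Real.pi)) / r ^ k, by positivity, fun w hw => ?_⟩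
  obtain ⟨h1, h2, h3⟩ := hw
  have hnear : ∀ z ∈ Metric.closedBall w r, -2 ≤ z.im ∧ (∀ n : ℤ, ρ / 2 ≤ ‖z - n‖) ∧
      w.im - 1 ≤ z.im := by
    intro z hz
    rw [mem_closedBall_iff_norm] at hz
    have h4 := (Complex.abs_im_le_norm (z - w)).trans hz
    rw [Complex.sub_im, abs_le] at h4
    refine ⟨by linarith, fun n => ?_, by linarith⟩
    have h5 : ‖w - n‖ ≤ ‖z - n‖ + ‖z - w‖ := by
      have := norm_sub_le (z - n) (z - w)
      simpa using this
    linarith [h3 n]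
  have hne : ∀ z ∈ Metric.closedBall w r, 1 - cyc z ≠ 0 := by
    intro z hz
    refine one_sub_cyc_ne_zero_of_ne fun n hn => ?_
    have := (hnear z hz).2.1 n
    rw [hn, sub_self, norm_zero] at this
    linarith
  have heq : deriv logOneSub =ᶠ[𝓝 w] logOneSubDeriv := by
    filter_upwards [isOpen_logDomain.mem_nhds h1] with z hz
    exact (hasDerivAt_logOneSub hz).deriv
  have hval : logChain (k + 2) w = iteratedDeriv k logOneSubDeriv w := by
    simp only [logChain]
    rw [iteratedDeriv_succ']
    exact heq.iteratedDeriv_eq k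
  have hdiff : DiffContOnCl ℂ logOneSubDeriv (Metric.ball w r) := by
    refine DifferentiableOn.diffContOnCl (fun z hz => ?_)
    rw [closure_ball _ hr0.ne'] at hz
    unfold logOneSubDeriv
    have hd := (hasDerivAt_cyc z).differentiableAt
    exact ((hd.const_mul _).div (hd.const_sub _) (hne z hz)).differentiableWithinAt
  rw [hval]
  refine (Complex.norm_iteratedDeriv_le_of_forall_mem_sphere_norm_le k hr0 hdiff
    (C := C * Real.exp (2 * Real.pi) * Real.exp (-(2 * Real.pi * w.im))) ?_).trans (le_of_eq ?_)
  · intro z hz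
    obtain ⟨h4, h5, h6⟩ := hnear z (Metric.sphere_subset_closedBall hz)
    refine (hC z h4 h5).trans ?_
    rw [mul_assoc C, ← Real.exp_add]
    gcongr
    nlinarith
  · ring

lemma norm_logPrim_le {w : ℂ} (hw : 1 ≤ w.im) :
    ‖logPrim w‖ ≤ 2 * Real.exp (-(2 * Real.pi * w.im)) := by
  have hπ := Real.pi_gt_three
  rw [logPrim, norm_mul, norm_neg, Complex.norm_I, one_mul]
  have h1 : ∀ s ∈ Set.Ioi (0 : ℝ), ‖logOneSub (w + s * Complex.I)‖ ≤
      2 * Real.exp (-(2 * Real.pi * w.im)) * Real.exp (-s) := by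
    intro s hs
    have hs' : 0 < s := hs
    refine (norm_logOneSub_le (by simp; linarith)).trans ?_
    rw [mul_assoc 2 (Real.exp _), ← Real.exp_add]
    gcongr
    simp only [Complex.add_im, Complex.mul_im, Complex.ofReal_re, Complex.I_im, mul_one,
      Complex.ofReal_im, Complex.I_re, mul_zero, add_zero]
    nlinarith
  refine (MeasureTheory.norm_integral_le_of_norm_le
    ((integrableOn_exp_neg_Ioi 0).const_mul _)
    ((MeasureTheory.ae_restrict_iff' measurableSet_Ioi).mpr (Eventually.of_forall h1))).trans ?_
  rw [MeasureTheory.integral_const_mul, integral_exp_neg_Ioi]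
  simp

lemma mem_logRegion_one {w : ℂ} (hw : 1 ≤ w.im) : w ∈ logRegion 1 := by
  refine ⟨Or.inl (by linarith), by linarith, fun n => ?_⟩
  refine le_trans ?_ (Complex.abs_im_le_norm _)
  simp only [Complex.sub_im, Complex.intCast_im, sub_zero]
  exact hw.trans (le_abs_self _)

lemma exists_norm_logChain_le_of_one_le_im (k : ℕ) :
    ∃ C > 0, ∀ w : ℂ, 1 ≤ w.im → ‖logChain k w‖ ≤ C * Real.exp (-(2 * Real.pi * w.im)) := by
  rcases k with _ | _ | k
  · exact ⟨2, two_pos, fun w hw => norm_logPrim_le hw⟩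
  · exact ⟨2, two_pos, fun w hw => by simpa [logChain] using norm_logOneSub_le hw⟩
  · obtain ⟨C, hC0, hC⟩ := exists_norm_logChain_le k one_pos
    exact ⟨C, hC0, fun w hw => hC w (mem_logRegion_one hw)⟩

lemma im_add_nat_mul (v τ : ℂ) (J : ℝ) : (v + J * τ).im = v.im + J * τ.im := by
  simp

lemma exists_norm_logChain_ray_le (k : ℕ) (v : ℂ) {τ : ℂ} (hτ : 0 < τ.im) :
    ∃ C : ℝ, ∀ᶠ t : ℝ in atTop, ‖logChain k (v + t * τ)‖ ≤ C * Real.exp (-(τ.im * t)) := by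
  have hπ := Real.pi_gt_three
  obtain ⟨C, hC0, hC⟩ := exists_norm_logChain_le_of_one_le_im k
  refine ⟨C * Real.exp (-(2 * Real.pi * v.im)), ?_⟩
  filter_upwards [eventually_ge_atTop ((1 - v.im) / τ.im), eventually_ge_atTop 0] with t ht ht0
  rw [div_le_iff₀ hτ] at ht
  have him := im_add_nat_mul v τ t
  refine (hC _ (by rw [him]; linarith)).trans ?_
  rw [mul_assoc C, ← Real.exp_add, him]
  have : 0 ≤ t * τ.im := by positivity
  gcongr
  nlinarith

lemma tendsto_logChain_ray (k : ℕ) (v : ℂ) {τ : ℂ} (hτ : 0 < τ.im) :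
    Tendsto (fun t : ℝ => logChain k (v + t * τ)) atTop (𝓝 0) := by
  obtain ⟨C, hC⟩ := exists_norm_logChain_ray_le k v hτ
  refine squeeze_zero_norm' hC ?_
  have h1 : Tendsto (fun t : ℝ => -(τ.im * t)) atTop atBot :=
    tendsto_neg_atTop_atBot.comp (tendsto_id.const_mul_atTop hτ)
  simpa using (Real.tendsto_exp_atBot.comp h1).const_mul C

lemma hasDerivAt_logChain_ray (k : ℕ) {v τ : ℂ} {t : ℝ} (h : v + t * τ ∈ logDomain) :
    HasDerivAt (fun t : ℝ => τ ^ k * logChain k (v + t * τ))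
      (τ ^ (k + 1) * logChain (k + 1) (v + t * τ)) t := by
  have h3 : HasDerivAt (fun s : ℝ => v + s * τ) τ t := by
    simpa using ((Complex.ofRealCLM.hasDerivAt (x := t)).mul_const τ).const_add v
  refine (((hasDerivAt_logChain k h).comp t h3).const_mul (τ ^ k)).congr_deriv ?_
  rw [pow_succ]; ring

lemma exp_sum_logOneSub {v τ : ℂ} (J : ℕ) (h : ∀ t : ℝ, 0 ≤ t → v + t * τ ∈ logDomain) :
    Complex.exp (∑ j ∈ Finset.range J, logOneSub (v + (j + 1 / 2) * τ)) =
      ∏ j ∈ Finset.range J, (1 - cyc (v + (j + 1 / 2) * τ)) := by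
  rw [Complex.exp_sum]
  refine Finset.prod_congr rfl fun j _ => exp_logOneSub ?_
  have := h (j + 1 / 2) (by positivity)
  push_cast at this
  exact this

/-- The asymptotic expansion of the infinite product, uniformly over base points whose rays in the
direction of `τ` avoid the integers: the Euler–Maclaurin formula for the sum of `log (1 - e(w))` over
the midpoints `w = v + (j + 1/2) τ` of the ray. -/
lemma exists_halfPoch_eq_exp (K : ℕ) {ρ : ℝ} (hρ : 0 < ρ) :
    ∃ C > 0, ∀ τ : ℂ, 0 < τ.im → τ.im ≤ 1 → ∀ v : ℂ, (∀ t : ℝ, 0 ≤ t → v + t * τ ∈ logRegion ρ) →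
      ∃ ε : ℂ, ‖ε‖ ≤ C * ‖τ‖ ^ (2 * K + 2) / τ.im ∧
        halfPoch τ v = Complex.exp ((-(∑ k ∈ Finset.range (K + 1),
          emCoeff k * τ ^ (2 * k) * logChain (2 * k) v) + ε) / τ) := by
  obtain ⟨C, hC0, hC⟩ := exists_norm_logChain_le (2 * K) hρ
  have hπ := Real.pi_gt_three
  refine ⟨(emConst K + 1) * (C * Real.exp (2 * Real.pi)) * 4,
    by have := emConst_nonneg K; positivity, ?_⟩
  intro τ hτ hτ1 v hv
  have hv' : ∀ t : ℝ, 0 ≤ t → v + t * τ ∈ logDomain := fun t ht => (hv t ht).1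
  have hτ0 : τ ≠ 0 := by rintro rfl; simp at hτ
  set P := ∑ k ∈ Finset.range (K + 1), emCoeff k * τ ^ (2 * k) * logChain (2 * k) v with hP
  set S : ℕ → ℂ := fun J => ∑ j ∈ Finset.range J, τ * logOneSub (v + (j + 1 / 2) * τ) with hS
  set D := C * Real.exp (2 * Real.pi) * ‖τ‖ ^ (2 * K + 2) with hD
  set x := Real.exp (-τ.im) with hx
  have hx0 : 0 < x := Real.exp_pos _
  have hx1 : x < 1 := by rw [hx, Real.exp_lt_one_iff]; linarith
  have hgeom : ∀ J : ℕ, ∑ j ∈ Finset.range J, x ^ j ≤ 4 / τ.im := by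
    intro J
    have h1 : ∑ j ∈ Finset.range J, x ^ j ≤ (1 - x)⁻¹ := by
      rw [← tsum_geometric_of_lt_one hx0.le hx1]
      exact (summable_geometric_of_lt_one hx0.le hx1).sum_le_tsum _ fun _ _ => by positivity
    have h2 : τ.im / 4 ≤ 1 - x := by
      -- `e^{-t} ≤ 1 / (1 + t) ≤ 1 - t / 2` for `0 ≤ t ≤ 1`.
      have h3 : x * (1 + τ.im) ≤ 1 := by
        have := Real.add_one_le_exp τ.im
        calc x * (1 + τ.im) ≤ x * Real.exp τ.im := by gcongr; linarith
          _ = 1 := by rw [hx, ← Real.exp_add]; simp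
      nlinarith
    refine h1.trans ?_
    rw [inv_le_comm₀ (by linarith) (by positivity), inv_div]
    exact h2
  -- The Euler–Maclaurin formula for the partial sums, with an error independent of their length.
  have hEM : ∀ J : ℕ, ‖S J - (∑ k ∈ Finset.range (K + 1), emCoeff k *
      (τ ^ (2 * k) * logChain (2 * k) (v + J * τ)) - P)‖ ≤ emConst K * (D * (4 / τ.im)) := by
    intro J
    have h := euler_maclaurin_sum (a := 0) J K (fun k t => τ ^ k * logChain k (v + t * τ))
      (fun j => D * x ^ j)
      (fun k _ t ht => hasDerivAt_logChain_ray k (hv' t ht.1)) (by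
        intro j _ t ht
        have hj : (0 : ℝ) ≤ j := j.cast_nonneg
        have ht0 : 0 ≤ t := by linarith [ht.1]
        have h1 := hC _ (hv t ht0)
        have him := im_add_nat_mul v τ t
        have hvim : -1 ≤ v.im := by simpa using (hv 0 le_rfl).2.1
        rw [norm_mul, norm_pow, hD, hx, ← Real.exp_nat_mul]
        calc _ ≤ ‖τ‖ ^ (2 * K + 2) * (C * Real.exp (-(2 * Real.pi * (v + t * τ).im))) := by gcongr
          _ ≤ ‖τ‖ ^ (2 * K + 2) * (C * Real.exp (2 * Real.pi + j * -τ.im)) := by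
            rw [him]
            gcongr
            have h5 : (j : ℝ) * τ.im ≤ t * τ.im := by
              have := ht.1
              gcongr
              linarith
            have h6 : 0 ≤ t * τ.im := by positivity
            nlinarith
          _ = _ := by rw [Real.exp_add]; ring)
    have e1 : ∑ j ∈ Finset.range J, τ ^ 1 * logChain 1 (v + ((0 + j + 1 / 2 : ℝ) : ℂ) * τ) = S J := by
      rw [hS]
      refine Finset.sum_congr rfl fun j _ => ?_
      simp [logChain]
    have e2 : ∑ k ∈ Finset.range (K + 1), emCoeff k *
        (τ ^ (2 * k) * logChain (2 * k) (v + ((0 + J : ℝ) : ℂ) * τ) -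
          τ ^ (2 * k) * logChain (2 * k) (v + ((0 : ℝ) : ℂ) * τ)) =
        ∑ k ∈ Finset.range (K + 1), emCoeff k *
          (τ ^ (2 * k) * logChain (2 * k) (v + J * τ)) - P := by
      rw [hP, ← Finset.sum_sub_distrib]
      refine Finset.sum_congr rfl fun k _ => ?_
      simp
      ring
    rw [e1, e2] at h
    refine h.trans ?_
    rw [← Finset.mul_sum]
    have := hgeom J
    have := emConst_nonneg K
    gcongr
  -- The boundary terms at the far end of the ray tend to zero.
  have hPlim : Tendsto (fun J : ℕ => ∑ k ∈ Finset.range (K + 1), emCoeff k *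
      (τ ^ (2 * k) * logChain (2 * k) (v + J * τ)) - P) atTop (𝓝 (0 - P)) := by
    refine Tendsto.sub_const ?_ _
    have : (0 : ℂ) = ∑ k ∈ Finset.range (K + 1), emCoeff k * (τ ^ (2 * k) * 0) := by simp
    rw [this]
    refine tendsto_finsetSum _ fun k _ => ((Tendsto.const_mul _ ?_).const_mul _)
    have := (tendsto_logChain_ray (2 * k) v hτ).comp tendsto_natCast_atTop_atTop
    simpa [Function.comp_def] using this
  have hsum : Summable fun j : ℕ => τ * logOneSub (v + (j + 1 / 2) * τ) := by
    obtain ⟨C', hC'⟩ := exists_norm_logChain_ray_le 1 v hτ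
    have hlim : Tendsto (fun j : ℕ => (j : ℝ) + 1 / 2) atTop atTop :=
      tendsto_atTop_add_const_right _ _ tendsto_natCast_atTop_atTop
    refine Summable.mul_left _ (summable_of_isBigO_nat (g := fun j : ℕ => x ^ j)
      (summable_geometric_of_lt_one hx0.le hx1) ?_)
    refine Asymptotics.IsBigO.of_bound (|C'|) ?_
    filter_upwards [hlim.eventually hC'] with j hj
    have e : v + (((j : ℝ) + 1 / 2 : ℝ) : ℂ) * τ = v + (j + 1 / 2) * τ := by push_cast; rfl
    rw [e] at hj
    simp only [logChain, iteratedDeriv_zero] at hj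
    refine hj.trans ?_
    rw [Real.norm_of_nonneg (by positivity), hx, ← Real.exp_nat_mul]
    calc _ ≤ |C'| * Real.exp (-(τ.im * (j + 1 / 2))) := by gcongr; exact le_abs_self _
      _ ≤ _ := by gcongr; nlinarith
  have hSlim : Tendsto S atTop (𝓝 (∑' j : ℕ, τ * logOneSub (v + (j + 1 / 2) * τ))) :=
    hsum.hasSum.tendsto_sum_nat
  set T := ∑' j : ℕ, τ * logOneSub (v + (j + 1 / 2) * τ) with hT
  have hbound : ‖T - (0 - P)‖ ≤ emConst K * (D * (4 / τ.im)) :=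
    le_of_tendsto (hSlim.sub hPlim).norm (Eventually.of_forall hEM)
  refine ⟨T + P, ?_, ?_⟩
  · have e : T - (0 - P) = T + P := by ring
    rw [e] at hbound
    refine hbound.trans ?_
    rw [hD]
    have : 0 ≤ C * Real.exp (2 * Real.pi) * ‖τ‖ ^ (2 * K + 2) * (4 / τ.im) := by positivity
    calc _ ≤ (emConst K + 1) * (C * Real.exp (2 * Real.pi) * ‖τ‖ ^ (2 * K + 2) * (4 / τ.im)) := by
          nlinarith
      _ = _ := by ring
  · have h1 : Tendsto (fun J => Complex.exp (S J / τ)) atTop (𝓝 (Complex.exp (T / τ))) :=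
      (Complex.continuous_exp.tendsto _).comp (hSlim.div_const τ)
    have h2 : ∀ J, Complex.exp (S J / τ) = ∏ j ∈ Finset.range J,
        (1 - cyc v * cyc (τ / 2) * cyc τ ^ j) := by
      intro J
      rw [hS]
      simp only
      rw [← Finset.mul_sum, mul_div_cancel_left₀ _ hτ0, exp_sum_logOneSub J hv']
      simp only [cyc_half_shift]
    rw [halfPoch_eq]
    have h3 := (tendsto_prod_one_sub_mul_pow (norm_cyc_lt_one hτ) (cyc v * cyc (τ / 2)))
    have h4 := tendsto_nhds_unique (h1.congr h2) h3
    rw [← h4]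
    congr 2
    ring

/-! ### The phase function and the volume -/

/-- The coefficients, as functions of the base point, of the expansion of the logarithm of the kernel,
up to the Euler–Maclaurin coefficients. -/
noncomputable def phaseCoeff (k : ℕ) (v : ℂ) : ℂ := logChain (2 * k) (1 - v) - logChain (2 * k) v

/-- The truncated expansion of the logarithm of the kernel: `phaseCoeff 0 v / τ`, plus corrections
with odd powers of `τ`. -/
noncomputable def wkb (K : ℕ) (τ v : ℂ) : ℂ :=
  (∑ k ∈ Finset.range (K + 1), emCoeff k * τ ^ (2 * k) * phaseCoeff k v) / τ

/-- The real phase function `Im Li_2(e(v)) / π`. -/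
noncomputable def phase (v : ℝ) : ℝ := (dilog (cyc v)).im / Real.pi

lemma one_sub_mem_logDomain {v : ℂ} (h0 : 0 < v.re) (h1 : v.re < 1) : 1 - v ∈ logDomain := by
  right; simp; constructor <;> linarith

lemma mem_logDomain {v : ℂ} (h0 : 0 < v.re) (h1 : v.re < 1) : v ∈ logDomain := Or.inr ⟨h0, h1⟩

lemma analyticAt_phaseCoeff (k : ℕ) {v : ℂ} (h0 : 0 < v.re) (h1 : v.re < 1) :
    AnalyticAt ℂ (phaseCoeff k) v := by
  have h2 : AnalyticAt ℂ (fun v : ℂ => 1 - v) v := analyticAt_const.sub analyticAt_id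
  exact ((analyticAt_logChain (2 * k) (one_sub_mem_logDomain h0 h1)).comp h2).sub
    (analyticAt_logChain (2 * k) (mem_logDomain h0 h1))

lemma hasDerivAt_phaseCoeff_zero {v : ℂ} (h0 : 0 < v.re) (h1 : v.re < 1) :
    HasDerivAt (phaseCoeff 0) (-(logOneSub (1 - v)) - logOneSub v) v := by
  have h2 : HasDerivAt (fun v : ℂ => 1 - v) (-1) v := by
    simpa using (hasDerivAt_id v).const_sub 1
  have h3 := (hasDerivAt_logPrim (one_sub_mem_logDomain h0 h1)).comp v h2
  have h4 := h3.sub (hasDerivAt_logPrim (mem_logDomain h0 h1))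
  refine HasDerivAt.congr_deriv (f := phaseCoeff 0) h4 ?_
  ring

lemma conj_cyc (w : ℂ) : (starRingEnd ℂ) (cyc w) = cyc (-(starRingEnd ℂ) w) := by
  rw [cyc, ← Complex.exp_conj, cyc]
  simp [map_ofNat]

lemma conj_cyc_ofReal (v : ℝ) : (starRingEnd ℂ) (cyc v) = cyc (-v) := by
  rw [conj_cyc, Complex.conj_ofReal]

lemma cyc_one_sub (v : ℂ) : cyc (1 - v) = cyc (-v) := by
  have := cyc_add_int (-v) 1
  rw [← this]; congr 1; push_cast; ring

lemma norm_one_sub_cyc {v : ℝ} (h0 : 0 ≤ v) (h1 : v ≤ 1) :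
    ‖1 - cyc v‖ = 2 * Real.sin (Real.pi * v) := by
  have hs : 0 ≤ Real.sin (Real.pi * v) :=
    Real.sin_nonneg_of_nonneg_of_le_pi (by have := Real.pi_pos; positivity)
      (by have := Real.pi_pos; nlinarith)
  have h : 1 - cyc v = cyc (v / 2) * (-2 * Complex.I * Real.sin (Real.pi * v)) := by
    have e1 : cyc v = cyc (v / 2) * cyc (v / 2) := by rw [← cyc_add]; congr 1; ring
    have e2 : (1 : ℂ) = cyc (v / 2) * cyc (-(v / 2)) := by rw [← cyc_add]; simp
    have e3 : (2 : ℂ) * Complex.I * Real.sin (Real.pi * v) = cyc (v / 2) - cyc (-(v / 2)) := by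
      rw [Complex.ofReal_sin, Complex.sin, cyc, cyc]
      push_cast
      have a1 : 2 * (Real.pi : ℂ) * Complex.I * (v / 2) = Real.pi * v * Complex.I := by ring
      have a2 : 2 * (Real.pi : ℂ) * Complex.I * -(v / 2) = -(Real.pi * v) * Complex.I := by ring
      rw [a1, a2]
      linear_combination (Complex.exp (-(Real.pi * v) * Complex.I) -
        Complex.exp (Real.pi * v * Complex.I)) * Complex.I_mul_I
    linear_combination e2 - e1 + cyc (v / 2) * e3
  have e4 := norm_cyc_ofReal (v / 2)
  push_cast at e4
  rw [h, norm_mul, e4, one_mul, norm_mul, Complex.norm_real, Real.norm_of_nonneg hs]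
  simp

lemma logOneSub_add_reflect {v : ℝ} (h0 : 0 < v) (h1 : v < 1) :
    logOneSub (1 - v) + logOneSub v = ((2 * Real.log (2 * Real.sin (Real.pi * v)) : ℝ) : ℂ) := by
  have hm : (v : ℂ) ∈ logDomain := mem_logDomain (by simpa) (by simpa)
  have e : logOneSub (1 - v) = (starRingEnd ℂ) (logOneSub v) := by
    rw [logOneSub, logOneSub, ← Complex.log_conj _
      (Complex.mem_slitPlane_iff_arg.mp (one_sub_cyc_mem_slitPlane hm)).1, cyc_one_sub, map_sub,
      conj_cyc_ofReal, map_one]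
  rw [e, add_comm, Complex.add_conj, logOneSub, Complex.log_re, norm_one_sub_cyc h0.le h1.le]

lemma summable_one_div_succ_sq : Summable fun n : ℕ => 1 / ((n : ℝ) + 1) ^ 2 := by
  have := (summable_nat_add_iff 1).mpr (Real.summable_one_div_nat_pow.mpr one_lt_two)
  simpa using this

lemma norm_dilog_term (v : ℝ) (n : ℕ) :
    ‖cyc v ^ (n + 1) / ((n : ℂ) + 1) ^ 2‖ = 1 / ((n : ℝ) + 1) ^ 2 := by
  rw [norm_div, norm_pow, norm_pow, norm_cyc_ofReal, one_pow]
  congr 2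
  exact_mod_cast Complex.norm_natCast (n + 1)

lemma continuous_phase : Continuous phase := by
  refine Continuous.div_const (Complex.continuous_im.comp ?_) _
  unfold dilog
  refine continuous_tsum (fun n => ?_) summable_one_div_succ_sq (fun n v => (norm_dilog_term v n).le)
  exact ((continuous_cyc.comp Complex.continuous_ofReal).pow _).div_const _

/-- Termwise integration of the logarithmic series along the vertical ray. -/
lemma logPrim_eq_dilog (v : ℝ) :
    logPrim v = Complex.I / (2 * Real.pi) * dilog (cyc v) := by
  have hπ := Real.pi_pos
  set F : ℕ → ℝ → ℂ := fun n s => cyc v ^ (n + 1) / ((n : ℂ) + 1) *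
    (Real.exp (-(2 * Real.pi * (n + 1)) * s) : ℂ) with hF
  have hc : ∀ n : ℕ, -(2 * Real.pi * ((n : ℝ) + 1)) < 0 := fun n => by
    have : 0 < 2 * Real.pi * ((n : ℝ) + 1) := by positivity
    linarith
  have hint : ∀ n : ℕ, ∫ s in Set.Ioi (0 : ℝ), Real.exp (-(2 * Real.pi * ((n : ℝ) + 1)) * s) =
      1 / (2 * Real.pi * ((n : ℝ) + 1)) := by
    intro n
    rw [integral_exp_mul_Ioi (hc n)]
    simp
  have hFi : ∀ n, MeasureTheory.Integrable (F n)
      (MeasureTheory.volume.restrict (Set.Ioi (0 : ℝ))) := fun n =>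
    ((integrableOn_exp_mul_Ioi (hc n) 0).ofReal).const_mul _
  have hnorm : ∀ n s, ‖F n s‖ = 1 / ((n : ℝ) + 1) * Real.exp (-(2 * Real.pi * ((n : ℝ) + 1)) * s) := by
    intro n s
    rw [hF, norm_mul, norm_div, norm_pow, norm_cyc_ofReal, one_pow, Complex.norm_real,
      Real.norm_of_nonneg (Real.exp_pos _).le]
    congr 2
    exact_mod_cast Complex.norm_natCast (n + 1)
  have hsum := MeasureTheory.hasSum_integral_of_summable_integral_norm hFi (by
    simp only [hnorm, MeasureTheory.integral_const_mul, hint]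
    refine (summable_one_div_succ_sq.mul_left (1 / (2 * Real.pi))).congr fun n => ?_
    field_simp)
  have hlog : ∀ s ∈ Set.Ioi (0 : ℝ), ∑' n, F n s = -logOneSub (v + s * Complex.I) := by
    intro s hs
    have hs' : 0 < s := hs
    have h2 := norm_cyc_lt_one (w := v + s * Complex.I) (by simpa using hs')
    have h3 := Complex.hasSum_taylorSeries_neg_log h2
    rw [← hasSum_nat_add_iff' 1] at h3
    simp only [Finset.range_one, Finset.sum_singleton, Nat.cast_zero, div_zero, sub_zero] at h3
    rw [logOneSub, ← h3.tsum_eq]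
    refine tsum_congr fun n => ?_
    rw [hF]
    simp only
    rw [cyc_add, mul_pow, div_mul_eq_mul_div]
    push_cast
    congr 2
    rw [← cyc_nat_mul, cyc]
    congr 1
    push_cast
    linear_combination (-2 * Real.pi * (n + 1) * s : ℂ) * Complex.I_mul_I
  have h4 : ∫ s in Set.Ioi (0 : ℝ), ∑' n, F n s =
      -∫ s in Set.Ioi (0 : ℝ), logOneSub (v + s * Complex.I) := by
    rw [← MeasureTheory.integral_neg]
    exact MeasureTheory.setIntegral_congr_fun measurableSet_Ioi hlog
  rw [h4] at hsum
  have h5 : ∀ n, ∫ s in Set.Ioi (0 : ℝ), F n s =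
      1 / (2 * Real.pi) * (cyc v ^ (n + 1) / ((n : ℂ) + 1) ^ 2) := by
    intro n
    rw [hF]
    simp only
    rw [MeasureTheory.integral_const_mul, integral_complex_ofReal, hint]
    have : (n : ℂ) + 1 ≠ 0 := by exact_mod_cast n.succ_ne_zero
    push_cast
    field_simp
  simp only [h5] at hsum
  have h6 := hsum.tsum_eq
  rw [tsum_mul_left] at h6
  rw [logPrim, dilog]
  have : (Real.pi : ℂ) ≠ 0 := by exact_mod_cast hπ.ne'
  linear_combination (-Complex.I) * h6

lemma dilog_conj (v : ℝ) : dilog (cyc (-v)) = (starRingEnd ℂ) (dilog (cyc v)) := by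
  rw [dilog, dilog, Complex.conj_tsum]
  refine tsum_congr fun n => ?_
  simp [conj_cyc_ofReal]

/-- On the real line the leading coefficient of the logarithm of the kernel is real. -/
lemma phaseCoeff_zero_ofReal (v : ℝ) : phaseCoeff 0 v = (phase v : ℂ) := by
  have h2 := logPrim_eq_dilog v
  have h3 := logPrim_eq_dilog (1 - v)
  push_cast at h3
  rw [cyc_one_sub] at h3
  have hπ : (Real.pi : ℂ) ≠ 0 := by exact_mod_cast Real.pi_ne_zero
  have h4 := Complex.sub_conj (dilog (cyc v))
  have : phaseCoeff 0 v = logPrim (1 - v) - logPrim v := rfl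
  rw [this, h2, h3, dilog_conj, phase]
  push_cast
  field_simp
  push_cast at h4
  linear_combination (-Complex.I) * h4 - 2 * (dilog (cyc v)).im * Complex.I_mul_I

lemma phase_zero : phase 0 = 0 := by
  have := dilog_conj 0
  simp only [Complex.ofReal_zero, neg_zero] at this
  have h := Complex.conj_eq_iff_im.mp this.symm
  rw [phase, Complex.ofReal_zero, h, zero_div]

lemma phase_one : phase 1 = 0 := by
  rw [← phase_zero, phase, phase]
  have : cyc ((1 : ℝ) : ℂ) = cyc ((0 : ℝ) : ℂ) := by
    have := cyc_int 1
    push_cast at this ⊢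
    rw [this, cyc_zero]
  rw [this]

/-- The value of the phase at the saddle point is the exponential growth rate of both asymptotic
expansions. -/
lemma phase_saddle : phase (1 / 6) = V / (2 * Real.pi) := by
  have : cyc ((1 / 6 : ℝ) : ℂ) = Complex.exp (Real.pi * Complex.I / 3) := by
    rw [cyc]; congr 1; push_cast; ring
  rw [phase, V, this]
  field_simp

/-- The derivative vanishes where `2 sin (π v) = 1`, that is, at `v = 1/6` and `v = 5/6`. -/
lemma hasDerivAt_phase {v : ℝ} (h0 : 0 < v) (h1 : v < 1) :
    HasDerivAt phase (-(2 * Real.log (2 * Real.sin (Real.pi * v)))) v := by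
  have h2 := hasDerivAt_phaseCoeff_zero (v := v) (by simpa) (by simpa)
  have h3 := h2.real_of_complex
  have h4 : (fun x : ℝ => (phaseCoeff 0 x).re) =ᶠ[𝓝 v] phase := by
    filter_upwards with x
    rw [phaseCoeff_zero_ofReal, Complex.ofReal_re]
  refine (h3.congr_of_eventuallyEq h4.symm).congr_deriv ?_
  have h5 := logOneSub_add_reflect h0 h1
  have h6 : -(logOneSub (1 - v)) - logOneSub v =
      ((-(2 * Real.log (2 * Real.sin (Real.pi * v))) : ℝ) : ℂ) := by
    push_cast at h5 ⊢
    linear_combination -h5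
  rw [h6, Complex.ofReal_re]

lemma sin_pi_mul_lt {x y : ℝ} (hx : 0 ≤ x) (hxy : x < y) (hy : y ≤ 1 / 2) :
    Real.sin (Real.pi * x) < Real.sin (Real.pi * y) := by
  have hπ := Real.pi_pos
  exact Real.sin_lt_sin_of_lt_of_le_pi_div_two (by nlinarith) (by nlinarith) (by nlinarith)

lemma sin_pi_div_six' : Real.sin (Real.pi * (1 / 6)) = 1 / 2 := by
  rw [show Real.pi * (1 / 6) = Real.pi / 6 by ring, Real.sin_pi_div_six]

lemma sin_pi_one_sub (x : ℝ) : Real.sin (Real.pi * (1 - x)) = Real.sin (Real.pi * x) := by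
  rw [mul_sub, mul_one, Real.sin_pi_sub]

lemma two_sin_lt_one {v : ℝ} (h0 : 0 < v) (h1 : v < 1 / 6) :
    0 < 2 * Real.sin (Real.pi * v) ∧ 2 * Real.sin (Real.pi * v) < 1 := by
  have a := sin_pi_mul_lt h0.le h1 (by norm_num)
  have b := sin_pi_mul_lt le_rfl h0 (by linarith)
  rw [sin_pi_div_six'] at a
  simp at b
  constructor <;> linarith

lemma one_lt_two_sin {v : ℝ} (h0 : 1 / 6 < v) (h1 : v < 5 / 6) :
    1 < 2 * Real.sin (Real.pi * v) := by
  rcases le_total v (1 / 2) with h | h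
  · have a := sin_pi_mul_lt (by norm_num) h0 h
    rw [sin_pi_div_six'] at a
    linarith
  · have a := sin_pi_mul_lt (x := 1 / 6) (y := 1 - v) (by norm_num) (by linarith) (by linarith)
    rw [sin_pi_div_six', sin_pi_one_sub] at a
    linarith

lemma strictMonoOn_phase_left : StrictMonoOn phase (Set.Icc 0 (1 / 6)) := by
  refine strictMonoOn_of_deriv_pos (convex_Icc _ _) continuous_phase.continuousOn fun v hv => ?_
  rw [interior_Icc] at hv
  rw [(hasDerivAt_phase hv.1 (by linarith [hv.2])).deriv]
  obtain ⟨h1, h2⟩ := two_sin_lt_one hv.1 hv.2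
  linarith [Real.log_neg h1 h2]

lemma strictAntiOn_phase : StrictAntiOn phase (Set.Icc (1 / 6) (5 / 6)) := by
  refine strictAntiOn_of_deriv_neg (convex_Icc _ _) continuous_phase.continuousOn fun v hv => ?_
  rw [interior_Icc] at hv
  rw [(hasDerivAt_phase (by linarith [hv.1]) (by linarith [hv.2])).deriv]
  have h1 := one_lt_two_sin hv.1 hv.2
  linarith [Real.log_pos h1]

lemma strictMonoOn_phase_right : StrictMonoOn phase (Set.Icc (5 / 6) 1) := by
  refine strictMonoOn_of_deriv_pos (convex_Icc _ _) continuous_phase.continuousOn fun v hv => ?_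
  rw [interior_Icc] at hv
  rw [(hasDerivAt_phase (by linarith [hv.1]) hv.2).deriv]
  obtain ⟨h1, h2⟩ := two_sin_lt_one (v := 1 - v) (by linarith [hv.2]) (by linarith [hv.1])
  rw [sin_pi_one_sub] at h1 h2
  linarith [Real.log_neg h1 h2]

lemma phase_saddle_pos : 0 < phase (1 / 6) := by
  rw [← phase_zero]
  exact strictMonoOn_phase_left ⟨le_rfl, by norm_num⟩ ⟨by norm_num, le_rfl⟩ (by norm_num)

/-- The phase function has its unique maximum on a period at `1/6`. -/
lemma phase_lt_saddle {v : ℝ} (h0 : 0 ≤ v) (h1 : v ≤ 1) (hv : v ≠ 1 / 6) :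
    phase v < phase (1 / 6) := by
  rcases lt_or_gt_of_ne hv with h | h
  · exact strictMonoOn_phase_left ⟨h0, h.le⟩ ⟨by norm_num, le_rfl⟩ h
  rcases le_total v (5 / 6) with h2 | h2
  · exact strictAntiOn_phase ⟨le_rfl, by norm_num⟩ ⟨h.le, h2⟩ h
  · have h3 := strictMonoOn_phase_right.monotoneOn ⟨h2, h1⟩ ⟨by norm_num, le_rfl⟩ h1
    rw [phase_one] at h3
    linarith [phase_saddle_pos]

/-! ### Asymptotics of the kernel and of the terms of the Kashaev invariant -/

lemma halfPoch_neg (τ v : ℂ) : halfPoch τ (-v) = halfPoch τ (1 - v) := by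
  rw [halfPoch_eq, halfPoch_eq, cyc_one_sub]

/-- The expansion of the kernel, uniformly over base points whose rays avoid the integers. -/
lemma exists_kernel_eq_exp (K : ℕ) {ρ : ℝ} (hρ : 0 < ρ) :
    ∃ C > 0, ∀ τ : ℂ, 0 < τ.im → τ.im ≤ 1 → ∀ v : ℂ, (∀ t : ℝ, 0 ≤ t → v + t * τ ∈ logRegion ρ) →
      (∀ t : ℝ, 0 ≤ t → 1 - v + t * τ ∈ logRegion ρ) →
      ∃ ε : ℂ, ‖ε‖ ≤ C * ‖τ‖ ^ (2 * K + 1) / τ.im ∧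
        kernel τ v = Complex.exp (wkb K τ v + ε) := by
  obtain ⟨C, hC0, hC⟩ := exists_halfPoch_eq_exp K hρ
  refine ⟨2 * C, by positivity, fun τ hτ hτ1 v h1 h2 => ?_⟩
  obtain ⟨ε₁, hε₁, e₁⟩ := hC τ hτ hτ1 v h1
  obtain ⟨ε₂, hε₂, e₂⟩ := hC τ hτ hτ1 (1 - v) h2
  have hτ0 : τ ≠ 0 := by rintro rfl; simp at hτ
  have hn : 0 < ‖τ‖ := norm_pos_iff.mpr hτ0
  refine ⟨(ε₁ - ε₂) / τ, ?_, ?_⟩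
  · rw [norm_div, div_le_iff₀ hn]
    refine (norm_sub_le _ _).trans ((add_le_add hε₁ hε₂).trans (le_of_eq ?_))
    rw [pow_succ _ (2 * K + 1)]
    ring
  · rw [kernel, halfPoch_neg, e₁, e₂, ← Complex.exp_sub]
    congr 1
    rw [wkb, ← sub_div, ← add_div]
    congr 1
    simp only [phaseCoeff, mul_sub, Finset.sum_sub_distrib]
    ring

lemma isPrimitiveRoot_cyc {N : ℕ} (hN : N ≠ 0) : IsPrimitiveRoot (cyc (1 / N)) N := by
  have := Complex.isPrimitiveRoot_exp N hN
  rw [cyc]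
  convert this using 2
  ring

/-- The reflection formula `|(ζ;ζ)_{N-1-m}|² = N ∏_{m < j < N - m} (1 - ζ^j)`. -/
lemma norm_qPoch_sq_eq {N m : ℕ} (hm : 2 * m + 1 ≤ N) :
    ((‖qPoch (cyc (1 / N)) (N - 1 - m)‖ ^ 2 : ℝ) : ℂ) =
      N * ∏ j ∈ Finset.range (N - 1 - 2 * m), (1 - cyc (1 / N) ^ (m + 1 + j)) := by
  set ζ := cyc (1 / N) with hζ
  have hprim : IsPrimitiveRoot ζ N := isPrimitiveRoot_cyc (by omega)
  have hfull : ∏ k ∈ Finset.range (N - 1), (1 - ζ ^ (k + 1)) = N := by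
    have h1 : N - 1 + 1 = N := by omega
    have := IsPrimitiveRoot.prod_one_sub_pow_eq_order (n := N - 1) (μ := ζ) (by rwa [h1])
    rw [this]
    exact_mod_cast congrArg (Nat.cast (R := ℂ)) h1
  -- Complex conjugation maps `ζ ^ j` to `ζ ^ (N - j)`.
  have hconj : ∀ j ≤ N, (starRingEnd ℂ) (ζ ^ j) = ζ ^ (N - j) := by
    intro j hj
    have e0 : ζ ^ j ≠ 0 := pow_ne_zero _ (cyc_ne_zero _)
    have e1 : ζ ^ (N - j) * ζ ^ j = 1 := by
      rw [← pow_add, Nat.sub_add_cancel hj, hprim.pow_eq_one]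
    have e2 : (starRingEnd ℂ) ζ * ζ = 1 := by
      rw [mul_comm, Complex.mul_conj, Complex.normSq_eq_norm_sq]
      have := norm_cyc_ofReal (1 / N)
      push_cast at this
      rw [hζ, this]; simp
    have e3 : (starRingEnd ℂ) (ζ ^ j) * ζ ^ j = 1 := by rw [map_pow, ← mul_pow, e2, one_pow]
    exact mul_right_cancel₀ e0 (e3.trans e1.symm)
  set n := N - 1 - m with hn
  have hc : (starRingEnd ℂ) (qPoch ζ n) = ∏ k ∈ Finset.range n, (1 - ζ ^ (m + 1 + k)) := by
    rw [qPoch, map_prod, ← Finset.prod_range_reflect]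
    refine Finset.prod_congr rfl fun k hk => ?_
    have hk' := Finset.mem_range.mp hk
    rw [map_sub, map_one, hconj _ (by omega)]
    congr 2
    omega
  have h1 : ((‖qPoch ζ n‖ ^ 2 : ℝ) : ℂ) = qPoch ζ n * (starRingEnd ℂ) (qPoch ζ n) := by
    rw [Complex.mul_conj, Complex.normSq_eq_norm_sq]
  have h2 : n = (N - 1 - 2 * m) + m := by omega
  have h3 : N - 1 = n + m := by omega
  have h4 : ∏ k ∈ Finset.range n, (1 - ζ ^ (m + 1 + k)) =
      (∏ j ∈ Finset.range (N - 1 - 2 * m), (1 - ζ ^ (m + 1 + j))) *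
        ∏ k ∈ Finset.range m, (1 - ζ ^ (n + 1 + k)) := by
    rw [h2, Finset.prod_range_add, ← h2]
    congr 1
    refine Finset.prod_congr rfl fun k _ => ?_
    congr 2
    omega
  have h5 : (N : ℂ) = qPoch ζ n * ∏ k ∈ Finset.range m, (1 - ζ ^ (n + 1 + k)) := by
    rw [← hfull, h3, Finset.prod_range_add, qPoch]
    congr 1
    refine Finset.prod_congr rfl fun k _ => ?_
    congr 2
    omega
  rw [h1, hc, h4, h5]
  ring

lemma ofReal_mem_logRegion {ρ x : ℝ} (hρ : 0 < ρ) (h0 : ρ ≤ x) (h1 : x ≤ 1 - ρ) :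
    (x : ℂ) ∈ logRegion ρ := by
  refine ⟨Or.inr ⟨by simp; linarith, by simp; linarith⟩, by simp, fun n => ?_⟩
  refine le_trans ?_ (Complex.abs_re_le_norm _)
  simp only [Complex.sub_re, Complex.ofReal_re, Complex.intCast_re]
  rcases le_or_gt n 0 with hn | hn
  · have : (n : ℝ) ≤ 0 := by exact_mod_cast hn
    exact le_trans (by linarith) (le_abs_self _)
  · have : (1 : ℝ) ≤ n := by exact_mod_cast hn
    exact le_trans (by linarith) (neg_le_abs _)

/-- The expansion of the terms of the Kashaev invariant: by the reflection formula they are products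
of `1 - e(w)` over the midpoints of a real interval symmetric about `1/2`, so the Euler–Maclaurin
formula gives the same function `wkb` as for the kernel, with `τ = 1 / N`. -/
lemma exists_norm_qPoch_sq_eq_exp (K : ℕ) {ρ : ℝ} (hρ : 0 < ρ) :
    ∃ C > 0, ∀ N m : ℕ, 2 * m + 1 ≤ N → ρ ≤ ((m : ℝ) + 1 / 2) / N →
      ∃ ε : ℂ, ‖ε‖ ≤ C * (1 / (N : ℝ)) ^ (2 * K) ∧
        ((‖qPoch (cyc (1 / N)) (N - 1 - m)‖ ^ 2 : ℝ) : ℂ) =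
          N * Complex.exp (wkb K (1 / N) ((((m : ℝ) + 1 / 2) / N : ℝ) : ℂ) + ε) := by
  obtain ⟨C, hC0, hC⟩ := exists_norm_logChain_le (2 * K) hρ
  have hE := emConst_nonneg K
  refine ⟨(emConst K + 1) * C, by positivity, fun N m hm hρm => ?_⟩
  have hN : (0 : ℝ) < N := by
    have : 0 < N := by omega
    exact_mod_cast this
  have hNC : (N : ℂ) ≠ 0 := by exact_mod_cast hN.ne'
  set v : ℝ := ((m : ℝ) + 1 / 2) / N with hv
  set τ : ℂ := 1 / N with hτ
  set J := N - 1 - 2 * m with hJ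
  have hJN : (J : ℝ) = N - 1 - 2 * m := by
    rw [hJ, Nat.sub_sub, Nat.cast_sub (by omega)]
    push_cast; ring
  have hend : v + J / N = 1 - v := by rw [hv, hJN]; field_simp; ring
  have hpt : ∀ t : ℝ, (v : ℂ) + t * τ = ((v + t / N : ℝ) : ℂ) := by
    intro t; rw [hτ]; push_cast; ring
  have hreg : ∀ t ∈ Set.Icc (0 : ℝ) J, (v : ℂ) + t * τ ∈ logRegion ρ := by
    intro t ht
    rw [hpt]
    have h1 : 0 ≤ t / N := div_nonneg ht.1 hN.le
    have h2 : t / N ≤ J / N := by gcongr; exact ht.2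
    exact ofReal_mem_logRegion hρ (by linarith) (by linarith)
  have hτn : ‖τ‖ = 1 / N := by rw [hτ, norm_div, norm_one, Complex.norm_natCast]
  have h := euler_maclaurin_sum (a := 0) J K (fun k t => τ ^ k * logChain k (v + t * τ))
    (fun _ => (1 / (N : ℝ)) ^ (2 * K + 2) * C)
    (fun k _ t ht => hasDerivAt_logChain_ray k (hreg t (by simpa using ht)).1) (by
      intro j hj t ht
      have hj2 : (j : ℝ) + 1 ≤ J := by exact_mod_cast hj
      have hj0 : (0 : ℝ) ≤ j := j.cast_nonneg
      have h1 := hC _ (hreg t ⟨by linarith [ht.1], by linarith [ht.2]⟩)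
      rw [hpt] at h1 ⊢
      simp only [Complex.ofReal_im, mul_zero, neg_zero, Real.exp_zero, mul_one] at h1
      rw [norm_mul, norm_pow, hτn]
      gcongr)
  set S := ∑ j ∈ Finset.range J, logOneSub ((v : ℂ) + (j + 1 / 2) * τ) with hS
  have e1 : ∑ j ∈ Finset.range J, τ ^ 1 * logChain 1 ((v : ℂ) + ((0 + j + 1 / 2 : ℝ) : ℂ) * τ) =
      τ * S := by
    rw [hS, Finset.mul_sum]
    refine Finset.sum_congr rfl fun j _ => ?_
    simp [logChain]
  have e2 : ∑ k ∈ Finset.range (K + 1), emCoeff k *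
      (τ ^ (2 * k) * logChain (2 * k) ((v : ℂ) + ((0 + J : ℝ) : ℂ) * τ) -
        τ ^ (2 * k) * logChain (2 * k) ((v : ℂ) + ((0 : ℝ) : ℂ) * τ)) = τ * wkb K τ v := by
    have hτ0 : τ ≠ 0 := by rw [hτ]; exact one_div_ne_zero hNC
    rw [wkb, mul_div_cancel₀ _ hτ0]
    refine Finset.sum_congr rfl fun k _ => ?_
    rw [hpt, hpt, zero_add, hend, phaseCoeff]
    simp
    ring
  rw [e1, e2, ← mul_sub, norm_mul, hτn] at h
  refine ⟨S - wkb K τ v, ?_, ?_⟩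
  · have hJle : (J : ℝ) ≤ N := by rw [hJN]; have : (0 : ℝ) ≤ m := m.cast_nonneg; linarith
    simp only [Finset.sum_const, Finset.card_range, nsmul_eq_mul] at h
    have h1 : ‖S - wkb K τ v‖ ≤ N * (emConst K * (J * ((1 / (N : ℝ)) ^ (2 * K + 2) * C))) := by
      rw [div_mul_eq_mul_div, one_mul, div_le_iff₀ hN] at h
      linarith
    refine h1.trans ?_
    have h2 : (N : ℝ) * (emConst K * (J * ((1 / (N : ℝ)) ^ (2 * K + 2) * C))) ≤
        N * ((emConst K + 1) * (N * ((1 / (N : ℝ)) ^ (2 * K + 2) * C))) := by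
      gcongr; linarith
    refine h2.trans (le_of_eq ?_)
    rw [pow_add]
    field_simp
  · rw [norm_qPoch_sq_eq hm, add_sub_cancel, hS, Complex.exp_sum]
    congr 1
    refine Finset.prod_congr rfl fun j hj => ?_
    have hj' := Finset.mem_range.mp hj
    have hj2 : (j : ℝ) + 1 ≤ J := by exact_mod_cast hj'
    have h1 := (hreg (j + 1 / 2) ⟨by positivity, by linarith⟩).1
    push_cast at h1
    rw [exp_logOneSub h1, ← cyc_nat_mul]
    congr 2
    rw [hv, hτ]
    push_cast
    field_simp
    ring

/-! ### Laplace's method for complex Gaussian integrals -/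

/-- A direction `e` of integration which is adapted to the Gaussian weight `exp (-a s² / τ)` for
`τ` on the ray through `ω`, and is oriented in accordance with the principal square root. -/
structure Admissible (e ω : ℂ) : Prop where
  norm_dir : ‖e‖ = 1
  norm_ray : ‖ω‖ = 1
  re_pos : 0 < (e ^ 2 / ω).re
  root : e * ((e ^ 2 / ω)⁻¹) ^ (1 / 2 : ℂ) = ω ^ (1 / 2 : ℂ)

/-- The integral of `H(s, τ) exp (-a s² / τ)` over the segment from `-R₁ e` to `R₂ e`. -/
noncomputable def gaussInt (a : ℝ) (e τ : ℂ) (R₁ R₂ : ℝ) (H : ℂ → ℂ → ℂ) : ℂ :=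
  ∫ x in (-R₁)..R₂, H (x * e) τ * Complex.exp (-(a * (x * e) ^ 2 / τ)) * e

/-- `H` has an expansion of order `K` under the Gaussian integral, with coefficients that depend
neither on the direction of integration nor on the ray of `τ`. -/
def Expands (a : ℝ) (K : ℕ) (H : ℂ → ℂ → ℂ) : Prop :=
  ∃ A : ℕ → ℂ, ∀ e ω : ℂ, Admissible e ω → ∃ δ' > 0, ∀ δ : ℝ, 0 < δ → δ ≤ δ' →
    ∃ C : ℝ, ∃ r₀ > 0, ∀ r : ℝ, 0 < r → r < r₀ → ∀ R₁ ∈ Set.Icc (δ / 2) δ, ∀ R₂ ∈ Set.Icc (δ / 2) δ,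
      ‖gaussInt a e (r * ω) R₁ R₂ H -
        (r * ω) ^ (1 / 2 : ℂ) * ∑ j ∈ Finset.range K, A j * (r * ω) ^ j‖ ≤ C * (√r * r ^ K)

lemma exp_neg_div_le {c r : ℝ} (hc : 0 < c) (hr : 0 < r) (Q : ℕ) :
    Real.exp (-(c / r)) ≤ Q.factorial / c ^ Q * r ^ Q := by
  have h := Real.pow_div_factorial_le_exp (c / r) (by positivity) Q
  have hQ : (0 : ℝ) < Q.factorial := by exact_mod_cast Q.factorial_pos
  rw [Real.exp_neg, inv_le_comm₀ (Real.exp_pos _) (by positivity)]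
  refine le_trans (le_of_eq ?_) h
  rw [div_pow]
  field_simp

/-- Half of a Gaussian weight absorbs a power, at the price of a power of `r`. -/
lemma pow_mul_exp_le {κ r : ℝ} (hκ : 0 < κ) (hr : 0 < r) (M : ℕ) (x : ℝ) :
    x ^ (2 * M) * Real.exp (-(κ * x ^ 2 / r)) ≤
      (2 / κ) ^ M * M.factorial * r ^ M * Real.exp (-(κ / 2 / r) * x ^ 2) := by
  have h := Real.pow_div_factorial_le_exp (κ * x ^ 2 / (2 * r)) (by positivity) M
  have hM : (0 : ℝ) < M.factorial := by exact_mod_cast M.factorial_pos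
  rw [div_le_iff₀ hM] at h
  have e1 : Real.exp (-(κ * x ^ 2 / r)) =
      Real.exp (-(κ * x ^ 2 / (2 * r))) * Real.exp (-(κ / 2 / r) * x ^ 2) := by
    rw [← Real.exp_add]; congr 1; field_simp; ring
  have e2 : x ^ (2 * M) = (2 / κ) ^ M * r ^ M * (κ * x ^ 2 / (2 * r)) ^ M := by
    rw [← mul_pow, ← mul_pow, pow_mul]; congr 1; field_simp
  rw [e1, e2]
  calc _ = (2 / κ) ^ M * r ^ M * ((κ * x ^ 2 / (2 * r)) ^ M *
        Real.exp (-(κ * x ^ 2 / (2 * r)))) * Real.exp (-(κ / 2 / r) * x ^ 2) := by ring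
    _ ≤ (2 / κ) ^ M * r ^ M * ((Real.exp (κ * x ^ 2 / (2 * r)) * M.factorial) *
        Real.exp (-(κ * x ^ 2 / (2 * r)))) * Real.exp (-(κ / 2 / r) * x ^ 2) := by gcongr
    _ = (2 / κ) ^ M * r ^ M * (M.factorial * (Real.exp (κ * x ^ 2 / (2 * r)) *
        Real.exp (-(κ * x ^ 2 / (2 * r))))) * Real.exp (-(κ / 2 / r) * x ^ 2) := by ring
    _ = _ := by rw [← Real.exp_add, add_neg_cancel, Real.exp_zero]; ring

/-- The constant in the bound `norm_integral_le_of_gauss` for Gaussian moments. -/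
noncomputable def momentConst (κ : ℝ) (M : ℕ) : ℝ :=
  (2 / κ) ^ M * M.factorial * √(2 * Real.pi / κ)

lemma momentConst_nonneg {κ : ℝ} (hκ : 0 < κ) (M : ℕ) : 0 ≤ momentConst κ M := by
  unfold momentConst; positivity

/-- A function of size `x^{2M} exp (-κ x² / r)` has an integral of size `r^{M + 1/2}`. -/
lemma norm_integral_le_of_gauss {F : ℝ → ℂ} {D κ r R₁ R₂ : ℝ} (M : ℕ) (hκ : 0 < κ) (hr : 0 < r)
    (hD : 0 ≤ D) (hR₁ : 0 ≤ R₁) (hR₂ : 0 ≤ R₂)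
    (hF : ∀ x ∈ Set.Icc (-R₁) R₂, ‖F x‖ ≤ D * (x ^ (2 * M) * Real.exp (-(κ * x ^ 2 / r)))) :
    ‖∫ x in (-R₁)..R₂, F x‖ ≤ D * momentConst κ M * (√r * r ^ M) := by
  have hb : 0 < κ / 2 / r := by positivity
  set g : ℝ → ℝ := fun x =>
    D * ((2 / κ) ^ M * M.factorial * r ^ M) * Real.exp (-(κ / 2 / r) * x ^ 2) with hg
  have hgi : MeasureTheory.Integrable g := (integrable_exp_neg_mul_sq hb).const_mul _
  have hg0 : ∀ x, 0 ≤ g x := fun x => by rw [hg]; positivity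
  have h1 : ‖∫ x in (-R₁)..R₂, F x‖ ≤ ∫ x in (-R₁)..R₂, g x := by
    refine intervalIntegral.norm_integral_le_of_norm_le (by linarith) ?_ hgi.intervalIntegrable
    refine Eventually.of_forall fun x hx => (hF x ⟨hx.1.le, hx.2⟩).trans ?_
    rw [hg]
    simp only
    rw [mul_assoc D]
    exact mul_le_mul_of_nonneg_left (pow_mul_exp_le hκ hr M x) hD
  have h2 : ∫ x in (-R₁)..R₂, g x ≤ ∫ x, g x := by
    rw [intervalIntegral.integral_of_le (by linarith)]
    exact MeasureTheory.setIntegral_le_integral hgi (Eventually.of_forall hg0)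
  refine h1.trans (h2.trans (le_of_eq ?_))
  rw [hg, MeasureTheory.integral_const_mul, integral_gaussian, momentConst]
  have : Real.pi / (κ / 2 / r) = (2 * Real.pi / κ) * r := by field_simp
  rw [this, Real.sqrt_mul (by have := Real.pi_pos; positivity)]
  ring

section weights
variable {a : ℝ} {e ω : ℂ}

lemma Admissible.ray_ne_zero (h : Admissible e ω) : ω ≠ 0 := by
  intro h0; have := h.norm_ray; simp [h0] at this

lemma Admissible.dir_ne_zero (h : Admissible e ω) : e ≠ 0 := by
  intro h0; have := h.norm_dir; simp [h0] at this

lemma Admissible.norm_mul (h : Admissible e ω) {r : ℝ} (hr : 0 < r) : ‖(r : ℂ) * ω‖ = r := by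
  rw [_root_.norm_mul, h.norm_ray, mul_one, Complex.norm_real, Real.norm_of_nonneg hr.le]

lemma Admissible.mul_ne_zero (h : Admissible e ω) {r : ℝ} (hr : 0 < r) : (r : ℂ) * ω ≠ 0 :=
  _root_.mul_ne_zero (by exact_mod_cast hr.ne') h.ray_ne_zero

lemma Admissible.norm_mul_dir (h : Admissible e ω) (x : ℝ) : ‖(x : ℂ) * e‖ = |x| := by
  rw [_root_.norm_mul, h.norm_dir, mul_one, Complex.norm_real, Real.norm_eq_abs]

lemma gauss_exponent (h : Admissible e ω) {r : ℝ} (hr : 0 < r) (x : ℝ) :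
    -(a * (x * e) ^ 2 / (r * ω)) = ((-(a * x ^ 2 / r) : ℝ) : ℂ) * (e ^ 2 / ω) := by
  have := h.ray_ne_zero
  have : (r : ℂ) ≠ 0 := by exact_mod_cast hr.ne'
  push_cast
  field_simp

lemma norm_gauss (h : Admissible e ω) {r : ℝ} (hr : 0 < r) (x : ℝ) :
    ‖Complex.exp (-(a * (x * e) ^ 2 / (r * ω)))‖ =
      Real.exp (-(a * (e ^ 2 / ω).re * x ^ 2 / r)) := by
  rw [gauss_exponent h hr, Complex.norm_exp, Complex.re_ofReal_mul]
  congr 1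
  ring

lemma norm_cpow_half (h : Admissible e ω) {r : ℝ} (hr : 0 < r) :
    ‖((r : ℂ) * ω) ^ (1 / 2 : ℂ)‖ = √r := by
  have := Complex.norm_cpow_real (r * ω) (1 / 2)
  push_cast at this
  rw [this, h.norm_mul hr, Real.sqrt_eq_rpow]

/-- The full Gaussian integral in an admissible direction. -/
lemma integral_gauss (ha : 0 < a) (h : Admissible e ω) {r : ℝ} (hr : 0 < r) :
    ∫ x : ℝ, Complex.exp (-(a * (x * e) ^ 2 / (r * ω))) * e =
      (√(Real.pi / a) : ℂ) * (r * ω) ^ (1 / 2 : ℂ) := by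
  have hb : 0 < (((a / r : ℝ) : ℂ) * (e ^ 2 / ω)).re := by
    rw [Complex.re_ofReal_mul]
    exact mul_pos (by positivity) h.re_pos
  have h1 : ∀ x : ℝ, Complex.exp (-(a * (x * e) ^ 2 / (r * ω))) =
      Complex.exp (-(((a / r : ℝ) : ℂ) * (e ^ 2 / ω)) * x ^ 2) := by
    intro x
    rw [gauss_exponent h hr]
    congr 1
    push_cast
    ring
  simp only [h1]
  rw [MeasureTheory.integral_mul_const, integral_gaussian_complex hb]
  have hpr : 0 ≤ Real.pi * r / a := by have := Real.pi_pos; positivity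
  have h2 : (Real.pi : ℂ) / (((a / r : ℝ) : ℂ) * (e ^ 2 / ω)) =
      ((Real.pi * r / a : ℝ) : ℂ) * (e ^ 2 / ω)⁻¹ := by
    have hr0 : (r : ℂ) ≠ 0 := by exact_mod_cast hr.ne'
    have ha0 : (a : ℂ) ≠ 0 := by exact_mod_cast ha.ne'
    have := h.ray_ne_zero
    have := h.dir_ne_zero
    push_cast
    field_simp
  have hsq : ∀ y : ℝ, 0 ≤ y → ((y : ℂ)) ^ (1 / 2 : ℂ) = (√y : ℂ) := by
    intro y hy
    rw [Real.sqrt_eq_rpow, Complex.ofReal_cpow hy]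
    push_cast
    rfl
  have hmul : ∀ (y : ℝ) (z : ℂ), 0 < y → ((y : ℂ) * z) ^ (1 / 2 : ℂ) = (√y : ℂ) * z ^ (1 / 2 : ℂ) := by
    intro y z hy
    rcases eq_or_ne z 0 with rfl | hz
    · simp
    · rw [← hsq y hy.le, Complex.cpow_def_of_ne_zero (by simp [hy.ne', hz]),
        Complex.cpow_def_of_ne_zero (by exact_mod_cast hy.ne'), Complex.cpow_def_of_ne_zero hz,
        Complex.log_ofReal_mul hy hz, ← Complex.exp_add, Complex.ofReal_log hy.le]
      ring_nf
  have hpr' : 0 < Real.pi * r / a := by have := Real.pi_pos; positivity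
  rw [h2, hmul _ _ hpr', hmul _ _ hr, mul_assoc, mul_comm _ e, h.root]
  have : √(Real.pi * r / a) = √(Real.pi / a) * √r := by
    rw [← Real.sqrt_mul (by have := Real.pi_pos; positivity)]; congr 1; ring
  rw [this]
  push_cast
  ring

end weights

/-! ### Moments of complex Gaussian weights -/

section moments
variable {a : ℝ} {e ω : ℂ}

lemma hasDerivAt_pow_mul_gauss (h : Admissible e ω) {r : ℝ} (hr : 0 < r) (m : ℕ) (x : ℝ) :
    HasDerivAt (fun x : ℝ => ((x : ℂ) * e) ^ m * Complex.exp (-(a * (x * e) ^ 2 / (r * ω))))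
      (m * ((x : ℂ) * e) ^ (m - 1) * Complex.exp (-(a * (x * e) ^ 2 / (r * ω))) * e -
        2 * a / (r * ω) * (((x : ℂ) * e) ^ (m + 1) *
          Complex.exp (-(a * (x * e) ^ 2 / (r * ω))) * e)) x := by
  have h1 : HasDerivAt (fun x : ℝ => (x : ℂ) * e) e x := by
    simpa using (Complex.ofRealCLM.hasDerivAt (x := x)).mul_const e
  have h2 := (((h1.pow 2).const_mul (a : ℂ)).div_const (r * ω)).neg.cexp
  have h3 := (h1.pow m).mul h2
  refine h3.congr_deriv ?_
  have := h.mul_ne_zero hr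
  simp only [Pi.pow_apply, Pi.neg_apply, Nat.cast_ofNat]
  field_simp
  ring

/-- Integration by parts for truncated Gaussian moments. -/
lemma gaussInt_pow_succ (ha : 0 < a) (h : Admissible e ω) {r : ℝ} (hr : 0 < r) (R₁ R₂ : ℝ) (m : ℕ) :
    gaussInt a e (r * ω) R₁ R₂ (fun s _ => s ^ (m + 1)) = r * ω / (2 * a) *
      (m * gaussInt a e (r * ω) R₁ R₂ (fun s _ => s ^ (m - 1)) -
        (((R₂ : ℂ) * e) ^ m * Complex.exp (-(a * (R₂ * e) ^ 2 / (r * ω))) -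
          (((-R₁ : ℝ) : ℂ) * e) ^ m * Complex.exp (-(a * (((-R₁ : ℝ) : ℂ) * e) ^ 2 / (r * ω))))) := by
  have h1 := intervalIntegral.integral_eq_sub_of_hasDerivAt (a := -R₁) (b := R₂)
    (fun x _ => hasDerivAt_pow_mul_gauss (a := a) h hr m x)
    (by refine Continuous.intervalIntegrable ?_ _ _; fun_prop)
  rw [intervalIntegral.integral_sub
    (by refine Continuous.intervalIntegrable ?_ _ _; fun_prop)
    (by refine Continuous.intervalIntegrable ?_ _ _; fun_prop),
    intervalIntegral.integral_const_mul] at h1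
  have h2 : ∫ x in (-R₁)..R₂, m * ((x : ℂ) * e) ^ (m - 1) *
      Complex.exp (-(a * (x * e) ^ 2 / (r * ω))) * e =
      m * gaussInt a e (r * ω) R₁ R₂ (fun s _ => s ^ (m - 1)) := by
    rw [gaussInt, ← intervalIntegral.integral_const_mul]
    refine intervalIntegral.integral_congr fun x _ => ?_
    ring
  rw [h2] at h1
  have h3 := h.mul_ne_zero hr
  have ha' : (a : ℂ) ≠ 0 := by exact_mod_cast ha.ne'
  rw [← h1]
  change ∫ x in (-R₁)..R₂, ((x : ℂ) * e) ^ (m + 1) *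
    Complex.exp (-(a * (x * e) ^ 2 / (r * ω))) * e = _
  generalize (∫ x in (-R₁)..R₂, ((x : ℂ) * e) ^ (m + 1) *
    Complex.exp (-(a * (x * e) ^ 2 / (r * ω))) * e) = Y
  generalize (r : ℂ) * ω = τ at h3 ⊢
  field_simp
  ring

/-- The moments `∫ s^m exp (-a s²) ds` over the real line, by the recursion that integration by parts
gives. -/
noncomputable def gaussMoment (a : ℝ) : ℕ → ℂ
  | 0 => √(Real.pi / a)
  | 1 => 0
  | m + 2 => (m + 1) / (2 * a) * gaussMoment a m

lemma norm_boundary_le (ha : 0 < a) (h : Admissible e ω) {r δ R : ℝ} (hr : 0 < r) (hδ : 0 < δ)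
    (h1 : δ / 2 ≤ |R|) (h2 : |R| ≤ δ) (m : ℕ) :
    ‖((R : ℂ) * e) ^ m * Complex.exp (-(a * (R * e) ^ 2 / (r * ω)))‖ ≤
      δ ^ m * Real.exp (-(a * (e ^ 2 / ω).re * (δ / 2) ^ 2 / r)) := by
  have := h.re_pos
  rw [norm_mul, norm_pow, h.norm_mul_dir, norm_gauss h hr, ← sq_abs R]
  gcongr

/-- Truncated Gaussian moments equal the full ones up to an error smaller than any power of `r`. For
odd `m` the moment vanishes, so the rounding in `m / 2` does not matter. -/
lemma exists_norm_gaussInt_pow_sub_le (ha : 0 < a) (h : Admissible e ω) {δ : ℝ} (hδ : 0 < δ)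
    (m Q : ℕ) :
    ∃ C : ℝ, 0 ≤ C ∧ ∀ r : ℝ, 0 < r → r < 1 → ∀ R₁ ∈ Set.Icc (δ / 2) δ, ∀ R₂ ∈ Set.Icc (δ / 2) δ,
      ‖gaussInt a e (r * ω) R₁ R₂ (fun s _ => s ^ m) -
        gaussMoment a m * (r * ω) ^ (m / 2) * (r * ω) ^ (1 / 2 : ℂ)‖ ≤ C * r ^ Q := by
  set κ := a * (e ^ 2 / ω).re with hκ
  have hκ0 : 0 < κ := mul_pos ha h.re_pos
  have hc : 0 < κ * (δ / 2) ^ 2 := by positivity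
  set B := (Q.factorial : ℝ) / (κ * (δ / 2) ^ 2) ^ Q with hB
  -- The boundary terms of the integration by parts are exponentially small.
  have hbd : ∀ (m : ℕ) (r : ℝ), 0 < r → ∀ R₁ ∈ Set.Icc (δ / 2) δ, ∀ R₂ ∈ Set.Icc (δ / 2) δ,
      ‖((R₂ : ℂ) * e) ^ m * Complex.exp (-(a * (R₂ * e) ^ 2 / (r * ω))) -
          (((-R₁ : ℝ) : ℂ) * e) ^ m * Complex.exp (-(a * (((-R₁ : ℝ) : ℂ) * e) ^ 2 / (r * ω)))‖ ≤
        2 * δ ^ m * B * r ^ Q := by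
    intro m r hr R₁ hR₁ R₂ hR₂
    have p1 : |R₂| = R₂ := abs_of_nonneg (by linarith [hR₂.1])
    have p2 : |(-R₁)| = R₁ := by rw [abs_neg]; exact abs_of_nonneg (by linarith [hR₁.1])
    have b1 := norm_boundary_le ha h hr hδ (R := R₂) (by rw [p1]; exact hR₂.1)
      (by rw [p1]; exact hR₂.2) m
    have b2 := norm_boundary_le ha h hr hδ (R := -R₁) (by rw [p2]; exact hR₁.1)
      (by rw [p2]; exact hR₁.2) m
    have b3 := exp_neg_div_le hc hr Q
    refine (norm_sub_le _ _).trans ((add_le_add b1 b2).trans ?_)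
    have : δ ^ m * Real.exp (-(a * (e ^ 2 / ω).re * (δ / 2) ^ 2 / r)) ≤ δ ^ m * (B * r ^ Q) := by
      gcongr
    linarith
  have hB0 : 0 ≤ B := by positivity
  induction m using Nat.twoStepInduction with
  | zero =>
    set c' := κ * (δ / 2) ^ 2 / 2 with hc'
    have hc0' : 0 < c' := by positivity
    refine ⟨√(2 * Real.pi / κ) * (Q.factorial / c' ^ Q), by positivity, fun r hr hr1 R₁ hR₁ R₂ hR₂ => ?_⟩
    have hb : 0 < κ / 2 / r := by positivity
    have hfi : MeasureTheory.Integrable fun x : ℝ =>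
        Complex.exp (-(a * (x * e) ^ 2 / (r * ω))) * e := by
      have hg : MeasureTheory.Integrable fun x : ℝ => Real.exp (-(κ / r) * x ^ 2) :=
        integrable_exp_neg_mul_sq (by positivity)
      refine hg.mono' (Continuous.aestronglyMeasurable (by fun_prop)) (Eventually.of_forall fun x => ?_)
      rw [norm_mul, h.norm_dir, mul_one, norm_gauss h hr]
      apply le_of_eq; congr 1; rw [hκ]; ring
    have hle : -R₁ ≤ R₂ := by linarith [hR₁.1, hR₂.1]
    have e0 : gaussInt a e (r * ω) R₁ R₂ (fun s _ => s ^ 0) = ∫ x in Set.Ioc (-R₁) R₂,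
        Complex.exp (-(a * (x * e) ^ 2 / (r * ω))) * e := by
      rw [gaussInt, intervalIntegral.integral_of_le hle]
      simp
    have e1 := MeasureTheory.integral_add_compl (measurableSet_Ioc (a := -R₁) (b := R₂)) hfi
    rw [integral_gauss ha h hr] at e1
    have e2 : gaussInt a e (r * ω) R₁ R₂ (fun s _ => s ^ 0) -
        gaussMoment a 0 * (r * ω) ^ (0 / 2) * (r * ω) ^ (1 / 2 : ℂ) =
        -∫ x in (Set.Ioc (-R₁) R₂)ᶜ, Complex.exp (-(a * (x * e) ^ 2 / (r * ω))) * e := by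
      rw [e0, gaussMoment]
      simp only [Nat.zero_div, pow_zero, mul_one]
      linear_combination e1
    rw [e2, norm_neg]
    set g : ℝ → ℝ := fun x => Real.exp (-(c' / r)) * Real.exp (-(κ / 2 / r) * x ^ 2) with hg
    have hgi : MeasureTheory.Integrable g := (integrable_exp_neg_mul_sq hb).const_mul _
    have t1 : ‖∫ x in (Set.Ioc (-R₁) R₂)ᶜ, Complex.exp (-(a * (x * e) ^ 2 / (r * ω))) * e‖ ≤
        ∫ x in (Set.Ioc (-R₁) R₂)ᶜ, g x := by
      refine MeasureTheory.norm_integral_le_of_norm_le hgi.integrableOn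
        ((MeasureTheory.ae_restrict_iff' measurableSet_Ioc.compl).mpr (Eventually.of_forall ?_))
      intro x hx
      have hx2 : (δ / 2) ^ 2 ≤ x ^ 2 := by
        rcases le_or_gt x (-R₁) with h1 | h1
        · have := hR₁.1; nlinarith
        · have h2 : R₂ < x := by
            by_contra hcon
            exact hx ⟨h1, not_lt.mp hcon⟩
          have := hR₂.1; nlinarith
      rw [norm_mul, h.norm_dir, mul_one, norm_gauss h hr, hg]
      simp only
      rw [← Real.exp_add]
      apply Real.exp_le_exp.mpr
      have : c' / r + κ / 2 / r * x ^ 2 ≤ κ * x ^ 2 / r := by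
        rw [hc']
        have h3 : κ * (δ / 2) ^ 2 / 2 / r ≤ κ * x ^ 2 / 2 / r := by gcongr
        calc _ ≤ κ * x ^ 2 / 2 / r + κ / 2 / r * x ^ 2 := by gcongr
          _ = _ := by field_simp; ring
      rw [← hκ]
      linarith
    have t2 : ∫ x in (Set.Ioc (-R₁) R₂)ᶜ, g x ≤ ∫ x, g x :=
      MeasureTheory.setIntegral_le_integral hgi (Eventually.of_forall fun x => by rw [hg]; positivity)
    have t3 : ∫ x, g x = Real.exp (-(c' / r)) * (√(2 * Real.pi / κ) * √r) := by
      rw [hg, MeasureTheory.integral_const_mul, integral_gaussian]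
      have : Real.pi / (κ / 2 / r) = (2 * Real.pi / κ) * r := by field_simp
      rw [this, Real.sqrt_mul (by have := Real.pi_pos; positivity)]
    have t4 := exp_neg_div_le hc0' hr Q
    have t5 : √r ≤ 1 := Real.sqrt_le_one.mpr hr1.le
    calc _ ≤ Real.exp (-(c' / r)) * (√(2 * Real.pi / κ) * √r) := t1.trans (t2.trans t3.le)
      _ ≤ (Q.factorial / c' ^ Q * r ^ Q) * (√(2 * Real.pi / κ) * 1) := by gcongr
      _ = _ := by ring
  | one =>
    refine ⟨1 / (2 * a) * (2 * B), by positivity, fun r hr hr1 R₁ hR₁ R₂ hR₂ => ?_⟩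
    have h1 := gaussInt_pow_succ ha h hr R₁ R₂ 0
    have h2 := hbd 0 r hr R₁ hR₁ R₂ hR₂
    simp only [Nat.cast_zero, zero_mul, zero_sub, pow_zero, one_mul, mul_one, zero_add] at h1 h2
    have e2 : gaussMoment a 1 = 0 := rfl
    rw [h1, e2, zero_mul, zero_mul, sub_zero, norm_mul, norm_neg, norm_div, h.norm_mul hr]
    have e3 : ‖(2 * a : ℂ)‖ = 2 * a := by simp [abs_of_pos ha]
    rw [e3]
    calc _ ≤ 1 / (2 * a) * (2 * B * r ^ Q) := by gcongr
      _ = _ := by ring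
  | more m ih _ =>
    obtain ⟨C, hC0, hC⟩ := ih
    refine ⟨1 / (2 * a) * ((m + 1) * C + 2 * δ ^ (m + 1) * B), by positivity,
      fun r hr hr1 R₁ hR₁ R₂ hR₂ => ?_⟩
    have h1 := gaussInt_pow_succ ha h hr R₁ R₂ (m + 1)
    have h2 := hbd (m + 1) r hr R₁ hR₁ R₂ hR₂
    have h3 := hC r hr hr1 R₁ hR₁ R₂ hR₂
    have e1 : (m + 2) / 2 = m / 2 + 1 := by omega
    have e3 : ‖(2 * a : ℂ)‖ = 2 * a := by simp [abs_of_pos ha]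
    simp only [Nat.add_sub_cancel] at h1
    set BD := ((R₂ : ℂ) * e) ^ (m + 1) * Complex.exp (-(a * (R₂ * e) ^ 2 / (r * ω))) -
      (((-R₁ : ℝ) : ℂ) * e) ^ (m + 1) * Complex.exp (-(a * (((-R₁ : ℝ) : ℂ) * e) ^ 2 / (r * ω)))
    set X := gaussInt a e (r * ω) R₁ R₂ (fun s _ => s ^ m)
    have e2 : gaussInt a e (r * ω) R₁ R₂ (fun s _ => s ^ (m + 2)) -
        gaussMoment a (m + 2) * (r * ω) ^ ((m + 2) / 2) * (r * ω) ^ (1 / 2 : ℂ) =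
        r * ω / (2 * a) * ((m + 1) * (X -
          gaussMoment a m * (r * ω) ^ (m / 2) * (r * ω) ^ (1 / 2 : ℂ)) - BD) := by
      rw [h1, gaussMoment, e1, pow_succ]
      push_cast
      ring
    rw [e2, norm_mul, norm_div, h.norm_mul hr, e3]
    have h4 : ‖((m : ℂ) + 1) * (X -
          gaussMoment a m * (r * ω) ^ (m / 2) * (r * ω) ^ (1 / 2 : ℂ)) - BD‖ ≤
        (m + 1) * (C * r ^ Q) + 2 * δ ^ (m + 1) * B * r ^ Q := by
      refine (norm_sub_le _ _).trans (add_le_add ?_ h2)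
      rw [norm_mul]
      have : ‖(m : ℂ) + 1‖ = m + 1 := by exact_mod_cast Complex.norm_natCast (m + 1)
      rw [this]
      gcongr
    calc _ ≤ 1 / (2 * a) * ((m + 1) * (C * r ^ Q) + 2 * δ ^ (m + 1) * B * r ^ Q) := by gcongr
      _ = _ := by ring

end moments

/-! ### Expansions under a Gaussian weight -/

/-- Functions that are finite sums of terms `τ^n (s³/τ)^p h(s)` with `h` holomorphic on the disc of
radius `δ₀`. Under the Gaussian weight `s` has the size of `√τ`, so `s³/τ` is as small as `√τ`. -/
inductive Expandable (δ₀ : ℝ) : (ℂ → ℂ → ℂ) → Prop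
  | term (n p : ℕ) (h : ℂ → ℂ) (hh : DifferentiableOn ℂ h (Metric.ball 0 δ₀)) :
      Expandable δ₀ (fun s τ => τ ^ n * (s ^ 3 / τ) ^ p * h s)
  | add (H₁ H₂ : ℂ → ℂ → ℂ) (h₁ : Expandable δ₀ H₁) (h₂ : Expandable δ₀ H₂) :
      Expandable δ₀ (fun s τ => H₁ s τ + H₂ s τ)

namespace Expandable
variable {δ₀ : ℝ} {H₁ H₂ : ℂ → ℂ → ℂ}

lemma mul (h₁ : Expandable δ₀ H₁) (h₂ : Expandable δ₀ H₂) :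
    Expandable δ₀ (fun s τ => H₁ s τ * H₂ s τ) := by
  induction h₁ with
  | add F G _ _ ihF ihG =>
    have := Expandable.add _ _ ihF ihG
    simpa only [add_mul] using this
  | term n p h hh =>
    induction h₂ with
    | add F G _ _ ihF ihG =>
      have := Expandable.add _ _ ihF ihG
      simpa only [mul_add] using this
    | term n' p' h' hh' =>
      have := Expandable.term (n + n') (p + p') (fun s => h s * h' s) (hh.mul hh')
      convert this using 3
      ring

lemma const (c : ℂ) : Expandable δ₀ (fun _ _ => c) := by
  have := Expandable.term (δ₀ := δ₀) 0 0 (fun _ => c) (differentiableOn_const c)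
  simpa using this

lemma pow (h₁ : Expandable δ₀ H₁) (i : ℕ) : Expandable δ₀ (fun s τ => H₁ s τ ^ i) := by
  induction i with
  | zero => simpa using const 1
  | succ i ih => simpa only [pow_succ] using ih.mul h₁

lemma sum {ι : Type*} (S : Finset ι) (F : ι → ℂ → ℂ → ℂ) (hF : ∀ i ∈ S, Expandable δ₀ (F i)) :
    Expandable δ₀ (fun s τ => ∑ i ∈ S, F i s τ) := by
  classical
  induction S using Finset.induction_on with
  | empty => simpa using const 0
  | insert i S hi ih =>
    simp only [Finset.sum_insert hi]
    exact Expandable.add _ _ (hF i (Finset.mem_insert_self i S))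
      (ih fun j hj => hF j (Finset.mem_insert_of_mem hj))

lemma continuousOn (h₁ : Expandable δ₀ H₁) (τ : ℂ) :
    ContinuousOn (fun s => H₁ s τ) (Metric.ball 0 δ₀) := by
  induction h₁ with
  | add F G _ _ ihF ihG => exact ihF.add ihG
  | term n p h hh =>
    exact (Continuous.continuousOn (by fun_prop)).mul hh.continuousOn

end Expandable

section expands
variable {a δ₀ : ℝ} {K : ℕ}

lemma intervalIntegrable_gauss {e ω : ℂ} (h : Admissible e ω) (a : ℝ) (τ : ℂ) {H : ℂ → ℂ → ℂ}
    (hH : ContinuousOn (fun s => H s τ) (Metric.ball 0 δ₀)) {R₁ R₂ : ℝ} (h1 : 0 ≤ R₁) (h2 : 0 ≤ R₂)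
    (h1' : R₁ < δ₀) (h2' : R₂ < δ₀) :
    IntervalIntegrable (fun x : ℝ => H (x * e) τ * Complex.exp (-(a * (x * e) ^ 2 / τ)) * e)
      MeasureTheory.volume (-R₁) R₂ := by
  refine ContinuousOn.intervalIntegrable ?_
  rw [Set.uIcc_of_le (by linarith)]
  refine ((hH.comp (f := fun x : ℝ => (x : ℂ) * e) (Continuous.continuousOn (by fun_prop))
    fun x hx => ?_).mul (Continuous.continuousOn (by fun_prop))).mul continuousOn_const
  rw [mem_ball_zero_iff, h.norm_mul_dir]
  exact abs_lt.mpr ⟨by linarith [hx.1], by linarith [hx.2]⟩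

lemma Expands.add {H₁ H₂ : ℂ → ℂ → ℂ} (hδ₀ : 0 < δ₀) (h₁ : Expands a K H₁) (h₂ : Expands a K H₂)
    (c₁ : ∀ τ, ContinuousOn (fun s => H₁ s τ) (Metric.ball 0 δ₀))
    (c₂ : ∀ τ, ContinuousOn (fun s => H₂ s τ) (Metric.ball 0 δ₀)) :
    Expands a K (fun s τ => H₁ s τ + H₂ s τ) := by
  obtain ⟨A₁, hA₁⟩ := h₁
  obtain ⟨A₂, hA₂⟩ := h₂
  refine ⟨fun j => A₁ j + A₂ j, fun e ω h => ?_⟩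
  obtain ⟨δ₁, hδ₁, k₁⟩ := hA₁ e ω h
  obtain ⟨δ₂, hδ₂, k₂⟩ := hA₂ e ω h
  refine ⟨min (min δ₁ δ₂) (δ₀ / 2), by positivity, fun δ hδ hδ' => ?_⟩
  have hd : δ ≤ δ₀ / 2 := hδ'.trans (min_le_right _ _)
  obtain ⟨C₁, r₁, hr₁, b₁⟩ := k₁ δ hδ (hδ'.trans ((min_le_left _ _).trans (min_le_left _ _)))
  obtain ⟨C₂, r₂, hr₂, b₂⟩ := k₂ δ hδ (hδ'.trans ((min_le_left _ _).trans (min_le_right _ _)))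
  refine ⟨C₁ + C₂, min r₁ r₂, by positivity, fun r hr hr' R₁ hR₁ R₂ hR₂ => ?_⟩
  have i₁ := b₁ r hr (hr'.trans_le (min_le_left _ _)) R₁ hR₁ R₂ hR₂
  have i₂ := b₂ r hr (hr'.trans_le (min_le_right _ _)) R₁ hR₁ R₂ hR₂
  have e1 : gaussInt a e (r * ω) R₁ R₂ (fun s τ => H₁ s τ + H₂ s τ) =
      gaussInt a e (r * ω) R₁ R₂ H₁ + gaussInt a e (r * ω) R₁ R₂ H₂ := by
    rw [gaussInt, gaussInt, gaussInt, ← intervalIntegral.integral_add]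
    · simp only [add_mul]
    · exact intervalIntegrable_gauss h a _ (c₁ _) (by linarith [hR₁.1]) (by linarith [hR₂.1])
        (by linarith [hR₁.2]) (by linarith [hR₂.2])
    · exact intervalIntegrable_gauss h a _ (c₂ _) (by linarith [hR₁.1]) (by linarith [hR₂.1])
        (by linarith [hR₁.2]) (by linarith [hR₂.2])
  have e2 : ∑ j ∈ Finset.range K, (A₁ j + A₂ j) * (r * ω) ^ j =
      ∑ j ∈ Finset.range K, A₁ j * (r * ω) ^ j + ∑ j ∈ Finset.range K, A₂ j * (r * ω) ^ j := by
    rw [← Finset.sum_add_distrib]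
    simp only [add_mul]
  rw [e1, e2, mul_add, add_sub_add_comm, add_mul]
  exact (norm_add_le _ _).trans (add_le_add i₁ i₂)

/-- A function of size `|s|^{2(p+K)} / |τ|^p` contributes only to the error term of order `K`. -/
lemma expands_of_bound (ha : 0 < a) {H : ℂ → ℂ → ℂ} {D δ₁ : ℝ} (p : ℕ) (hD : 0 ≤ D) (hδ₁ : 0 < δ₁)
    (hH : ∀ s τ : ℂ, ‖s‖ ≤ δ₁ → 0 < ‖τ‖ → ‖τ‖ < 1 →
      ‖H s τ‖ ≤ D * ‖s‖ ^ (2 * (p + K)) / ‖τ‖ ^ p) : Expands a K H := by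
  refine ⟨fun _ => 0, fun e ω h => ⟨δ₁, hδ₁, fun δ hδ hδ' => ?_⟩⟩
  set κ := a * (e ^ 2 / ω).re with hκ
  have hκ0 : 0 < κ := mul_pos ha h.re_pos
  refine ⟨D * momentConst κ (p + K), 1, one_pos, fun r hr hr1 R₁ hR₁ R₂ hR₂ => ?_⟩
  have hn := h.norm_mul hr
  have := norm_integral_le_of_gauss (F := fun x : ℝ => H (x * e) (r * ω) *
      Complex.exp (-(a * (x * e) ^ 2 / (r * ω))) * e) (D := D / r ^ p) (p + K) hκ0 hr (by positivity)
    (by linarith [hR₁.1]) (by linarith [hR₂.1]) (R₁ := R₁) (R₂ := R₂) (by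
      intro x hx
      have hx1 : ‖(x : ℂ) * e‖ ≤ δ₁ := by
        rw [h.norm_mul_dir]
        exact abs_le.mpr ⟨by linarith [hx.1, hR₁.2], by linarith [hx.2, hR₂.2]⟩
      have h1 := hH _ _ hx1 (by rw [hn]; exact hr) (by rw [hn]; exact hr1)
      rw [hn, h.norm_mul_dir, pow_mul, sq_abs, ← pow_mul] at h1
      rw [norm_mul, norm_mul, h.norm_dir, mul_one, norm_gauss h hr]
      calc _ ≤ D * x ^ (2 * (p + K)) / r ^ p * Real.exp (-(a * (e ^ 2 / ω).re * x ^ 2 / r)) := by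
            gcongr
        _ = _ := by rw [hκ]; ring)
  simp only [zero_mul, Finset.sum_const_zero, mul_zero, sub_zero]
  refine this.trans (le_of_eq ?_)
  rw [pow_add]
  field_simp

/-- The condition `3 p ≤ m` ensures that only non-negative powers of `τ` arise. -/
lemma expands_monomial (ha : 0 < a) (c : ℂ) (n p m : ℕ) (hm : 3 * p ≤ m) :
    Expands a K (fun s τ => c * (τ ^ n / τ ^ p * s ^ m)) := by
  set J := n + m / 2 - p with hJ
  set B := c * gaussMoment a m with hB
  refine ⟨fun j => if j = J then B else 0, fun e ω h => ⟨1, one_pos, fun δ hδ _ => ?_⟩⟩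
  obtain ⟨C, hC0, hC⟩ := exists_norm_gaussInt_pow_sub_le ha h hδ m (K + 1 + p)
  refine ⟨‖c‖ * C + ‖B‖, 1, one_pos, fun r hr hr1 R₁ hR₁ R₂ hR₂ => ?_⟩
  have h1 := hC r hr hr1 R₁ hR₁ R₂ hR₂
  set τ : ℂ := r * ω with hτ
  have hn : ‖τ‖ = r := h.norm_mul hr
  have hτ0 : τ ≠ 0 := h.mul_ne_zero hr
  have hsq : ‖τ ^ (1 / 2 : ℂ)‖ = √r := norm_cpow_half h hr
  have hs1 : √r * √r = r := Real.mul_self_sqrt hr.le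
  have hs2 : √r ≤ 1 := Real.sqrt_le_one.mpr hr1.le
  have e1 : gaussInt a e τ R₁ R₂ (fun s τ => c * (τ ^ n / τ ^ p * s ^ m)) =
      c * (τ ^ n / τ ^ p) * gaussInt a e τ R₁ R₂ (fun s _ => s ^ m) := by
    rw [gaussInt, gaussInt, ← intervalIntegral.integral_const_mul]
    refine intervalIntegral.integral_congr fun x _ => ?_
    ring
  have e2 : c * (τ ^ n / τ ^ p) * (gaussMoment a m * τ ^ (m / 2) * τ ^ (1 / 2 : ℂ)) =
      τ ^ (1 / 2 : ℂ) * (B * τ ^ J) := by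
    have : τ ^ J * τ ^ p = τ ^ n * τ ^ (m / 2) := by
      rw [← pow_add, ← pow_add, hJ]; congr 1; omega
    have h4 : τ ^ J = τ ^ n * τ ^ (m / 2) / τ ^ p := by
      rw [eq_div_iff (pow_ne_zero _ hτ0), this]
    rw [h4, hB]
    field_simp
  have t1 : ‖c * (τ ^ n / τ ^ p) * (gaussInt a e τ R₁ R₂ (fun s _ => s ^ m) -
      gaussMoment a m * τ ^ (m / 2) * τ ^ (1 / 2 : ℂ))‖ ≤ ‖c‖ * C * (√r * r ^ K) := by
    rw [norm_mul, norm_mul, norm_div, norm_pow, norm_pow, hn]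
    calc _ ≤ ‖c‖ * (r ^ n / r ^ p) * (C * r ^ (K + 1 + p)) := by gcongr
      _ = ‖c‖ * C * (r ^ n * (√r * √r * r ^ K)) := by
        rw [hs1, pow_add, pow_add]; field_simp
      _ ≤ ‖c‖ * C * (1 * (√r * 1 * r ^ K)) := by
        gcongr
        exact pow_le_one₀ hr.le hr1.le
      _ = _ := by ring
  have t2 : ‖τ ^ (1 / 2 : ℂ) * (B * τ ^ J) -
      τ ^ (1 / 2 : ℂ) * ∑ j ∈ Finset.range K, (if j = J then B else 0) * τ ^ j‖ ≤
      ‖B‖ * (√r * r ^ K) := by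
    simp only [ite_mul, zero_mul, Finset.sum_ite_eq', Finset.mem_range]
    split_ifs with hlt
    · rw [sub_self, norm_zero]; positivity
    · rw [mul_zero, sub_zero, norm_mul, norm_mul, hsq, norm_pow, hn]
      have : r ^ J ≤ r ^ K := pow_le_pow_of_le_one hr.le hr1.le (not_lt.mp hlt)
      calc _ ≤ √r * (‖B‖ * r ^ K) := by gcongr
        _ = _ := by ring
  rw [e1]
  calc _ = ‖c * (τ ^ n / τ ^ p) * (gaussInt a e τ R₁ R₂ (fun s _ => s ^ m) -
        gaussMoment a m * τ ^ (m / 2) * τ ^ (1 / 2 : ℂ)) + (τ ^ (1 / 2 : ℂ) * (B * τ ^ J) -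
        τ ^ (1 / 2 : ℂ) * ∑ j ∈ Finset.range K, (if j = J then B else 0) * τ ^ j)‖ := by
        rw [← e2]; congr 1; ring
    _ ≤ _ := (norm_add_le _ _).trans (by rw [add_mul]; exact add_le_add t1 t2)

lemma exists_norm_le_closedBall {h : ℂ → ℂ} (hh : DifferentiableOn ℂ h (Metric.ball 0 δ₀))
    {δ₁ : ℝ} (h1 : δ₁ < δ₀) : ∃ D : ℝ, 0 ≤ D ∧ ∀ s : ℂ, ‖s‖ ≤ δ₁ → ‖h s‖ ≤ D := by
  obtain ⟨D, hD⟩ := (isCompact_closedBall (0 : ℂ) δ₁).exists_bound_of_continuousOn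
    (hh.continuousOn.mono (Metric.closedBall_subset_ball h1))
  refine ⟨max D 0, le_max_right _ _, fun s hs => (hD s ?_).trans (le_max_left _ _)⟩
  simpa using hs

lemma expands_term (ha : 0 < a) (hδ₀ : 0 < δ₀) (n p l : ℕ) (h : ℂ → ℂ)
    (hh : DifferentiableOn ℂ h (Metric.ball 0 δ₀)) :
    Expands a K (fun s τ => τ ^ n / τ ^ p * s ^ (3 * p + l) * h s) := by
  -- Descending induction on `l`: peel off the value of `h` at the origin.
  obtain ⟨d, hd⟩ : ∃ d, 2 * K ≤ l + d := ⟨2 * K, by omega⟩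
  induction d generalizing l h with
  | zero =>
    set δ₁ := min (δ₀ / 2) 1 with hδ₁
    obtain ⟨D, hD0, hD⟩ := exists_norm_le_closedBall hh (δ₁ := δ₁)
      ((min_le_left _ _).trans_lt (by linarith))
    refine expands_of_bound ha (D := D) (δ₁ := δ₁) p hD0 (by positivity) fun s τ hs hτ0 hτ1 => ?_
    have hs1 : ‖s‖ ≤ 1 := hs.trans (min_le_right _ _)
    rw [norm_mul, norm_mul, norm_div, norm_pow, norm_pow, norm_pow]
    have b1 : ‖s‖ ^ (3 * p + l) ≤ ‖s‖ ^ (2 * (p + K)) :=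
      pow_le_pow_of_le_one (norm_nonneg _) hs1 (by omega)
    have b2 : ‖τ‖ ^ n ≤ 1 := pow_le_one₀ (norm_nonneg _) hτ1.le
    calc _ ≤ 1 / ‖τ‖ ^ p * ‖s‖ ^ (2 * (p + K)) * D := by gcongr; exact hD s hs
      _ = _ := by ring
  | succ d ih =>
    have hds : DifferentiableOn ℂ (dslope h 0) (Metric.ball 0 δ₀) :=
      (Complex.differentiableOn_dslope (Metric.ball_mem_nhds 0 hδ₀)).mpr hh
    have h1 := ih (l + 1) (dslope h 0) hds (by omega)
    have h2 := expands_monomial (K := K) ha (h 0) n p (3 * p + l) (by omega)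
    have h3 := Expands.add hδ₀ h2 h1 (fun τ => Continuous.continuousOn (by fun_prop))
      (fun τ => (Continuous.continuousOn (by fun_prop)).mul hds.continuousOn)
    convert h3 using 3 with s τ
    have h4 := sub_smul_dslope h 0 s
    rw [sub_zero, smul_eq_mul] at h4
    rw [← add_assoc, pow_succ]
    linear_combination (-(τ ^ n / τ ^ p * s ^ (3 * p + l))) * h4

lemma Expandable.expands (ha : 0 < a) (hδ₀ : 0 < δ₀) {H : ℂ → ℂ → ℂ} (hH : Expandable δ₀ H) :
    Expands a K H := by
  induction hH with
  | term n p h hh =>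
    have := expands_term (K := K) ha hδ₀ n p 0 h hh
    convert this using 4
    rw [div_pow, ← pow_mul]
    ring_nf
  | add F G hF hG ihF ihG =>
    exact Expands.add hδ₀ ihF ihG hF.continuousOn hG.continuousOn

/-- Laplace's method: the exponential of an expandable function which is `O(|s|³/|τ| + |τ|)` has an
expansion of every order. -/
lemma expands_exp (ha : 0 < a) (hδ₀ : 0 < δ₀) {y : ℂ → ℂ → ℂ} (hy : Expandable δ₀ y) {C₀ δ₁ : ℝ}
    (hC₀ : 0 < C₀) (hδ₁ : 0 < δ₁) (hbd : ∀ s τ : ℂ, ‖s‖ ≤ δ₁ → 0 < ‖τ‖ → ‖τ‖ < 1 →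
      ‖y s τ‖ ≤ C₀ * (‖s‖ ^ 3 / ‖τ‖ + ‖τ‖))
    (hcont : ∀ τ, ContinuousOn (fun s => y s τ) (Metric.ball 0 δ₀)) :
    Expands a K (fun s τ => Complex.exp (y s τ)) := by
  -- The Taylor polynomial of the exponential; the remainder is `O(|y|^{2K} e^{|y|})`.
  set T : ℂ → ℂ → ℂ := fun s τ => ∑ i ∈ Finset.range (2 * K), y s τ ^ i / i.factorial with hT
  have hTE : Expandable δ₀ T := by
    refine Expandable.sum _ _ fun i _ => ?_
    have := (hy.pow i).mul (Expandable.const (1 / (i.factorial : ℂ)))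
    simpa only [mul_one_div] using this
  obtain ⟨A, hA⟩ := hTE.expands (K := K) ha hδ₀
  refine ⟨A, fun e ω h => ?_⟩
  obtain ⟨δ₂, hδ₂, k₂⟩ := hA e ω h
  set κ := a * (e ^ 2 / ω).re with hκ
  have hκ0 : 0 < κ := mul_pos ha h.re_pos
  refine ⟨min (min δ₁ δ₂) (min (δ₀ / 2) (κ / (2 * C₀))), by positivity, fun δ hδ hδ' => ?_⟩
  have d1 : δ ≤ δ₁ := hδ'.trans ((min_le_left _ _).trans (min_le_left _ _))
  have d2 : δ ≤ δ₂ := hδ'.trans ((min_le_left _ _).trans (min_le_right _ _))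
  have d3 : δ ≤ δ₀ / 2 := hδ'.trans ((min_le_right _ _).trans (min_le_left _ _))
  have d4 : δ ≤ κ / (2 * C₀) := hδ'.trans ((min_le_right _ _).trans (min_le_right _ _))
  rw [le_div_iff₀ (by positivity)] at d4
  obtain ⟨C, r₀, hr₀, b⟩ := k₂ δ hδ d2
  have hm := momentConst_nonneg (half_pos hκ0) (3 * K)
  have hm' := momentConst_nonneg (half_pos hκ0) 0
  set D := (2 * C₀) ^ (2 * K) * Real.exp C₀ with hD
  refine ⟨C + (D * momentConst (κ / 2) (3 * K) + D * momentConst (κ / 2) 0), min r₀ 1, by positivity,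
    fun r hr hr' R₁ hR₁ R₂ hR₂ => ?_⟩
  have hr1 : r < 1 := hr'.trans_le (min_le_right _ _)
  have hb := b r hr (hr'.trans_le (min_le_left _ _)) R₁ hR₁ R₂ hR₂
  have hn := h.norm_mul hr
  have r1 : 0 ≤ R₁ := by linarith [hR₁.1]
  have r2 : 0 ≤ R₂ := by linarith [hR₂.1]
  set τ : ℂ := r * ω with hτ
  set E : ℝ → ℂ := fun x => Complex.exp (-(a * (x * e) ^ 2 / τ)) with hE
  have key : ∀ x ∈ Set.Icc (-R₁) R₂, ‖(Complex.exp (y (x * e) τ) - T (x * e) τ) * E x * e‖ ≤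
      D / r ^ (2 * K) * (x ^ (2 * (3 * K)) * Real.exp (-(κ / 2 * x ^ 2 / r))) +
      D * r ^ (2 * K) * (x ^ (2 * 0) * Real.exp (-(κ / 2 * x ^ 2 / r))) := by
    intro x hx
    have hxd : |x| ≤ δ := abs_le.mpr ⟨by linarith [hx.1, hR₁.2], by linarith [hx.2, hR₂.2]⟩
    have hxn : ‖(x : ℂ) * e‖ = |x| := h.norm_mul_dir x
    have hy1 := hbd _ _ (by rw [hxn]; exact hxd.trans d1) (by rw [hn]; exact hr)
      (by rw [hn]; exact hr1)
    rw [hn, hxn] at hy1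
    set Y := y (x * e) τ with hY
    have p1 := Complex.norm_exp_sub_sum_le_norm_mul_exp Y (2 * K)
    -- For `|x| ≤ κ / (2 C₀)` the cubic term uses up at most half of the Gaussian decay.
    have p2 : ‖Y‖ ≤ C₀ + κ / 2 * x ^ 2 / r := by
      refine hy1.trans ?_
      have : C₀ * (|x| ^ 3 / r) ≤ κ / 2 * x ^ 2 / r := by
        rw [← mul_div_assoc]
        refine div_le_div_of_nonneg_right ?_ hr.le
        have hx3 : |x| ^ 3 = |x| * x ^ 2 := by rw [← sq_abs x]; ring
        rw [hx3]
        nlinarith [sq_nonneg x, mul_le_mul_of_nonneg_right hxd (sq_nonneg x)]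
      nlinarith
    have p3 : Real.exp ‖Y‖ * Real.exp (-(κ * x ^ 2 / r)) ≤
        Real.exp C₀ * Real.exp (-(κ / 2 * x ^ 2 / r)) := by
      rw [← Real.exp_add, ← Real.exp_add]
      apply Real.exp_le_exp.mpr
      have : κ * x ^ 2 / r = κ / 2 * x ^ 2 / r + κ / 2 * x ^ 2 / r := by field_simp; ring
      linarith
    have p4 : ‖Y‖ ^ (2 * K) ≤ (2 * C₀) ^ (2 * K) *
        (x ^ (2 * (3 * K)) / r ^ (2 * K) + r ^ (2 * K)) := by
      have q1 : ‖Y‖ ≤ 2 * C₀ * max (|x| ^ 3 / r) r := by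
        refine hy1.trans ?_
        have := le_max_left (|x| ^ 3 / r) r
        have := le_max_right (|x| ^ 3 / r) r
        nlinarith
      have q2 : max (|x| ^ 3 / r) r ^ (2 * K) ≤ (|x| ^ 3 / r) ^ (2 * K) + r ^ (2 * K) := by
        have z1 : 0 ≤ (|x| ^ 3 / r) ^ (2 * K) := by positivity
        have z2 : 0 ≤ r ^ (2 * K) := by positivity
        rcases max_choice (|x| ^ 3 / r) r with hh | hh <;> rw [hh] <;> linarith
      have q3 : (|x| ^ 3 / r) ^ (2 * K) = x ^ (2 * (3 * K)) / r ^ (2 * K) := by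
        rw [div_pow, ← pow_mul, show 3 * (2 * K) = 2 * (3 * K) by ring, pow_mul, sq_abs, ← pow_mul]
      calc _ ≤ (2 * C₀ * max (|x| ^ 3 / r) r) ^ (2 * K) := by gcongr
        _ = (2 * C₀) ^ (2 * K) * max (|x| ^ 3 / r) r ^ (2 * K) := by rw [mul_pow]
        _ ≤ _ := by rw [← q3]; gcongr
    rw [norm_mul, norm_mul, h.norm_dir, mul_one, hE]
    simp only
    rw [norm_gauss h hr, ← hκ]
    have z3 : 0 ≤ x ^ (2 * (3 * K)) := by rw [pow_mul]; positivity
    calc _ ≤ ‖Y‖ ^ (2 * K) * Real.exp ‖Y‖ * Real.exp (-(κ * x ^ 2 / r)) := by gcongr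
      _ = ‖Y‖ ^ (2 * K) * (Real.exp ‖Y‖ * Real.exp (-(κ * x ^ 2 / r))) := by ring
      _ ≤ ((2 * C₀) ^ (2 * K) * (x ^ (2 * (3 * K)) / r ^ (2 * K) + r ^ (2 * K))) *
          (Real.exp C₀ * Real.exp (-(κ / 2 * x ^ 2 / r))) := by gcongr
      _ = _ := by rw [hD]; ring
  have hcontE : ∀ F : ℂ → ℂ → ℂ, ContinuousOn (fun s => F s τ) (Metric.ball 0 δ₀) →
      IntervalIntegrable (fun x : ℝ => F (x * e) τ * E x * e) MeasureTheory.volume (-R₁) R₂ :=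
    fun F hF => intervalIntegrable_gauss h a τ hF r1 r2 (by linarith [hR₁.2]) (by linarith [hR₂.2])
  have hsub : gaussInt a e τ R₁ R₂ (fun s τ => Complex.exp (y s τ)) - gaussInt a e τ R₁ R₂ T =
      ∫ x in (-R₁)..R₂, (Complex.exp (y (x * e) τ) - T (x * e) τ) * E x * e := by
    rw [gaussInt, gaussInt, ← intervalIntegral.integral_sub]
    · simp only [sub_mul, hE]
    · exact hcontE (fun s τ => Complex.exp (y s τ)) (hcont τ).cexp
    · exact hcontE T (hTE.continuousOn τ)
  have hdiff : ‖∫ x in (-R₁)..R₂, (Complex.exp (y (x * e) τ) - T (x * e) τ) * E x * e‖ ≤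
      D * momentConst (κ / 2) (3 * K) * (√r * r ^ K) +
      D * momentConst (κ / 2) 0 * (√r * r ^ K) := by
    set g₁ : ℝ → ℝ := fun x =>
      D / r ^ (2 * K) * (x ^ (2 * (3 * K)) * Real.exp (-(κ / 2 * x ^ 2 / r))) with hg₁
    set g₂ : ℝ → ℝ := fun x =>
      D * r ^ (2 * K) * (x ^ (2 * 0) * Real.exp (-(κ / 2 * x ^ 2 / r))) with hg₂
    have g1nn : ∀ x, 0 ≤ g₁ x := fun x => by
      have : 0 ≤ x ^ (2 * (3 * K)) := by rw [pow_mul]; positivity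
      rw [hg₁]; positivity
    have g2nn : ∀ x, 0 ≤ g₂ x := fun x => by rw [hg₂]; simp only [mul_zero, pow_zero]; positivity
    have i1 : IntervalIntegrable g₁ MeasureTheory.volume (-R₁) R₂ :=
      Continuous.intervalIntegrable (by fun_prop) _ _
    have i2 : IntervalIntegrable g₂ MeasureTheory.volume (-R₁) R₂ :=
      Continuous.intervalIntegrable (by fun_prop) _ _
    have j1 := norm_integral_le_of_gauss (F := fun x => ((g₁ x : ℝ) : ℂ)) (D := D / r ^ (2 * K))
      (3 * K) (half_pos hκ0) hr (by positivity) r1 r2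
      (fun x _ => by rw [Complex.norm_real, Real.norm_of_nonneg (g1nn x)])
    have j2 := norm_integral_le_of_gauss (F := fun x => ((g₂ x : ℝ) : ℂ)) (D := D * r ^ (2 * K))
      0 (half_pos hκ0) hr (by positivity) r1 r2
      (fun x _ => by rw [Complex.norm_real, Real.norm_of_nonneg (g2nn x)])
    rw [intervalIntegral.integral_ofReal, Complex.norm_real] at j1 j2
    have k1 := (le_abs_self _).trans j1
    have k2 := (le_abs_self _).trans j2
    refine (intervalIntegral.norm_integral_le_of_norm_le (by linarith)
      (Eventually.of_forall fun x hx => key x ⟨hx.1.le, hx.2⟩) (i1.add i2)).trans ?_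
    have hadd : ∫ x in (-R₁)..R₂, (g₁ x + g₂ x) =
        (∫ x in (-R₁)..R₂, g₁ x) + ∫ x in (-R₁)..R₂, g₂ x :=
      intervalIntegral.integral_add i1 i2
    refine (le_of_eq hadd).trans (add_le_add (k1.trans (le_of_eq ?_)) (k2.trans ?_))
    · have : r ^ (3 * K) = r ^ (2 * K) * r ^ K := by rw [← pow_add]; congr 1; ring
      rw [this]
      field_simp
    · have : r ^ (2 * K) ≤ r ^ K := pow_le_pow_of_le_one hr.le hr1.le (by omega)
      rw [pow_zero, mul_one]
      calc _ = D * momentConst (κ / 2) 0 * (√r * r ^ (2 * K)) := by ring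
        _ ≤ _ := by gcongr
  calc _ = ‖(gaussInt a e τ R₁ R₂ T -
        τ ^ (1 / 2 : ℂ) * ∑ j ∈ Finset.range K, A j * τ ^ j) +
        (gaussInt a e τ R₁ R₂ (fun s τ => Complex.exp (y s τ)) - gaussInt a e τ R₁ R₂ T)‖ := by
        congr 1; ring
    _ ≤ C * (√r * r ^ K) + (D * momentConst (κ / 2) (3 * K) * (√r * r ^ K) +
      D * momentConst (κ / 2) 0 * (√r * r ^ K)) := by
        refine (norm_add_le _ _).trans (add_le_add hb ?_)
        rw [hsub]
        exact hdiff
    _ = _ := by ring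

end expands

/-! ### The kernel near the saddle point -/

/-- Half the modulus of the second derivative of the phase at the saddle point. -/
noncomputable def saddleCurvature : ℝ := √3 * Real.pi

lemma saddleCurvature_pos : 0 < saddleCurvature := by
  have := Real.pi_pos
  unfold saddleCurvature
  positivity

lemma saddle_re {s : ℂ} (hs : ‖s‖ < 1 / 6) : 0 < (1 / 6 + s).re ∧ (1 / 6 + s).re < 1 := by
  have h := (Complex.abs_re_le_norm s).trans_lt hs
  have := abs_lt.mp h
  norm_num at this ⊢
  constructor <;> linarith [this.1, this.2]

lemma differentiableOn_phaseCoeff_saddle (k : ℕ) :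
    DifferentiableOn ℂ (fun s => phaseCoeff k (1 / 6 + s)) (Metric.ball 0 (1 / 6)) := by
  intro s hs
  have h := saddle_re (by simpa using hs)
  exact ((analyticAt_phaseCoeff k h.1 h.2).differentiableAt.comp s
    (by fun_prop : DifferentiableAt ℂ (fun s : ℂ => 1 / 6 + s) s)).differentiableWithinAt

/-- The second derivative of the phase at the saddle point. -/
lemma logOneSubDeriv_saddle :
    logOneSubDeriv (5 / 6) - logOneSubDeriv (1 / 6) = -(2 * saddleCurvature : ℝ) := by
  have h3 : ((√3 : ℝ) : ℂ) * (√3 : ℝ) = 3 := by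
    rw [← Complex.ofReal_mul, Real.mul_self_sqrt (by norm_num)]; norm_num
  have hc : Real.cos (2 * Real.pi * (1 / 6)) = 1 / 2 := by
    rw [← Real.cos_pi_div_three]; congr 1; ring
  have hs : Real.sin (2 * Real.pi * (1 / 6)) = √3 / 2 := by
    rw [← Real.sin_pi_div_three]; congr 1; ring
  have e1 : cyc (1 / 6) = (1 + (√3 : ℝ) * Complex.I) / 2 := by
    have := cyc_eq ((1 / 6 : ℝ) : ℂ)
    rw [Complex.ofReal_im, Complex.ofReal_re, hc, hs] at this
    push_cast at this
    rw [this]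
    simp
    ring
  have e2 : cyc (5 / 6) = (1 - (√3 : ℝ) * Complex.I) / 2 := by
    have h := conj_cyc_ofReal (1 / 6)
    have h' := cyc_one_sub (1 / 6)
    push_cast at h
    rw [show (5 / 6 : ℂ) = 1 - 1 / 6 by norm_num, h', ← h, e1]
    simp only [map_div₀, map_add, map_mul, map_one, map_ofNat, Complex.conj_ofReal, Complex.conj_I]
    ring
  have n1 : (1 + (√3 : ℝ) * Complex.I) * (1 - (√3 : ℝ) * Complex.I) = 4 := by
    linear_combination (-((√3 : ℝ) : ℂ) * (√3 : ℝ)) * Complex.I_mul_I + h3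
  have z1 : (1 + (√3 : ℝ) * Complex.I) ≠ 0 := fun h => by rw [h] at n1; norm_num at n1
  have z2 : (1 - (√3 : ℝ) * Complex.I) ≠ 0 := fun h => by rw [h] at n1; norm_num at n1
  have z3 : (1 - (1 + (√3 : ℝ) * Complex.I) / 2) = (1 - (√3 : ℝ) * Complex.I) / 2 := by ring
  have z4 : (1 - (1 - (√3 : ℝ) * Complex.I) / 2) = (1 + (√3 : ℝ) * Complex.I) / 2 := by ring
  rw [logOneSubDeriv, logOneSubDeriv, e1, e2, z3, z4, saddleCurvature]
  have i1 : (1 - (√3 : ℝ) * Complex.I) / 2 / ((1 + (√3 : ℝ) * Complex.I) / 2) =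
      (1 - (√3 : ℝ) * Complex.I) ^ 2 / 4 := by
    field_simp
    linear_combination -n1
  have i2 : (1 + (√3 : ℝ) * Complex.I) / 2 / ((1 - (√3 : ℝ) * Complex.I) / 2) =
      (1 + (√3 : ℝ) * Complex.I) ^ 2 / 4 := by
    field_simp
    linear_combination -n1
  rw [mul_div_assoc, mul_div_assoc, i1, i2]
  push_cast
  linear_combination (2 * Real.pi * (√3 : ℝ)) * Complex.I_mul_I

/-- Taylor expansion of the phase at the saddle point. -/
lemma exists_phaseCoeff_zero_saddle :
    ∃ ρ : ℂ → ℂ, DifferentiableOn ℂ ρ (Metric.ball 0 (1 / 6)) ∧ ∀ s,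
      phaseCoeff 0 (1 / 6 + s) = phase (1 / 6) - saddleCurvature * s ^ 2 + s ^ 3 * ρ s := by
  set U : Set ℂ := Metric.ball 0 (1 / 6) with hU
  have hU0 : U ∈ 𝓝 (0 : ℂ) := Metric.ball_mem_nhds 0 (by norm_num)
  set g : ℂ → ℂ := fun s => phaseCoeff 0 (1 / 6 + s) with hg
  set G : ℂ → ℂ := fun s => -(logOneSub (1 - (1 / 6 + s))) - logOneSub (1 / 6 + s) with hG
  have dg : DifferentiableOn ℂ g U := differentiableOn_phaseCoeff_saddle 0
  have dsl : ∀ u : ℂ → ℂ, DifferentiableOn ℂ u U → DifferentiableOn ℂ (dslope u 0) U :=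
    fun u hu => (Complex.differentiableOn_dslope hU0).mpr hu
  have hgG : ∀ s ∈ U, HasDerivAt g (G s) s := by
    intro s hs
    have h := saddle_re (by simpa [hU] using hs)
    have h2 : HasDerivAt (fun s : ℂ => 1 / 6 + s) 1 s := (hasDerivAt_id s).const_add _
    refine HasDerivAt.congr_deriv (f := g) ((hasDerivAt_phaseCoeff_zero h.1 h.2).comp s h2) ?_
    rw [mul_one]
  have hG0 : G 0 = 0 := by
    have h := logOneSub_add_reflect (v := 1 / 6) (by norm_num) (by norm_num)
    have hs : Real.sin (Real.pi * (1 / 6)) = 1 / 2 := by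
      rw [← Real.sin_pi_div_six]; congr 1; ring
    rw [hs] at h
    norm_num at h
    simp only [hG, add_zero]
    norm_num
    linear_combination -h
  have hg0 : g 0 = phase (1 / 6) := by
    have := phaseCoeff_zero_ofReal (1 / 6)
    push_cast at this
    rw [hg]
    simp only [add_zero]
    exact this
  have hG' : HasDerivAt G (-(2 * saddleCurvature : ℝ)) 0 := by
    have h1 : HasDerivAt (fun s : ℂ => 1 - (1 / 6 + s)) (-1) 0 := by
      exact ((hasDerivAt_id (0 : ℂ)).const_add (1 / 6)).const_sub 1
    have h2 : HasDerivAt (fun s : ℂ => 1 / 6 + s) 1 0 := (hasDerivAt_id (0 : ℂ)).const_add _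
    have m1 : (1 - (1 / 6 + 0) : ℂ) ∈ logDomain := Or.inr (by norm_num)
    have m2 : (1 / 6 + 0 : ℂ) ∈ logDomain := Or.inr (by norm_num)
    have h3 := ((hasDerivAt_logOneSub m1).comp 0 h1).neg.sub ((hasDerivAt_logOneSub m2).comp 0 h2)
    refine HasDerivAt.congr_deriv (f := G) h3 ?_
    rw [← logOneSubDeriv_saddle]
    norm_num
  -- Divide out the factor `s` three times; the first derivative vanishes at the saddle point.
  set g₁ := dslope g 0 with hg₁
  set g₂ := dslope g₁ 0 with hg₂
  have dg₁ := dsl g dg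
  have dg₂ := dsl g₁ dg₁
  have sl : ∀ (u : ℂ → ℂ) (s : ℂ), u s = u 0 + s * dslope u 0 s := by
    intro u s
    have := sub_smul_dslope u 0 s
    rw [sub_zero, smul_eq_mul] at this
    linear_combination -this
  have h10 : g₁ 0 = 0 := by
    rw [hg₁, dslope_same, (hgG 0 (mem_of_mem_nhds hU0)).deriv, hG0]
  have hgs : ∀ s, g s = phase (1 / 6) + s ^ 2 * g₂ s := by
    intro s
    have e1 := sl g s
    have e2 := sl g₁ s
    rw [h10, zero_add] at e2
    rw [← hg₁, hg0, e2, ← hg₂] at e1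
    rw [e1]; ring
  have h20 : g₂ 0 = -saddleCurvature := by
    have dd : DifferentiableOn ℂ (deriv g₂) U := dg₂.deriv Metric.isOpen_ball
    have e1 : ∀ s ∈ U, G s = s * (2 * g₂ s + s * deriv g₂ s) := by
      intro s hs
      have d1 : HasDerivAt g₂ (deriv g₂ s) s :=
        (dg₂.differentiableAt (Metric.isOpen_ball.mem_nhds hs)).hasDerivAt
      have d2 : HasDerivAt (fun s : ℂ => (phase (1 / 6) : ℂ) + s ^ 2 * g₂ s)
          (2 * s * g₂ s + s ^ 2 * deriv g₂ s) s := by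
        have := (((hasDerivAt_id s).pow 2).mul d1).const_add (phase (1 / 6) : ℂ)
        simpa using this
      have d3 : HasDerivAt g (2 * s * g₂ s + s ^ 2 * deriv g₂ s) s :=
        d2.congr_of_eventuallyEq (Eventually.of_forall hgs)
      rw [(hgG s hs).unique d3]; ring
    have d4 : HasDerivAt (fun s => s * (2 * g₂ s + s * deriv g₂ s)) (2 * g₂ 0) 0 := by
      have z1 := (dg₂.differentiableAt hU0).const_mul 2
      have z2 := differentiableAt_id.mul (dd.differentiableAt hU0)
      have := (hasDerivAt_id (0 : ℂ)).mul (z1.add z2).hasDerivAt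
      refine (HasDerivAt.congr_deriv (f := fun s => s * (2 * g₂ s + s * deriv g₂ s)) this ?_)
      rw [Pi.add_apply, Pi.mul_apply, id, zero_mul, zero_mul, add_zero, add_zero, one_mul]
    have d5 := d4.congr_of_eventuallyEq (f₁ := G) (by filter_upwards [hU0] with s hs using e1 s hs)
    have := hG'.unique d5
    push_cast at this
    linear_combination -this / 2
  refine ⟨dslope g₂ 0, dsl g₂ dg₂, fun s => ?_⟩
  have e3 := sl g₂ s
  have := hgs s
  rw [h20] at e3
  rw [e3] at this
  change g s = _
  rw [this]
  ring

/-- The expansion of the logarithm of the kernel near the saddle point, as a quadratic form plus an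
expandable remainder. -/
lemma exists_wkb_saddle (K : ℕ) : ∃ y : ℂ → ℂ → ℂ, Expandable (1 / 6) y ∧
    (∃ C₀ > 0, ∀ s τ : ℂ, ‖s‖ ≤ 1 / 12 → 0 < ‖τ‖ → ‖τ‖ ≤ 1 →
      ‖y s τ‖ ≤ C₀ * (‖s‖ ^ 3 / ‖τ‖ + ‖τ‖)) ∧
    ∀ s τ : ℂ, τ ≠ 0 →
      wkb K τ (1 / 6 + s) = phase (1 / 6) / τ + -(saddleCurvature * s ^ 2 / τ) + y s τ := by
  obtain ⟨ρ, dρ, hρ⟩ := exists_phaseCoeff_zero_saddle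
  set y : ℂ → ℂ → ℂ := fun s τ => τ ^ 0 * (s ^ 3 / τ) ^ 1 * ρ s +
    ∑ k ∈ Finset.range K, τ ^ (2 * k + 1) * (s ^ 3 / τ) ^ 0 *
      (emCoeff (k + 1) * phaseCoeff (k + 1) (1 / 6 + s)) with hy
  refine ⟨y, ?_, ?_, ?_⟩
  · refine Expandable.add _ _ (Expandable.term 0 1 ρ dρ) (Expandable.sum _ _ fun k _ => ?_)
    exact Expandable.term (2 * k + 1) 0 _
      ((differentiableOn_phaseCoeff_saddle (k + 1)).const_mul _)
  · obtain ⟨D, hD0, hD⟩ := exists_norm_le_closedBall dρ (δ₁ := 1 / 12) (by norm_num)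
    have h2 : ∀ k, ∃ E : ℝ, 0 ≤ E ∧ ∀ s : ℂ, ‖s‖ ≤ 1 / 12 →
        ‖emCoeff (k + 1) * phaseCoeff (k + 1) (1 / 6 + s)‖ ≤ E := fun k =>
      exists_norm_le_closedBall ((differentiableOn_phaseCoeff_saddle (k + 1)).const_mul
        (emCoeff (k + 1))) (by norm_num)
    choose E hE0 hE using h2
    have hS : 0 ≤ ∑ k ∈ Finset.range K, E k := Finset.sum_nonneg fun k _ => hE0 k
    refine ⟨D + ∑ k ∈ Finset.range K, E k + 1, by positivity, fun s τ hs hτ hτ1 => ?_⟩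
    have b1 : ‖τ ^ 0 * (s ^ 3 / τ) ^ 1 * ρ s‖ ≤ D * (‖s‖ ^ 3 / ‖τ‖) := by
      rw [pow_zero, one_mul, pow_one, norm_mul, norm_div, norm_pow, mul_comm]
      gcongr
      exact hD s hs
    have b2 : ‖∑ k ∈ Finset.range K, τ ^ (2 * k + 1) * (s ^ 3 / τ) ^ 0 *
        (emCoeff (k + 1) * phaseCoeff (k + 1) (1 / 6 + s))‖ ≤
        (∑ k ∈ Finset.range K, E k) * ‖τ‖ := by
      rw [Finset.sum_mul]
      refine norm_sum_le_of_le _ fun k _ => ?_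
      rw [pow_zero, mul_one, norm_mul, norm_pow, mul_comm]
      gcongr
      · exact hE0 k
      · exact hE k s hs
      · rw [pow_succ]
        exact mul_le_of_le_one_left hτ.le (pow_le_one₀ hτ.le hτ1)
    have z1 : 0 ≤ ‖s‖ ^ 3 / ‖τ‖ := by positivity
    refine (norm_add_le _ _).trans ((add_le_add b1 b2).trans ?_)
    nlinarith [mul_nonneg hS z1, mul_nonneg hD0 hτ.le]
  · intro s τ hτ
    rw [wkb, Finset.sum_range_succ', emCoeff_zero, hρ, hy, add_div, Finset.sum_div]
    have : ∀ k ∈ Finset.range K,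
        emCoeff (k + 1) * τ ^ (2 * (k + 1)) * phaseCoeff (k + 1) (1 / 6 + s) / τ =
        τ ^ (2 * k + 1) * (s ^ 3 / τ) ^ 0 * (emCoeff (k + 1) * phaseCoeff (k + 1) (1 / 6 + s)) := by
      intro k _
      rw [show 2 * (k + 1) = 2 * k + 1 + 1 by ring, pow_succ τ (2 * k + 1)]
      field_simp
    rw [Finset.sum_congr rfl this]
    field_simp
    ring

/-! ### The contribution of the saddle point -/

/-- The numbers `A j` are the coefficients, up to order `K`, of the contribution of a neighbourhood
of the saddle point to the integral of any function which agrees with `exp (wkb K' τ v)` up to a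
relative error `O(|τ|^K)`. They depend neither on the direction of integration nor on the ray. -/
def IsSaddleExpansion (K' K : ℕ) (A : ℕ → ℂ) : Prop := ∀ e ω : ℂ, Admissible e ω →
    ∃ δ' > 0, ∀ δ : ℝ, 0 < δ → δ ≤ δ' → ∀ B : ℝ, 0 ≤ B → ∃ C : ℝ, ∃ r₀ > 0, ∀ r : ℝ, 0 < r → r < r₀ →
      ∀ R₁ ∈ Set.Icc (δ / 2) δ, ∀ R₂ ∈ Set.Icc (δ / 2) δ, ∀ F : ℝ → ℂ,
      IntervalIntegrable F MeasureTheory.volume (-R₁) R₂ →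
      (∀ x ∈ Set.Icc (-R₁) R₂, ∃ ε : ℂ, ‖ε‖ ≤ B * r ^ K ∧
        F x = Complex.exp (wkb K' (r * ω) (1 / 6 + x * e) + ε)) →
      ‖(∫ x in (-R₁)..R₂, F x) * e - Complex.exp (phase (1 / 6) / (r * ω)) *
        ((r * ω) ^ (1 / 2 : ℂ) * ∑ j ∈ Finset.range K, A j * (r * ω) ^ j)‖ ≤
        C * (‖Complex.exp (phase (1 / 6) / (r * ω))‖ * (√r * r ^ K))

/-- Laplace's method at the saddle point. The coefficients come from Gaussian moments of the Taylor
coefficients of `wkb`, which is why they do not depend on the direction or the ray. -/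
lemma exists_isSaddleExpansion (K' K : ℕ) : ∃ A : ℕ → ℂ, IsSaddleExpansion K' K A := by
  obtain ⟨y, hyE, ⟨C₀, hC₀, hbd⟩, hy⟩ := exists_wkb_saddle K'
  have ha := saddleCurvature_pos
  set a := saddleCurvature with ha'
  obtain ⟨A, hA⟩ := expands_exp (K := K) ha (by norm_num) hyE hC₀ (δ₁ := 1 / 12) (by norm_num)
    (fun s τ h1 h2 h3 => hbd s τ h1 h2 h3.le) hyE.continuousOn
  refine ⟨A, fun e ω h => ?_⟩
  obtain ⟨δ₂, hδ₂, k₂⟩ := hA e ω h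
  set κ := a * (e ^ 2 / ω).re with hκ
  have hκ0 : 0 < κ := mul_pos ha h.re_pos
  refine ⟨min δ₂ (min (1 / 12) (κ / (2 * C₀))), by positivity, fun δ hδ hδ' B hB => ?_⟩
  have d2 : δ ≤ δ₂ := hδ'.trans (min_le_left _ _)
  have d3 : δ ≤ 1 / 12 := hδ'.trans ((min_le_right _ _).trans (min_le_left _ _))
  have d4 : δ ≤ κ / (2 * C₀) := hδ'.trans ((min_le_right _ _).trans (min_le_right _ _))
  rw [le_div_iff₀ (by positivity)] at d4
  obtain ⟨C, r₀, hr₀, b⟩ := k₂ δ hδ d2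
  set D := Real.exp C₀ * (B * Real.exp B) with hD
  refine ⟨C + D * momentConst (κ / 2) 0, min r₀ 1, by positivity,
    fun r hr hr' R₁ hR₁ R₂ hR₂ F hF hFε => ?_⟩
  have hr1 : r < 1 := hr'.trans_le (min_le_right _ _)
  have hb := b r hr (hr'.trans_le (min_le_left _ _)) R₁ hR₁ R₂ hR₂
  have hn := h.norm_mul hr
  have hτ0 := h.mul_ne_zero hr
  have r1 : 0 ≤ R₁ := by linarith [hR₁.1]
  have r2 : 0 ≤ R₂ := by linarith [hR₂.1]
  set τ : ℂ := r * ω with hτ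
  set P := Complex.exp (phase (1 / 6) / τ) with hP
  set W : ℝ → ℂ := fun x => Complex.exp (y (x * e) τ) * Complex.exp (-(a * (x * e) ^ 2 / τ))
    with hW
  have hWi : IntervalIntegrable (fun x => W x * e) MeasureTheory.volume (-R₁) R₂ :=
    intervalIntegrable_gauss h a τ (H := fun s τ => Complex.exp (y s τ))
      (hyE.continuousOn τ).cexp r1 r2 (by linarith [hR₁.2]) (by linarith [hR₂.2])
  have hwkb : ∀ x : ℝ, Complex.exp (wkb K' τ (1 / 6 + x * e)) = P * W x := by
    intro x
    rw [hy _ _ hτ0, Complex.exp_add, Complex.exp_add, hP, hW]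
    ring
  have hWb : ∀ x ∈ Set.Icc (-R₁) R₂,
      ‖W x‖ ≤ Real.exp C₀ * Real.exp (-(κ / 2 * x ^ 2 / r)) := by
    intro x hx
    have hxd : |x| ≤ δ := abs_le.mpr ⟨by linarith [hx.1, hR₁.2], by linarith [hx.2, hR₂.2]⟩
    have hxn : ‖(x : ℂ) * e‖ = |x| := h.norm_mul_dir x
    have hy1 := hbd _ _ (by rw [hxn]; exact hxd.trans d3) (by rw [hn]; exact hr)
      (by rw [hn]; exact hr1.le)
    rw [hn, hxn] at hy1
    have p2 : ‖y (x * e) τ‖ ≤ C₀ + κ / 2 * x ^ 2 / r := by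
      refine hy1.trans ?_
      have : C₀ * (|x| ^ 3 / r) ≤ κ / 2 * x ^ 2 / r := by
        rw [← mul_div_assoc]
        refine div_le_div_of_nonneg_right ?_ hr.le
        have hx3 : |x| ^ 3 = |x| * x ^ 2 := by rw [← sq_abs x]; ring
        rw [hx3]
        nlinarith [sq_nonneg x, mul_le_mul_of_nonneg_right hxd (sq_nonneg x)]
      nlinarith
    rw [hW]
    simp only
    rw [norm_mul, norm_gauss h hr, ← hκ]
    refine (mul_le_mul_of_nonneg_right (Complex.norm_exp_le_exp_norm _) (Real.exp_pos _).le).trans ?_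
    rw [← Real.exp_add, ← Real.exp_add]
    apply Real.exp_le_exp.mpr
    have : κ * x ^ 2 / r = κ / 2 * x ^ 2 / r + κ / 2 * x ^ 2 / r := by field_simp; ring
    linarith
  have hdiff : ‖∫ x in (-R₁)..R₂, (F x * e - P * (W x * e))‖ ≤
      ‖P‖ * D * r ^ K * momentConst (κ / 2) 0 * (√r * r ^ 0) := by
    refine norm_integral_le_of_gauss 0 (half_pos hκ0) hr (by positivity) r1 r2 fun x hx => ?_
    obtain ⟨ε, hε, hFx⟩ := hFε x hx
    have hε' : ‖ε‖ ≤ B := hε.trans (mul_le_of_le_one_right hB (pow_le_one₀ hr.le hr1.le))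
    have e1 : F x * e - P * (W x * e) = P * W x * (Complex.exp ε - 1) * e := by
      rw [hFx, Complex.exp_add, hwkb]; ring
    have e2 : ‖Complex.exp ε - 1‖ ≤ B * Real.exp B * r ^ K := by
      have := Complex.norm_exp_sub_sum_le_norm_mul_exp ε 1
      simp only [Finset.sum_range_one, pow_zero, Nat.factorial_zero, Nat.cast_one, div_one,
        pow_one] at this
      refine this.trans ?_
      calc _ ≤ B * r ^ K * Real.exp B := by gcongr
        _ = _ := by ring
    rw [e1, norm_mul, norm_mul, norm_mul, h.norm_dir, mul_one, mul_zero, pow_zero, one_mul]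
    calc _ ≤ ‖P‖ * (Real.exp C₀ * Real.exp (-(κ / 2 * x ^ 2 / r))) * (B * Real.exp B * r ^ K) := by
          gcongr; exact hWb x hx
      _ = _ := by rw [hD]; ring
  rw [intervalIntegral.integral_sub (hF.mul_const e) (hWi.const_mul P),
    intervalIntegral.integral_mul_const, intervalIntegral.integral_const_mul] at hdiff
  have hg : gaussInt a e τ R₁ R₂ (fun s τ => Complex.exp (y s τ)) = ∫ x in (-R₁)..R₂, W x * e := rfl
  rw [hg] at hb
  calc _ = ‖((∫ x in (-R₁)..R₂, F x) * e - P * ∫ x in (-R₁)..R₂, W x * e) +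
        P * ((∫ x in (-R₁)..R₂, W x * e) -
          τ ^ (1 / 2 : ℂ) * ∑ j ∈ Finset.range K, A j * τ ^ j)‖ := by congr 1; ring
    _ ≤ ‖P‖ * D * r ^ K * momentConst (κ / 2) 0 * (√r * r ^ 0) + ‖P‖ * (C * (√r * r ^ K)) := by
        refine (norm_add_le _ _).trans (add_le_add hdiff ?_)
        rw [norm_mul]
        gcongr
    _ = _ := by ring

/-- A Gaussian bound near the saddle point, valid in a thin neighbourhood of the real axis. -/
lemma exists_norm_exp_wkb_le (K : ℕ) : ∃ δ' > 0, δ' ≤ 1 / 12 ∧ ∃ C > 0, ∀ r : ℝ, 0 < r → r ≤ 1 →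
    ∀ s : ℂ, ‖s‖ ≤ δ' → s.im ^ 2 ≤ r →
      ‖Complex.exp (wkb K r (1 / 6 + s))‖ ≤
        C * Real.exp (phase (1 / 6) / r) * Real.exp (-(saddleCurvature / 2 * ‖s‖ ^ 2 / r)) := by
  obtain ⟨y, -, ⟨C₀, hC₀, hbd⟩, hy⟩ := exists_wkb_saddle K
  have ha := saddleCurvature_pos
  set a := saddleCurvature with ha'
  refine ⟨min (1 / 12) (a / (2 * C₀)), by positivity, min_le_left _ _,
    Real.exp (2 * a + C₀), Real.exp_pos _, fun r hr hr1 s hs him => ?_⟩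
  have d3 : ‖s‖ ≤ 1 / 12 := hs.trans (min_le_left _ _)
  have d4 : ‖s‖ ≤ a / (2 * C₀) := hs.trans (min_le_right _ _)
  rw [le_div_iff₀ (by positivity)] at d4
  have hr0 : (r : ℂ) ≠ 0 := by exact_mod_cast hr.ne'
  have hn : ‖(r : ℂ)‖ = r := by rw [Complex.norm_real, Real.norm_of_nonneg hr.le]
  have hy1 := hbd s r d3 (by rw [hn]; exact hr) (by rw [hn]; exact hr1)
  rw [hn] at hy1
  -- The cubic term uses up at most half of the Gaussian decay.
  have p2 : ‖y s r‖ ≤ C₀ + a / 2 * ‖s‖ ^ 2 / r := by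
    refine hy1.trans ?_
    have : C₀ * (‖s‖ ^ 3 / r) ≤ a / 2 * ‖s‖ ^ 2 / r := by
      rw [← mul_div_assoc]
      refine div_le_div_of_nonneg_right ?_ hr.le
      nlinarith [mul_le_mul_of_nonneg_right d4 (sq_nonneg ‖s‖)]
    nlinarith
  -- In the strip `|Im s|² ≤ r` the exponent differs by a bounded quantity from its value at `|s|`.
  have p3 : (-(a * s ^ 2 / r) : ℂ).re ≤ -(a * ‖s‖ ^ 2 / r) + 2 * a := by
    have e1 : (-(a * s ^ 2 / r) : ℂ) = ((-(a / r) : ℝ) : ℂ) * s ^ 2 := by push_cast; ring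
    have e2 : (s ^ 2).re = ‖s‖ ^ 2 - 2 * s.im ^ 2 := by
      rw [← Complex.normSq_eq_norm_sq, Complex.normSq_apply, sq, Complex.mul_re]; ring
    rw [e1, Complex.re_ofReal_mul, e2]
    have : a / r * (2 * s.im ^ 2) ≤ 2 * a := by
      rw [div_mul_eq_mul_div, div_le_iff₀ hr]; nlinarith
    have e3 : a * ‖s‖ ^ 2 / r = a / r * ‖s‖ ^ 2 := by ring
    rw [e3]; linarith
  have p4 : ((phase (1 / 6) : ℂ) / r).re = phase (1 / 6) / r := by
    rw [← Complex.ofReal_div, Complex.ofReal_re]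
  rw [Complex.norm_exp, hy s r hr0, ← Real.exp_add, ← Real.exp_add]
  apply Real.exp_le_exp.mpr
  rw [Complex.add_re, Complex.add_re, p4]
  have p5 := (Complex.re_le_norm (y s r)).trans p2
  have : a * ‖s‖ ^ 2 / r = a / 2 * ‖s‖ ^ 2 / r + a / 2 * ‖s‖ ^ 2 / r := by field_simp; ring
  linarith

/-! ### From sums to integrals -/

section midpoint
variable {E : ℂ → ℂ} {U : Set ℂ} {r : ℝ}

lemma norm_iteratedDeriv_le_of_ball (hE : DifferentiableOn ℂ E U) (hr : 0 < r)
    {c : ℂ} {M : ℝ} (hc : ∀ z, ‖z - c‖ ≤ √r → z ∈ U) (hM : ∀ z, ‖z - c‖ ≤ √r → ‖E z‖ ≤ M) (n : ℕ) :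
    ‖iteratedDeriv n E c‖ ≤ n.factorial * M / √r ^ n := by
  have hs : 0 < √r := Real.sqrt_pos.mpr hr
  have hsub : Metric.closedBall c (√r) ⊆ U := fun z hz =>
    hc z (by rwa [Metric.mem_closedBall, dist_eq_norm] at hz)
  refine Complex.norm_iteratedDeriv_le_of_forall_mem_sphere_norm_le n hs ?_ fun z hz => ?_
  · exact ⟨hE.mono (Metric.ball_subset_closedBall.trans hsub),
      hE.continuousOn.mono (Metric.closure_ball_subset_closedBall.trans hsub)⟩
  · exact hM z (by rw [Metric.mem_sphere, dist_eq_norm] at hz; exact hz.le)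

/-- The midpoint rule with step `r` for a function that is holomorphic, and bounded by `M₁`, within
distance `√r` of the interval: the error is `O(r^M)`, up to the size `M₀` near the endpoints. This is
the Euler–Maclaurin formula, where Cauchy's estimates on discs of radius `√r` show that each further
derivative gains a factor `√r`. -/
lemma exists_midpoint_le (M : ℕ) : ∃ C ≥ 0, ∀ (r : ℝ) (J : ℕ) (a : ℝ) (E : ℂ → ℂ) (U : Set ℂ)
    (M₀ M₁ : ℝ), 0 < r → r ≤ 1 → J * r ≤ 1 → IsOpen U → DifferentiableOn ℂ E U →
    (∀ x ∈ Set.Icc a (a + J * r), ∀ z : ℂ, ‖z - x‖ ≤ √r → z ∈ U) →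
    (∀ z : ℂ, ‖z - a‖ ≤ √r → ‖E z‖ ≤ M₀) →
    (∀ z : ℂ, ‖z - (a + J * r : ℝ)‖ ≤ √r → ‖E z‖ ≤ M₀) →
    (∀ x ∈ Set.Icc a (a + J * r), ∀ z : ℂ, ‖z - x‖ ≤ √r → ‖E z‖ ≤ M₁) →
    ‖r * ∑ j ∈ Finset.range J, E ((a + (j + 1 / 2) * r : ℝ)) - ∫ x in a..(a + J * r), E x‖ ≤
      C * (M₀ + r ^ M * M₁) := by
  set S := ∑ k ∈ Finset.range M, ‖emCoeff (k + 1)‖ * (2 * (2 * k + 1).factorial) with hS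
  have hS0 : 0 ≤ S := by positivity
  have hE0 := emConst_nonneg M
  refine ⟨S + emConst M * (2 * M + 1).factorial, by positivity,
    fun r J a E U M₀ M₁ hr hr1 hJ hU hE hball h0 h0' h1 => ?_⟩
  have hs : 0 < √r := Real.sqrt_pos.mpr hr
  have hs1 : √r ≤ 1 := Real.sqrt_le_one.mpr hr1
  have hss : √r * √r = r := Real.mul_self_sqrt hr.le
  have hJr : 0 ≤ J * r := by positivity
  have hM0 : 0 ≤ M₀ := (norm_nonneg _).trans (h0 a (by rw [sub_self, norm_zero]; exact hs.le))
  have hM1 : 0 ≤ M₁ := (norm_nonneg _).trans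
    (h1 a ⟨le_rfl, by linarith⟩ a (by rw [sub_self, norm_zero]; exact hs.le))
  have hmem : ∀ x ∈ Set.Icc a (a + J * r), (x : ℂ) ∈ U := fun x hx =>
    hball x hx x (by rw [sub_self, norm_zero]; exact hs.le)
  have hmem' : ∀ t ∈ Set.Icc (0 : ℝ) (0 + J), a + t * r ∈ Set.Icc a (a + J * r) := by
    intro t ht
    rw [zero_add] at ht
    have : t * r ≤ J * r := by gcongr; exact ht.2
    exact ⟨by linarith [mul_nonneg ht.1 hr.le], by linarith⟩
  -- The chain of a primitive of the rescaled function and its derivatives.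
  set G : ℕ → ℝ → ℂ := fun k => match k with
    | 0 => fun t => ∫ x in a..(a + t * r), E x
    | k + 1 => fun t => (r : ℂ) ^ (k + 1) * iteratedDeriv k E ((a + t * r : ℝ)) with hG
  have hline : ∀ t : ℝ, HasDerivAt (fun t : ℝ => a + t * r) r t := fun t => by
    simpa using ((hasDerivAt_id t).mul_const r).const_add a
  have hcont : ∀ x ∈ Set.Icc a (a + J * r), ContinuousAt (fun x : ℝ => E x) x := fun x hx =>
    (hE.continuousOn.continuousAt (hU.mem_nhds (hmem x hx))).comp
      Complex.continuous_ofReal.continuousAt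
  have hderiv : ∀ k < 2 * M + 2, ∀ t ∈ Set.Icc (0 : ℝ) (0 + J), HasDerivAt (G k) (G (k + 1) t) t := by
    intro k _ t ht
    have hx := hmem' t ht
    rcases k with _ | k
    · have hV : IsOpen {x : ℝ | (x : ℂ) ∈ U} := hU.preimage Complex.continuous_ofReal
      have hint : IntervalIntegrable (fun x : ℝ => E x) MeasureTheory.volume a (a + t * r) := by
        refine ContinuousOn.intervalIntegrable fun x hx' => ?_
        rw [Set.uIcc_of_le hx.1] at hx'
        exact (hcont x ⟨hx'.1, hx'.2.trans hx.2⟩).continuousWithinAt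
      have hon : ContinuousOn (fun x : ℝ => E x) {x : ℝ | (x : ℂ) ∈ U} :=
        hE.continuousOn.comp Complex.continuous_ofReal.continuousOn fun x hx => hx
      have := intervalIntegral.integral_hasDerivAt_right hint
        (hon.stronglyMeasurableAtFilter hV _ (hmem _ hx)) (hcont _ hx)
      have h2 := this.scomp t (hline t)
      refine h2.congr_deriv ?_
      simp [hG]
    · have hd : DifferentiableAt ℂ (iteratedDeriv k E) ((a + t * r : ℝ)) := by
        rw [iteratedDeriv_eq_iterate]
        exact ((hE.analyticAt (hU.mem_nhds (hmem _ hx))).iterated_deriv k).differentiableAt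
      have h3 := (hd.hasDerivAt.comp_ofReal.scomp t (hline t)).const_mul ((r : ℂ) ^ (k + 1))
      refine h3.congr_deriv ?_
      simp only [hG, ← iteratedDeriv_succ, Complex.real_smul]
      ring
  have hEM := euler_maclaurin_sum (a := 0) J M G
    (fun _ => r ^ (2 * M + 2) * ((2 * M + 1).factorial * M₁ / √r ^ (2 * M + 1))) hderiv (by
      intro j hj t ht
      have hj2 : (j : ℝ) + 1 ≤ J := by exact_mod_cast hj
      have hj0 : (0 : ℝ) ≤ j := j.cast_nonneg
      have hx := hmem' t ⟨by linarith [ht.1], by linarith [ht.2]⟩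
      simp only [hG]
      rw [norm_mul, norm_pow, Complex.norm_real, Real.norm_of_nonneg hr.le]
      gcongr
      exact norm_iteratedDeriv_le_of_ball hE hr (hball _ hx) (h1 _ hx) _)
  have hend : ∀ c ∈ Set.Icc a (a + J * r), (∀ z : ℂ, ‖z - c‖ ≤ √r → ‖E z‖ ≤ M₀) → ∀ k : ℕ,
      ‖(r : ℂ) ^ (2 * k + 1 + 1) * iteratedDeriv (2 * k + 1) E c‖ ≤ (2 * k + 1).factorial * M₀ := by
    intro c hc hb k
    have := norm_iteratedDeriv_le_of_ball hE hr (hball _ hc) hb (2 * k + 1)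
    rw [norm_mul, norm_pow, Complex.norm_real, Real.norm_of_nonneg hr.le]
    have hp : r ^ (2 * k + 1 + 1) ≤ √r ^ (2 * k + 1) := by
      calc r ^ (2 * k + 1 + 1) ≤ r ^ (2 * k + 1) := pow_le_pow_of_le_one hr.le hr1 (by omega)
        _ ≤ √r ^ (2 * k + 1) := by
          gcongr
          nlinarith
    calc _ ≤ √r ^ (2 * k + 1) * ((2 * k + 1).factorial * M₀ / √r ^ (2 * k + 1)) := by gcongr
      _ = _ := by field_simp
  have hsum : ∑ k ∈ Finset.range (M + 1), emCoeff k * (G (2 * k) (0 + J) - G (2 * k) 0) =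
      ∑ k ∈ Finset.range M, emCoeff (k + 1) * (G (2 * (k + 1)) (0 + J) - G (2 * (k + 1)) 0) +
      ∫ x in a..(a + J * r), E x := by
    rw [Finset.sum_range_succ', emCoeff_zero, one_mul]
    congr 1
    simp [hG]
  have hsum' : ∑ j ∈ Finset.range J, G 1 (0 + j + 1 / 2) =
      r * ∑ j ∈ Finset.range J, E ((a + (j + 1 / 2) * r : ℝ)) := by
    rw [Finset.mul_sum]
    refine Finset.sum_congr rfl fun j _ => ?_
    simp [hG]
  have hbd : ‖∑ k ∈ Finset.range M, emCoeff (k + 1) *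
      (G (2 * (k + 1)) (0 + J) - G (2 * (k + 1)) 0)‖ ≤ S * M₀ := by
    rw [hS, Finset.sum_mul]
    refine norm_sum_le_of_le _ fun k _ => ?_
    rw [norm_mul, mul_assoc]
    refine mul_le_mul_of_nonneg_left ?_ (norm_nonneg _)
    have a1 := hend _ ⟨by linarith, le_rfl⟩ h0' k
    have a2 := hend _ ⟨le_rfl, by linarith⟩ h0 k
    have e1 : G (2 * (k + 1)) (0 + J) =
        (r : ℂ) ^ (2 * k + 1 + 1) * iteratedDeriv (2 * k + 1) E ((a + J * r : ℝ)) := by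
      rw [show 2 * (k + 1) = 2 * k + 1 + 1 by ring, zero_add]
    have e2 : G (2 * (k + 1)) 0 =
        (r : ℂ) ^ (2 * k + 1 + 1) * iteratedDeriv (2 * k + 1) E (a : ℝ) := by
      rw [show 2 * (k + 1) = 2 * k + 1 + 1 by ring]
      simp only [hG, zero_mul, add_zero]
    rw [e1, e2]
    refine (norm_sub_le _ _).trans ((add_le_add a1 a2).trans (le_of_eq ?_))
    ring
  have hrem : emConst M * ∑ j ∈ Finset.range J,
      r ^ (2 * M + 2) * ((2 * M + 1).factorial * M₁ / √r ^ (2 * M + 1)) ≤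
      emConst M * (2 * M + 1).factorial * (r ^ M * M₁) := by
    rw [Finset.sum_const, Finset.card_range, nsmul_eq_mul, mul_assoc]
    refine mul_le_mul_of_nonneg_left ?_ hE0
    have e1 : r ^ (2 * M + 2) = r * (r ^ M * √r * √r ^ (2 * M + 1)) := by
      have : √r ^ (2 * M + 1) = r ^ M * √r := by rw [pow_succ, pow_mul, sq, hss]
      rw [this]
      calc _ = r * (r ^ M * (r * r ^ M)) := by ring
        _ = r * (r ^ M * ((√r * √r) * r ^ M)) := by rw [hss]
        _ = _ := by ring
    rw [e1]
    calc _ = (J * r) * (√r * ((2 * M + 1).factorial * (r ^ M * M₁))) := by field_simp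
      _ ≤ 1 * (1 * ((2 * M + 1).factorial * (r ^ M * M₁))) := by gcongr
      _ = _ := by ring
  rw [hsum, hsum'] at hEM
  set X := ∑ k ∈ Finset.range M, emCoeff (k + 1) *
      (G (2 * (k + 1)) (0 + J) - G (2 * (k + 1)) 0) with hX
  calc _ = ‖(r * ∑ j ∈ Finset.range J, E ((a + (j + 1 / 2) * r : ℝ)) -
        (X + ∫ x in a..(a + J * r), E x)) + X‖ := by congr 1; ring
    _ ≤ emConst M * (2 * M + 1).factorial * (r ^ M * M₁) + S * M₀ :=
        (norm_add_le _ _).trans (add_le_add (hEM.trans hrem) hbd)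
    _ ≤ _ := by
        have : 0 ≤ r ^ M * M₁ := by positivity
        nlinarith [mul_nonneg hS0 this, mul_nonneg (mul_nonneg hE0
          (Nat.cast_nonneg (α := ℝ) (2 * M + 1).factorial)) hM0]

end midpoint

/-! ### The Kashaev invariant -/

/-- The ratio of consecutive terms is `(2 sin (π (n + 1) / N))²`, so the terms decrease up to
`n = N / 6`, increase up to `n = 5 N / 6`, and decrease from there on. -/
lemma norm_qPoch_cyc_succ {N n : ℕ} (hn : n + 1 ≤ N) :
    ‖qPoch (cyc (1 / N)) (n + 1)‖ ^ 2 =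
      (2 * Real.sin (Real.pi * ((n + 1 : ℝ) / N))) ^ 2 * ‖qPoch (cyc (1 / N)) n‖ ^ 2 := by
  have hN : (0 : ℝ) < N := by
    have : 0 < N := by omega
    exact_mod_cast this
  have hn' : (n : ℝ) + 1 ≤ N := by exact_mod_cast hn
  have e1 : cyc (1 / N) ^ (n + 1) = cyc (((n + 1 : ℝ) / N : ℝ)) := by
    rw [← cyc_nat_mul]; congr 1; push_cast; ring
  rw [qPoch_succ, norm_mul, e1, norm_one_sub_cyc (by positivity) (by rw [div_le_one hN]; exact hn')]
  ring

lemma two_sin_sq_le_one {v : ℝ} (h0 : 0 ≤ v) (h1 : v ≤ 1 / 6) :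
    (2 * Real.sin (Real.pi * v)) ^ 2 ≤ 1 := by
  have hs : 0 ≤ Real.sin (Real.pi * v) :=
    Real.sin_nonneg_of_nonneg_of_le_pi (by have := Real.pi_pos; positivity)
      (by have := Real.pi_pos; nlinarith)
  have h2 : 2 * Real.sin (Real.pi * v) ≤ 1 := by
    rcases h1.lt_or_eq with h | h
    · rcases h0.lt_or_eq with h' | h'
      · exact (two_sin_lt_one h' h).2.le
      · rw [← h']; simp
    · rw [h, sin_pi_div_six']; norm_num
  exact pow_le_one₀ (by positivity) h2

lemma two_sin_sq_le_one' {v : ℝ} (h0 : 5 / 6 ≤ v) (h1 : v ≤ 1) :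
    (2 * Real.sin (Real.pi * v)) ^ 2 ≤ 1 := by
  rw [← sin_pi_one_sub]
  exact two_sin_sq_le_one (by linarith) (by linarith)

lemma one_le_two_sin_sq {v : ℝ} (h0 : 1 / 6 ≤ v) (h1 : v ≤ 5 / 6) :
    1 ≤ (2 * Real.sin (Real.pi * v)) ^ 2 := by
  have h2 : 1 ≤ 2 * Real.sin (Real.pi * v) := by
    rcases h0.lt_or_eq with h | h
    · rcases h1.lt_or_eq with h' | h'
      · exact (one_lt_two_sin h h').le
      · rw [h', ← sin_pi_one_sub, show (1 - 5 / 6 : ℝ) = 1 / 6 by norm_num, sin_pi_div_six']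
        norm_num
    · rw [← h, sin_pi_div_six']; norm_num
  exact one_le_pow₀ h2

section terms
variable {N : ℕ}

lemma norm_qPoch_cyc_le_one (hN : 0 < N) {n : ℕ} (hn : (n : ℝ) / N ≤ 1 / 6) :
    ‖qPoch (cyc (1 / N)) n‖ ^ 2 ≤ 1 := by
  have hN' : (0 : ℝ) < N := by exact_mod_cast hN
  induction n with
  | zero => simp
  | succ n ih =>
    push_cast at hn
    have h1 : ((n + 1 : ℕ) : ℝ) ≤ N := by
      rw [div_le_iff₀ hN'] at hn; push_cast; linarith
    rw [norm_qPoch_cyc_succ (by exact_mod_cast h1)]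
    have h2 : (n : ℝ) / N ≤ 1 / 6 := le_trans (by gcongr; linarith) hn
    exact mul_le_one₀ (two_sin_sq_le_one (by positivity) hn) (by positivity) (ih h2)

/-- The terms of the Kashaev invariant up to index `n₁ ≤ 5N/6` are dominated by the first one and the
last one. -/
lemma norm_qPoch_cyc_le_max (hN : 0 < N) {n n₁ : ℕ} (hn : n ≤ n₁) (h₁ : (n₁ : ℝ) / N ≤ 5 / 6) :
    ‖qPoch (cyc (1 / N)) n‖ ^ 2 ≤ 1 + ‖qPoch (cyc (1 / N)) n₁‖ ^ 2 := by
  have hN' : (0 : ℝ) < N := by exact_mod_cast hN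
  rcases le_or_gt ((n : ℝ) / N) (1 / 6) with h | h
  · have := norm_qPoch_cyc_le_one hN h
    have : 0 ≤ ‖qPoch (cyc (1 / N)) n₁‖ ^ 2 := by positivity
    linarith
  · suffices ‖qPoch (cyc (1 / N)) n‖ ^ 2 ≤ ‖qPoch (cyc (1 / N)) n₁‖ ^ 2 by linarith
    induction n₁, hn using Nat.le_induction with
    | base => exact le_rfl
    | succ m hm ih =>
      push_cast at h₁
      have h2 : (m : ℝ) / N ≤ 5 / 6 := le_trans (by gcongr; linarith) h₁
      have h3 : ((m + 1 : ℕ) : ℝ) ≤ N := by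
        rw [div_le_iff₀ hN'] at h₁; push_cast; linarith
      refine (ih h2).trans ?_
      rw [norm_qPoch_cyc_succ (by exact_mod_cast h3)]
      refine le_mul_of_one_le_left (by positivity) (one_le_two_sin_sq ?_ h₁)
      have : (n : ℝ) ≤ m := by exact_mod_cast hm
      exact h.le.trans (by gcongr; linarith)

lemma norm_qPoch_cyc_le_of_le {n n₂ : ℕ} (hn : n₂ ≤ n) (hnN : n < N) (h₂ : 5 / 6 ≤ (n₂ : ℝ) / N) :
    ‖qPoch (cyc (1 / N)) n‖ ^ 2 ≤ ‖qPoch (cyc (1 / N)) n₂‖ ^ 2 := by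
  have hN' : (0 : ℝ) < N := by
    have : 0 < N := by omega
    exact_mod_cast this
  induction n, hn using Nat.le_induction with
  | base => exact le_rfl
  | succ m hm ih =>
    have hm' : (n₂ : ℝ) ≤ m := by exact_mod_cast hm
    have h3 : ((m + 1 : ℕ) : ℝ) ≤ N := by exact_mod_cast hnN.le
    push_cast at h3
    rw [norm_qPoch_cyc_succ hnN.le]
    refine le_trans (mul_le_of_le_one_left (by positivity) (two_sin_sq_le_one' ?_ ?_)) (ih (by omega))
    · exact h₂.trans (by gcongr; linarith)
    · rw [div_le_one hN']; exact h3

end terms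

/-- The terms in reverse order, in which the largest one has index about `N / 6`. -/
lemma kashaev_eq_sum (N : ℕ) :
    kashaev N = ∑ m ∈ Finset.range N, ‖qPoch (cyc (1 / N)) (N - 1 - m)‖ ^ 2 := by
  rw [kashaev, ← Finset.sum_range_reflect]
  have : Complex.exp (2 * Real.pi * Complex.I / N) = cyc (1 / N) := by
    rw [cyc]; congr 1; ring
  rw [this]

lemma differentiableOn_exp_wkb (K : ℕ) (τ : ℂ) :
    DifferentiableOn ℂ (fun v => Complex.exp (wkb K τ v)) {v | 0 < v.re ∧ v.re < 1} := by
  intro v hv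
  have : DifferentiableAt ℂ (fun v => wkb K τ v) v := by
    unfold wkb
    refine DifferentiableAt.div_const (DifferentiableAt.fun_sum fun k _ => ?_) _
    exact (analyticAt_phaseCoeff k hv.1 hv.2).differentiableAt.const_mul _
  exact this.cexp.differentiableWithinAt

lemma admissible_one : Admissible 1 1 := ⟨by simp, by simp, by simp, by simp⟩

/-- The midpoint rule near the saddle point. The integrand is a Gaussian of width `√r`, which still
varies slowly compared with the step `r`. -/
lemma exists_window_midpoint_le (K' K : ℕ) : ∃ δ' > 0, δ' ≤ 1 / 12 ∧ ∀ δ : ℝ, 0 < δ → δ ≤ δ' →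
    ∃ C > 0, ∃ r₀ > 0, ∀ (r : ℝ) (J : ℕ) (x₀ : ℝ), 0 < r → r < r₀ → J * r ≤ 1 →
      x₀ ∈ Set.Icc (1 / 6 - δ) (1 / 6 - δ / 2) → x₀ + J * r ∈ Set.Icc (1 / 6 + δ / 2) (1 / 6 + δ) →
      ‖r * ∑ j ∈ Finset.range J, Complex.exp (wkb K' r ((x₀ + (j + 1 / 2) * r : ℝ))) -
        ∫ x in x₀..(x₀ + J * r), Complex.exp (wkb K' r x)‖ ≤
        C * (Real.exp (phase (1 / 6) / r) * r ^ K) := by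
  obtain ⟨δ₁, hδ₁, hδ₁', C₁, hC₁, hb⟩ := exists_norm_exp_wkb_le K'
  obtain ⟨C₂, hC₂, hm⟩ := exists_midpoint_le K
  have ha := saddleCurvature_pos
  set a := saddleCurvature with ha'
  refine ⟨δ₁ / 2, by positivity, by linarith, fun δ hδ hδ' => ?_⟩
  set c := a / 2 * (δ / 4) ^ 2 with hc
  have hc0 : 0 < c := by positivity
  set D := (K.factorial : ℝ) / c ^ K with hD
  refine ⟨C₂ * (C₁ * D + C₁) + 1, by positivity, min 1 ((δ / 4) ^ 2), by positivity,
    fun r J x₀ hr hr' hJ hx₀ hx₁ => ?_⟩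
  have hr1 : r ≤ 1 := hr'.le.trans (min_le_left _ _)
  have hr2 : √r ≤ δ / 4 := by
    rw [Real.sqrt_le_left (by positivity)]
    exact hr'.le.trans (min_le_right _ _)
  have hsq : √r ^ 2 = r := Real.sq_sqrt hr.le
  have hJr : 0 ≤ J * r := by positivity
  set P := Real.exp (phase (1 / 6) / r) with hP
  have hP0 : 0 < P := Real.exp_pos _
  -- A Gaussian bound at points close to a point `x` of the window.
  have hnear : ∀ x ∈ Set.Icc x₀ (x₀ + J * r), ∀ z : ℂ, ‖z - x‖ ≤ √r →
      ‖Complex.exp (wkb K' r z)‖ ≤ C₁ * P * Real.exp (-(a / 2 * ‖z - 1 / 6‖ ^ 2 / r)) := by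
    intro x hx z hz
    have h1 : ‖z - 1 / 6‖ ≤ δ₁ := by
      have e : z - 1 / 6 = (z - x) + ((x - 1 / 6 : ℝ) : ℂ) := by push_cast; ring
      rw [e]
      refine (norm_add_le _ _).trans ?_
      have : ‖((x - 1 / 6 : ℝ) : ℂ)‖ ≤ δ := by
        rw [Complex.norm_real, Real.norm_eq_abs]
        exact abs_le.mpr ⟨by linarith [hx.1, hx₀.1], by linarith [hx.2, hx₁.2]⟩
      linarith
    have h2 : (z - 1 / 6).im ^ 2 ≤ r := by
      have e : (z - 1 / 6).im = (z - x).im := by norm_num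
      have := (Complex.abs_im_le_norm (z - x)).trans hz
      rw [e, ← sq_abs, ← hsq]
      gcongr
    have := hb r hr hr1 (z - 1 / 6) h1 h2
    rwa [add_sub_cancel] at this
  have hend : ∀ x ∈ Set.Icc x₀ (x₀ + J * r), δ / 2 ≤ |x - 1 / 6| → ∀ z : ℂ, ‖z - x‖ ≤ √r →
      ‖Complex.exp (wkb K' r z)‖ ≤ C₁ * D * (P * r ^ K) := by
    intro x hx hxs z hz
    refine (hnear x hx z hz).trans ?_
    have h1 : δ / 4 ≤ ‖z - 1 / 6‖ := by
      have e : ((x - 1 / 6 : ℝ) : ℂ) = (z - 1 / 6) - (z - x) := by push_cast; ring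
      have h3 := norm_sub_le (z - 1 / 6) (z - x)
      rw [← e, Complex.norm_real, Real.norm_eq_abs] at h3
      linarith
    have h2 : Real.exp (-(a / 2 * ‖z - 1 / 6‖ ^ 2 / r)) ≤ D * r ^ K := by
      refine le_trans ?_ (exp_neg_div_le hc0 hr K)
      apply Real.exp_le_exp.mpr
      rw [hc]
      gcongr
    calc _ ≤ C₁ * P * (D * r ^ K) := by gcongr
      _ = _ := by ring
  have hmid := hm r J x₀ (fun v => Complex.exp (wkb K' r v)) {v | 0 < v.re ∧ v.re < 1}
    (C₁ * D * (P * r ^ K)) (C₁ * P) hr hr1 hJ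
    ((isOpen_lt continuous_const Complex.continuous_re).inter
      (isOpen_lt Complex.continuous_re continuous_const))
    (differentiableOn_exp_wkb K' r) (by
      intro x hx z hz
      have h1 := abs_le.mp ((Complex.abs_re_le_norm (z - x)).trans hz)
      simp only [Complex.sub_re, Complex.ofReal_re] at h1
      constructor <;> linarith [h1.1, h1.2, hx.1, hx.2, hx₀.1, hx₁.2])
    (hend x₀ ⟨le_rfl, by linarith⟩ (by
      rw [abs_of_nonpos (by linarith [hx₀.2])]; linarith [hx₀.2]))
    (hend _ ⟨by linarith, le_rfl⟩ (by
      rw [abs_of_nonneg (by linarith [hx₁.1])]; linarith [hx₁.1]))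
    (fun x hx z hz => (hnear x hx z hz).trans (mul_le_of_le_one_right (by positivity)
      (Real.exp_le_one_iff.mpr (by rw [neg_nonpos]; positivity))))
  refine hmid.trans ?_
  have : 0 ≤ P * r ^ K := by positivity
  nlinarith

/-- The terms of the Kashaev invariant near the largest one agree with their expansion, and they are
negligible at distance at least `δ / 4`. -/
lemma exists_window_term_le (K : ℕ) : ∃ δ' > 0, δ' ≤ 1 / 12 ∧ ∀ δ : ℝ, 0 < δ → δ ≤ δ' →
    ∃ C > 0, ∀ N m : ℕ, 2 ≤ N → |((m : ℝ) + 1 / 2) / N - 1 / 6| ≤ δ →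
      ‖((‖qPoch (cyc (1 / N)) (N - 1 - m)‖ ^ 2 : ℝ) : ℂ) -
        N * Complex.exp (wkb K (1 / N) ((((m : ℝ) + 1 / 2) / N : ℝ)))‖ ≤
        N * (C * (Real.exp (phase (1 / 6) * N) * (1 / (N : ℝ)) ^ (2 * K))) ∧
      (δ / 4 ≤ |((m : ℝ) + 1 / 2) / N - 1 / 6| →
        ‖qPoch (cyc (1 / N)) (N - 1 - m)‖ ^ 2 ≤
          N * (C * (Real.exp (phase (1 / 6) * N) * (1 / (N : ℝ)) ^ (2 * K)))) := by
  obtain ⟨δ₁, hδ₁, hδ₁', C₁, hC₁, hb⟩ := exists_norm_exp_wkb_le K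
  obtain ⟨C₂, hC₂, ht⟩ := exists_norm_qPoch_sq_eq_exp K (ρ := 1 / 12) (by norm_num)
  have ha := saddleCurvature_pos
  set a := saddleCurvature with ha'
  refine ⟨δ₁, hδ₁, hδ₁', fun δ hδ hδ' => ?_⟩
  set c := a / 2 * (δ / 4) ^ 2 with hc
  have hc0 : 0 < c := by positivity
  set D := ((2 * K).factorial : ℝ) / c ^ (2 * K) with hD
  refine ⟨C₁ * (C₂ * Real.exp C₂) + C₁ * (D * Real.exp C₂), by positivity, fun N m hN hv => ?_⟩
  have hN0 : (0 : ℝ) < N := by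
    have : 0 < N := by omega
    exact_mod_cast this
  have hN2 : (2 : ℝ) ≤ N := by exact_mod_cast hN
  set r : ℝ := 1 / N with hr
  have hr0 : 0 < r := by positivity
  have hr1 : r ≤ 1 := by rw [hr, div_le_one hN0]; linarith
  have hrC : (1 / (N : ℂ)) = (r : ℂ) := by rw [hr]; push_cast; ring
  set v := ((m : ℝ) + 1 / 2) / N with hvdef
  have hv' := abs_le.mp hv
  have hm : 2 * m + 1 ≤ N := by
    have h1 : v ≤ 1 / 4 := by linarith [hv'.2]
    rw [hvdef, div_le_iff₀ hN0] at h1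
    have : (2 * m + 1 : ℝ) ≤ N := by linarith
    exact_mod_cast this
  obtain ⟨ε, hε, hX⟩ := ht N m hm (by linarith [hv'.1])
  rw [hrC] at hX ⊢
  have hfr : phase (1 / 6) * N = phase (1 / 6) / r := by rw [hr]; field_simp
  rw [hfr]
  set P := Real.exp (phase (1 / 6) / r) with hP
  have hP0 : 0 < P := Real.exp_pos _
  have hE := hb r hr0 hr1 ((v - 1 / 6 : ℝ) : ℂ) (by
    rw [Complex.norm_real, Real.norm_eq_abs]; exact hv.trans hδ') (by
    rw [Complex.ofReal_im]; simpa using hr0.le)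
  rw [show (1 / 6 : ℂ) + ((v - 1 / 6 : ℝ) : ℂ) = (v : ℂ) by push_cast; ring, Complex.norm_real,
    Real.norm_eq_abs] at hE
  have hε1 : ‖ε‖ ≤ C₂ := hε.trans (mul_le_of_le_one_right hC₂.le (pow_le_one₀ hr0.le hr1))
  have hrK : 0 ≤ r ^ (2 * K) := by positivity
  constructor
  · have e1 : ‖Complex.exp ε - 1‖ ≤ C₂ * Real.exp C₂ * r ^ (2 * K) := by
      have := Complex.norm_exp_sub_sum_le_norm_mul_exp ε 1
      simp only [Finset.sum_range_one, pow_zero, Nat.factorial_zero, Nat.cast_one, div_one,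
        pow_one] at this
      refine this.trans ?_
      calc _ ≤ C₂ * r ^ (2 * K) * Real.exp C₂ := by gcongr
        _ = _ := by ring
    have e2 : ‖Complex.exp (wkb K r v)‖ ≤ C₁ * P :=
      hE.trans (mul_le_of_le_one_right (by positivity)
        (Real.exp_le_one_iff.mpr (by rw [neg_nonpos]; positivity)))
    have e3 : (N : ℂ) * Complex.exp (wkb K r v + ε) - N * Complex.exp (wkb K r v) =
        N * (Complex.exp (wkb K r v) * (Complex.exp ε - 1)) := by rw [Complex.exp_add]; ring
    rw [hX, e3, norm_mul, Complex.norm_natCast, norm_mul]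
    have z : 0 ≤ C₁ * (D * Real.exp C₂) * (P * r ^ (2 * K)) := by positivity
    calc _ ≤ (N : ℝ) * (C₁ * P * (C₂ * Real.exp C₂ * r ^ (2 * K))) := by gcongr
      _ ≤ _ := by
        refine mul_le_mul_of_nonneg_left ?_ hN0.le
        linarith
  · intro hfar
    have e2 : Real.exp (-(a / 2 * |v - 1 / 6| ^ 2 / r)) ≤ D * r ^ (2 * K) := by
      refine le_trans ?_ (exp_neg_div_le hc0 hr0 (2 * K))
      apply Real.exp_le_exp.mpr
      rw [hc]
      gcongr
    have e3 : ‖Complex.exp ε‖ ≤ Real.exp C₂ :=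
      (Complex.norm_exp_le_exp_norm _).trans (Real.exp_le_exp.mpr hε1)
    have e4 : ‖qPoch (cyc (r : ℂ)) (N - 1 - m)‖ ^ 2 =
        N * (‖Complex.exp (wkb K r v)‖ * ‖Complex.exp ε‖) := by
      have := congrArg norm hX
      rwa [Complex.norm_real, Real.norm_of_nonneg (by positivity), Complex.exp_add, norm_mul,
        Complex.norm_natCast, norm_mul] at this
    rw [e4]
    have z : 0 ≤ C₁ * (C₂ * Real.exp C₂) * (P * r ^ (2 * K)) := by positivity
    calc _ ≤ (N : ℝ) * (C₁ * P * (D * r ^ (2 * K)) * Real.exp C₂) := by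
          gcongr
          exact hE.trans (by gcongr)
      _ ≤ _ := by
        refine mul_le_mul_of_nonneg_left ?_ hN0.le
        linarith

lemma norm_sum_range_le {u : ℕ → ℂ} {n : ℕ} {B : ℝ} (h : ∀ i < n, ‖u i‖ ≤ B) :
    ‖∑ i ∈ Finset.range n, u i‖ ≤ n * B := by
  have := norm_sum_le_of_le (Finset.range n) fun i hi => h i (Finset.mem_range.mp hi)
  rwa [Finset.sum_const, Finset.card_range, nsmul_eq_mul] at this

set_option maxHeartbeats 800000 in
/-- The Kashaev invariant is dominated by its terms in a neighbourhood of the largest one, where the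
terms are given by the asymptotic expansion. -/
lemma exists_kashaev_sub_sum_le (K : ℕ) : ∃ δ' > 0, ∀ δ : ℝ, 0 < δ → δ ≤ δ' →
    ∃ C > 0, ∀ N : ℕ, 0 < N → 1 / (N : ℝ) < δ / 8 → ∃ m₁ J : ℕ,
      J * (1 / (N : ℝ)) ≤ 1 ∧ m₁ * (1 / (N : ℝ)) ∈ Set.Icc (1 / 6 - δ) (1 / 6 - δ / 2) ∧
      m₁ * (1 / (N : ℝ)) + J * (1 / (N : ℝ)) ∈ Set.Icc (1 / 6 + δ / 2) (1 / 6 + δ) ∧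
      ‖(kashaev N : ℂ) - N * ∑ j ∈ Finset.range J, Complex.exp (wkb (K + 1) ((1 / N : ℝ) : ℂ)
        ((m₁ * (1 / N) + (j + 1 / 2) * (1 / N) : ℝ)))‖ ≤
        N ^ 2 * (C * (Real.exp (phase (1 / 6) * N) * (1 / (N : ℝ)) ^ (K + 1))) := by
  obtain ⟨δ₃, hδ₃, hδ₃', h₃⟩ := exists_window_term_le (K + 1)
  refine ⟨δ₃, hδ₃, fun δ hδ hδ' => ?_⟩
  obtain ⟨C₃, hC₃, b₃⟩ := h₃ δ hδ hδ'
  have hδ12 : δ ≤ 1 / 12 := hδ'.trans hδ₃'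
  have hf := phase_saddle_pos
  set f := phase (1 / 6) with hfdef
  set D := ((K + 1).factorial : ℝ) / f ^ (K + 1) with hD
  have hD0 : 0 ≤ D := by positivity
  refine ⟨C₃ + D, by positivity, fun N hN l3 => ?_⟩
  have hN0 : (0 : ℝ) < N := by exact_mod_cast hN
  set r : ℝ := 1 / N with hr
  have hr0 : 0 < r := by positivity
  have hrN : r * N = 1 := by rw [hr]; field_simp
  have hr1 : r ≤ 1 := by linarith
  have hN2 : (2 : ℝ) ≤ N := by
    by_contra h
    push Not at h
    nlinarith
  have hN2' : 2 ≤ N := by exact_mod_cast hN2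
  have hrC : (1 / (N : ℂ)) = (r : ℂ) := by rw [hr]; push_cast; ring
  have hdiv : ∀ x : ℝ, x / N = x * r := fun x => by rw [hr]; ring
  -- The window consists of the indices from `m₁` to `m₂ - 1`.
  set m₁ := ⌈(1 / 6 - δ) * N⌉₊ with hm₁
  set m₂ := ⌊(1 / 6 + δ) * N⌋₊ with hm₂
  have a1 : 1 / 6 - δ ≤ m₁ * r := by
    have := Nat.le_ceil ((1 / 6 - δ) * N)
    calc 1 / 6 - δ = (1 / 6 - δ) * N * r := by linear_combination (-(1 / 6 - δ)) * hrN
      _ ≤ _ := by gcongr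
  have a2 : m₁ * r ≤ 1 / 6 - δ + r := by
    have := (Nat.ceil_lt_add_one (a := (1 / 6 - δ) * N)
      (mul_nonneg (by linarith) hN0.le)).le
    calc m₁ * r ≤ ((1 / 6 - δ) * N + 1) * r := by gcongr
      _ = _ := by linear_combination (1 / 6 - δ) * hrN
  have a3 : m₂ * r ≤ 1 / 6 + δ := by
    have := Nat.floor_le (a := (1 / 6 + δ) * N) (by positivity)
    calc m₂ * r ≤ (1 / 6 + δ) * N * r := by gcongr
      _ = _ := by linear_combination (1 / 6 + δ) * hrN
  have a4 : 1 / 6 + δ - r ≤ m₂ * r := by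
    have := (Nat.lt_floor_add_one ((1 / 6 + δ) * N)).le
    have h : (1 / 6 + δ) * N * r ≤ (m₂ + 1) * r := by gcongr
    have h' : (1 / 6 + δ) * N * r = 1 / 6 + δ := by linear_combination (1 / 6 + δ) * hrN
    linarith
  have a5 : m₁ + 1 ≤ m₂ := by
    have : ((m₁ : ℝ) + 1) * r ≤ m₂ * r := by linarith
    have := le_of_mul_le_mul_right this hr0
    exact_mod_cast this
  have a6 : m₂ ≤ N := by
    have : (m₂ : ℝ) * r ≤ N * r := by linarith
    have := le_of_mul_le_mul_right this hr0
    exact_mod_cast this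
  obtain ⟨J, hJ⟩ : ∃ J, m₂ = m₁ + J := ⟨m₂ - m₁, by omega⟩
  obtain ⟨L, hL⟩ : ∃ L, N = m₁ + J + L := ⟨N - m₂, by omega⟩
  have hJ' : (m₂ : ℝ) = m₁ + J := by exact_mod_cast hJ
  have hL' : (N : ℝ) = m₁ + J + L := by exact_mod_cast hL
  have hx1 : m₁ * r + J * r = m₂ * r := by rw [hJ']; ring
  set X : ℕ → ℝ := fun m => ‖qPoch (cyc (1 / N)) (N - 1 - m)‖ ^ 2 with hX
  set P := Real.exp (f * N) with hP
  have hP0 : 0 < P := Real.exp_pos _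
  have hPr : P = Real.exp (f / r) := by rw [hP, hr]; congr 1; field_simp
  set Err := P * r ^ (K + 1) with hErr
  have hErr0 : 0 ≤ Err := by positivity
  have hErrle : P * r ^ (2 * (K + 1)) ≤ Err := by
    exact mul_le_mul_of_nonneg_left (pow_le_pow_of_le_one hr0.le hr1 (by omega)) hP0.le
  have hXb : ∀ m : ℕ, |((m : ℝ) + 1 / 2) * r - 1 / 6| ≤ δ →
      δ / 4 ≤ |((m : ℝ) + 1 / 2) * r - 1 / 6| → X m ≤ N * (C₃ * Err) := by
    intro m h1 h2
    have := (b₃ N m hN2' (by rwa [hdiv])).2 (by rwa [hdiv])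
    refine this.trans ?_
    gcongr
  have hX1 : X m₁ ≤ N * (C₃ * Err) := by
    have e : |((m₁ : ℝ) + 1 / 2) * r - 1 / 6| = 1 / 6 - ((m₁ : ℝ) + 1 / 2) * r := by
      rw [abs_of_nonpos (by linarith)]; ring
    exact hXb m₁ (by rw [e]; linarith) (by rw [e]; linarith)
  have hX2 : X (m₂ - 1) ≤ N * (C₃ * Err) := by
    have hc : ((m₂ - 1 : ℕ) : ℝ) = m₂ - 1 := by rw [Nat.cast_sub (by omega)]; simp
    have e : |(((m₂ - 1 : ℕ) : ℝ) + 1 / 2) * r - 1 / 6| = (m₂ - 1 / 2) * r - 1 / 6 := by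
      rw [hc, abs_of_nonneg (by linarith)]; ring
    exact hXb _ (by rw [e]; linarith) (by rw [e]; linarith)
  -- The terms on either side of the window are bounded by those at its ends.
  have t1 : ‖∑ i ∈ Finset.range m₁, (X i : ℂ)‖ ≤ m₁ * (N * (C₃ * Err)) := by
    refine norm_sum_range_le fun i hi' => ?_
    rw [Complex.norm_real, Real.norm_of_nonneg (by positivity)]
    refine le_trans ?_ hX1
    refine norm_qPoch_cyc_le_of_le (by omega) (by omega) ?_
    have hc : ((N - 1 - m₁ : ℕ) : ℝ) = N - 1 - m₁ := by
      rw [Nat.cast_sub (by omega), Nat.cast_sub (by omega)]; simp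
    rw [hc, hdiv]
    linarith
  have t3 : ‖∑ l ∈ Finset.range L, (X (m₁ + J + l) : ℂ)‖ ≤ L * (1 + N * (C₃ * Err)) := by
    refine norm_sum_range_le fun l hl => ?_
    rw [Complex.norm_real, Real.norm_of_nonneg (by positivity)]
    refine le_trans ?_ (add_le_add le_rfl hX2)
    refine norm_qPoch_cyc_le_max (by omega) (by omega) ?_
    have hc : ((N - 1 - (m₂ - 1) : ℕ) : ℝ) = N - m₂ := by
      rw [show N - 1 - (m₂ - 1) = N - m₂ by omega, Nat.cast_sub a6]
    rw [hc, hdiv]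
    linarith
  set E : ℝ → ℂ := fun v => Complex.exp (wkb (K + 1) r v) with hE
  have t2 : ‖∑ j ∈ Finset.range J, (X (m₁ + j) : ℂ) -
      N * ∑ j ∈ Finset.range J, E (m₁ * r + (j + 1 / 2) * r)‖ ≤ J * (N * (C₃ * Err)) := by
    rw [Finset.mul_sum, ← Finset.sum_sub_distrib]
    refine norm_sum_range_le fun j hj' => ?_
    have hj2 : (j : ℝ) + 1 ≤ J := by exact_mod_cast hj'
    have hj3 : ((j : ℝ) + 1) * r ≤ J * r := by gcongr
    have hj0 : 0 ≤ (j : ℝ) * r := by positivity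
    have e : (((m₁ + j : ℕ) : ℝ) + 1 / 2) / N = m₁ * r + (j + 1 / 2) * r := by
      rw [hdiv]; push_cast; ring
    have := (b₃ N (m₁ + j) hN2' (by
      rw [e]; exact abs_le.mpr ⟨by linarith, by linarith⟩)).1
    rw [e, hrC] at this
    rw [hX, hrC]
    refine this.trans ?_
    gcongr
  have hsum : (kashaev N : ℂ) = ∑ i ∈ Finset.range m₁, (X i : ℂ) +
      ∑ j ∈ Finset.range J, (X (m₁ + j) : ℂ) + ∑ l ∈ Finset.range L, (X (m₁ + J + l) : ℂ) := by
    rw [kashaev_eq_sum, ← Finset.sum_range_add, ← Finset.sum_range_add, ← hL]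
    simp only [hX]
    push_cast
    rfl
  have hone : 1 ≤ D * Err := by
    have h1 := exp_neg_div_le hf hr0 (K + 1)
    have h2 : P * Real.exp (-(f / r)) = 1 := by
      rw [hPr, ← Real.exp_add, add_neg_cancel, Real.exp_zero]
    calc 1 = P * Real.exp (-(f / r)) := h2.symm
      _ ≤ P * (D * r ^ (K + 1)) := by gcongr
      _ = _ := by rw [hErr]; ring
  refine ⟨m₁, J, by linarith, ⟨a1, by linarith⟩, ⟨by linarith, by linarith⟩, ?_⟩
  set S := ∑ j ∈ Finset.range J, E (m₁ * r + (j + 1 / 2) * r) with hS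
  have e1 : (kashaev N : ℂ) - N * S = ∑ i ∈ Finset.range m₁, (X i : ℂ) +
      (∑ j ∈ Finset.range J, (X (m₁ + j) : ℂ) - N * S) +
      ∑ l ∈ Finset.range L, (X (m₁ + J + l) : ℂ) := by
    rw [hsum]; ring
  rw [e1]
  refine ((norm_add_le _ _).trans (add_le_add ((norm_add_le _ _).trans (add_le_add t1 t2)) t3)).trans ?_
  have hLN : (L : ℝ) ≤ N ^ 2 := by
    have h1 : (L : ℝ) ≤ N := by exact_mod_cast (by omega : L ≤ N)
    exact h1.trans (le_self_pow₀ (by linarith) two_ne_zero)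
  have hL1 : (L : ℝ) * 1 ≤ N ^ 2 * (D * Err) := by
    have : (0 : ℝ) ≤ L := Nat.cast_nonneg _
    gcongr
  calc _ = N * (N * (C₃ * Err)) + L * 1 := by rw [hL']; ring
    _ ≤ N * (N * (C₃ * Err)) + N ^ 2 * (D * Err) := by gcongr
    _ = _ := by rw [hErr]; ring

/-- The expansion of the Kashaev invariant, with the coefficients of the saddle point. -/
lemma exists_kashaev_sub_le {K : ℕ} {A : ℕ → ℂ} (hA : IsSaddleExpansion (K + 1) K A) :
    ∃ C : ℝ, ∃ N₀ : ℕ, ∀ N ≥ N₀, ‖(kashaev N : ℂ) - N ^ 2 * (Complex.exp (phase (1 / 6) * N) *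
      (((1 / N : ℝ) : ℂ) ^ (1 / 2 : ℂ) * ∑ j ∈ Finset.range K, A j * ((1 / N : ℝ) : ℂ) ^ j))‖ ≤
      C * (N ^ 2 * (Real.exp (phase (1 / 6) * N) * (√(1 / N) * (1 / (N : ℝ)) ^ K))) := by
  obtain ⟨δ₁, hδ₁, h₁⟩ := hA 1 1 admissible_one
  obtain ⟨δ₂, hδ₂, hδ₂', h₂⟩ := exists_window_midpoint_le (K + 1) (K + 1)
  obtain ⟨δ₃, hδ₃, h₃⟩ := exists_kashaev_sub_sum_le K
  set δ := min δ₁ (min δ₂ δ₃) with hδdef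
  have hδ : 0 < δ := by positivity
  obtain ⟨C₁, r₁, hr₁, b₁⟩ := h₁ δ hδ (min_le_left _ _) 0 le_rfl
  obtain ⟨C₂, hC₂, r₂, hr₂, b₂⟩ := h₂ δ hδ ((min_le_right _ _).trans (min_le_left _ _))
  obtain ⟨C₃, hC₃, b₃⟩ := h₃ δ hδ ((min_le_right _ _).trans (min_le_right _ _))
  set f := phase (1 / 6) with hfdef
  obtain ⟨N₀, hN₀⟩ := exists_nat_gt (1 / min (min r₁ r₂) (δ / 8))
  have hmin : 0 < min (min r₁ r₂) (δ / 8) := by positivity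
  refine ⟨C₃ + C₂ + C₁, N₀, fun N hNN => ?_⟩
  have hN : 1 / min (min r₁ r₂) (δ / 8) < N := hN₀.trans_le (by exact_mod_cast hNN)
  have hN0 : (0 : ℝ) < N := lt_trans (by positivity) hN
  have hr' : 1 / (N : ℝ) < min (min r₁ r₂) (δ / 8) := by
    rw [one_div_lt hN0 hmin]; exact hN
  set r : ℝ := 1 / N with hr
  have hr0 : 0 < r := by positivity
  have hrN : r * N = 1 := by rw [hr]; field_simp
  have l1 : r < r₁ := hr'.trans_le ((min_le_left _ _).trans (min_le_left _ _))
  have l2 : r < r₂ := hr'.trans_le ((min_le_left _ _).trans (min_le_right _ _))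
  have l3 : r < δ / 8 := hr'.trans_le (min_le_right _ _)
  obtain ⟨m₁, J, hJr, hx₀, hx₁, hsum⟩ := b₃ N (by exact_mod_cast hN0) l3
  have hδ12 : δ ≤ 1 / 12 := ((min_le_right _ _).trans (min_le_left _ _)).trans hδ₂'
  have hr1 : r ≤ 1 := by linarith
  rw [← hr] at hJr hx₀ hx₁
  set E : ℝ → ℂ := fun v => Complex.exp (wkb (K + 1) r v) with hE
  set P := Real.exp (f * N) with hP
  have hP0 : 0 < P := Real.exp_pos _
  have hPr : P = Real.exp (f / r) := by rw [hP, hr]; congr 1; field_simp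
  set Err := P * r ^ (K + 1) with hErr
  have hmid := b₂ r J (m₁ * r) hr0 l2 hJr hx₀ hx₁
  rw [← hPr] at hmid
  have hint : ∫ x in (m₁ * r)..(m₁ * r + J * r), E x =
      ∫ x in (-(1 / 6 - m₁ * r))..(m₁ * r + J * r - 1 / 6), E (1 / 6 + x) := by
    rw [intervalIntegral.integral_comp_add_left]
    congr 1 <;> ring
  have hsad := b₁ r hr0 l1 (1 / 6 - m₁ * r)
    ⟨by linarith [hx₀.2], by linarith [hx₀.1]⟩ (m₁ * r + J * r - 1 / 6)
    ⟨by linarith [hx₁.1], by linarith [hx₁.2]⟩ (fun x => E (1 / 6 + x)) (by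
      refine ContinuousOn.intervalIntegrable fun x hx => ?_
      rw [Set.uIcc_of_le (by linarith [hx₀.2, hx₁.1])] at hx
      have hmem : 0 < (((1 / 6 + x : ℝ)) : ℂ).re ∧ (((1 / 6 + x : ℝ)) : ℂ).re < 1 := by
        rw [Complex.ofReal_re]
        exact ⟨by linarith [hx.1, hx₀.1], by linarith [hx.2, hx₁.2]⟩
      have hopen : IsOpen {v : ℂ | 0 < v.re ∧ v.re < 1} :=
        (isOpen_lt continuous_const Complex.continuous_re).inter
          (isOpen_lt Complex.continuous_re continuous_const)
      have := ((differentiableOn_exp_wkb (K + 1) r).differentiableAt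
        (hopen.mem_nhds hmem)).continuousAt
      exact (ContinuousAt.comp (f := fun x : ℝ => ((1 / 6 + x : ℝ) : ℂ)) this
        (by fun_prop)).continuousWithinAt) (fun x _ => ⟨0, by simp, by simp [hE]⟩)
  rw [← hint] at hsad
  simp only [mul_one] at hsad
  have hfr : (f : ℂ) / r = f * N := by
    rw [hr]; push_cast; field_simp
  have hPn : ‖Complex.exp (f * N)‖ = P := by
    rw [Complex.norm_exp, hP]; congr 1
    have : ((f : ℂ) * N) = ((f * N : ℝ) : ℂ) := by push_cast; ring
    rw [this, Complex.ofReal_re]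
  rw [hfr, hPn] at hsad
  set I := ∫ x in (m₁ * r)..(m₁ * r + J * r), E x with hI
  set S := ∑ j ∈ Finset.range J, E (m₁ * r + (j + 1 / 2) * r) with hS
  set main := Complex.exp (f * N) * ((r : ℂ) ^ (1 / 2 : ℂ) *
    ∑ j ∈ Finset.range K, A j * (r : ℂ) ^ j) with hmain
  have hErr' : Err ≤ P * (√r * r ^ K) := by
    rw [hErr, pow_succ']
    gcongr
    rw [Real.le_sqrt hr0.le hr0.le, sq]
    exact mul_le_of_le_one_left hr0.le hr1
  have e1 : (kashaev N : ℂ) - N ^ 2 * main =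
      ((kashaev N : ℂ) - N * S) + N ^ 2 * (r * S - I) + N ^ 2 * (I - main) := by
    have : (r : ℂ) * N = 1 := by exact_mod_cast hrN
    linear_combination (-(N : ℂ) * S) * this
  have n1 : ‖(N : ℂ) ^ 2 * (r * S - I)‖ ≤ N ^ 2 * (C₂ * Err) := by
    rw [norm_mul, norm_pow, Complex.norm_natCast]
    gcongr
  have n2 : ‖(N : ℂ) ^ 2 * (I - main)‖ ≤ N ^ 2 * (C₁ * (P * (√r * r ^ K))) := by
    rw [norm_mul, norm_pow, Complex.norm_natCast]
    gcongr
  rw [e1]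
  refine ((norm_add_le _ _).trans
    (add_le_add ((norm_add_le _ _).trans (add_le_add hsum n1)) n2)).trans ?_
  calc _ ≤ N ^ 2 * (C₃ * (P * (√r * r ^ K))) +
        N ^ 2 * (C₂ * (P * (√r * r ^ K))) + N ^ 2 * (C₁ * (P * (√r * r ^ K))) := by gcongr
    _ = _ := by ring

/-! ### Analytic properties of the kernel -/

lemma differentiable_tprod_one_sub_mul_pow {q : ℂ} (hq : ‖q‖ < 1) :
    Differentiable ℂ fun z : ℂ => ∏' j : ℕ, (1 - z * q ^ j) := by
  intro z
  simp only [← tsum_euler hq]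
  have hd : DifferentiableOn ℂ (fun z : ℂ => ∑' n : ℕ,
      (-1) ^ n * q ^ (n * (n - 1) / 2) * (qPoch q n)⁻¹ * z ^ n) (Metric.ball 0 (‖z‖ + 1)) := by
    refine Complex.differentiableOn_tsum_of_summable_norm
      (summable_norm_euler hq ((‖z‖ + 1 : ℝ) : ℂ)) (fun n => by fun_prop) Metric.isOpen_ball
      fun n w hw => ?_
    have hw' : ‖w‖ ≤ ‖z‖ + 1 := by
      rw [mem_ball_zero_iff] at hw; exact hw.le
    have h2 : ‖((‖z‖ + 1 : ℝ) : ℂ)‖ = ‖z‖ + 1 := by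
      rw [Complex.norm_real, Real.norm_of_nonneg (by positivity)]
    rw [norm_mul, norm_mul _ (((‖z‖ + 1 : ℝ) : ℂ) ^ n), norm_pow w, norm_pow ((‖z‖ + 1 : ℝ) : ℂ), h2]
    gcongr
  exact hd.differentiableAt (Metric.isOpen_ball.mem_nhds (by simp))

lemma differentiable_halfPoch {τ : ℂ} (hτ : 0 < τ.im) : Differentiable ℂ (halfPoch τ) := by
  have h : halfPoch τ = (fun z : ℂ => ∏' j : ℕ, (1 - z * cyc τ ^ j)) ∘ fun v =>
      cyc v * cyc (τ / 2) := funext fun v => halfPoch_eq τ v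
  rw [h]
  refine (differentiable_tprod_one_sub_mul_pow (norm_cyc_lt_one hτ)).comp fun v => ?_
  exact (hasDerivAt_cyc v).differentiableAt.mul_const _

lemma halfPoch_ne_zero {τ : ℂ} (hτ : 0 < τ.im) {v : ℂ}
    (hv : ∀ (j : ℕ) (n : ℤ), v + (j + 1 / 2) * τ ≠ n) : halfPoch τ v ≠ 0 := by
  rw [halfPoch_eq]
  refine tprod_one_sub_mul_pow_ne_zero (norm_cyc_lt_one hτ) _ fun j hj => ?_
  rw [← cyc_half_shift, cyc_eq_one_iff] at hj
  obtain ⟨n, hn⟩ := hj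
  exact hv j n hn

lemma halfPoch_ne_zero_of_im {τ : ℂ} (hτ : 0 < τ.im) {v : ℂ} (hv : -(τ.im / 2) < v.im) :
    halfPoch τ v ≠ 0 := by
  refine halfPoch_ne_zero hτ fun j n h => ?_
  have := congrArg Complex.im h
  have hj : (0 : ℝ) ≤ j := j.cast_nonneg
  simp at this
  norm_num at this
  nlinarith [mul_nonneg hj hτ.le]

lemma differentiableAt_kernel {τ : ℂ} (hτ : 0 < τ.im) {v : ℂ} (hv : halfPoch τ (-v) ≠ 0) :
    DifferentiableAt ℂ (kernel τ) v := by
  have h1 : DifferentiableAt ℂ (fun v => halfPoch τ (-v)) v :=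
    (differentiable_halfPoch hτ).differentiableAt.comp v differentiableAt_id.neg
  exact (differentiable_halfPoch hτ v).div h1 hv

lemma continuous_kernel_ofReal {τ : ℂ} (hτ : 0 < τ.im) : Continuous fun v : ℝ => kernel τ v := by
  rw [continuous_iff_continuousAt]
  intro v
  refine ContinuousAt.comp (f := fun v : ℝ => (v : ℂ))
    (differentiableAt_kernel hτ ?_).continuousAt Complex.continuous_ofReal.continuousAt
  refine halfPoch_ne_zero_of_im hτ ?_
  simp; linarith

/-- Up to normalisation, the left-hand side is a Riemann sum for the convergent integral of
`1 / √(1 - x)` over `[0, 1]`, with a geometric subdivision. -/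
lemma sum_pow_div_sqrt_le {s : ℝ} (h0 : 0 < s) (h1 : s < 1) (n : ℕ) :
    ∑ j ∈ Finset.range n, s ^ (j + 1) / √(1 - s ^ (j + 1)) ≤ 2 / (1 - s) := by
  have hp : ∀ j : ℕ, 0 ≤ 1 - s ^ j := fun j => by
    linarith [pow_le_one₀ (n := j) h0.le h1.le]
  -- Each term is dominated by a difference of values of the square root.
  have hstep : ∀ j : ℕ, s ^ (j + 1) / √(1 - s ^ (j + 1)) ≤
      2 / (1 - s) * (√(1 - s ^ (j + 1)) - √(1 - s ^ j)) := by
    intro j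
    set u := √(1 - s ^ (j + 1)) with hu
    set w := √(1 - s ^ j) with hw
    have hu2 : u ^ 2 = 1 - s ^ (j + 1) := Real.sq_sqrt (hp _)
    have hw2 : w ^ 2 = 1 - s ^ j := Real.sq_sqrt (hp _)
    have hw0 : 0 ≤ w := Real.sqrt_nonneg _
    have hu0 : 0 < u := Real.sqrt_pos.mpr (by
      have : s ^ (j + 1) < 1 := pow_lt_one₀ h0.le h1 (Nat.succ_ne_zero j)
      linarith)
    have hsj : 0 < s ^ j := pow_pos h0 j
    have hwu : w ≤ u := by
      refine Real.sqrt_le_sqrt ?_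
      rw [pow_succ]; nlinarith
    have hd : u ^ 2 - w ^ 2 = s ^ j * (1 - s) := by rw [hu2, hw2, pow_succ]; ring
    rw [div_le_iff₀ hu0, div_mul_eq_mul_div, div_mul_eq_mul_div, le_div_iff₀ (by linarith)]
    calc s ^ (j + 1) * (1 - s) ≤ s ^ j * (1 - s) := by
          rw [pow_succ]; nlinarith [mul_pos hsj (by linarith : 0 < 1 - s)]
      _ = (u - w) * (u + w) := by rw [← hd]; ring
      _ ≤ (u - w) * (u + u) := by
          refine mul_le_mul_of_nonneg_left ?_ ?_ <;> linarith
      _ = _ := by ring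
  refine (Finset.sum_le_sum fun j _ => hstep j).trans ?_
  rw [← Finset.mul_sum, Finset.sum_range_sub (fun j => √(1 - s ^ j))]
  have : √(1 - s ^ n) ≤ 1 := Real.sqrt_le_one.mpr (by linarith [pow_pos h0 n])
  have h2 : 0 < 2 / (1 - s) := by have : 0 < 1 - s := by linarith
                                  positivity
  simp
  nlinarith

/-- Comparison of two factors of the infinite products. With the square root of the distance of `z` and
`w`, instead of the distance itself, the exponents can be summed by `sum_pow_div_sqrt_le`. -/
lemma norm_one_sub_mul_le {z w x : ℂ} {p : ℝ} (hw : ‖w‖ = 1) (hp0 : 0 ≤ p) (hp1 : p < 1)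
    (hx : ‖x‖ ≤ p ^ 2) :
    ‖1 - z * x‖ ≤ Real.exp (2 * √‖z - w‖ * (p / √(1 - p))) * ‖1 - w * x‖ := by
  set ε := ‖z - w‖ with hε
  have hε0 : 0 ≤ ε := norm_nonneg _
  have h1p : 0 < 1 - p := by linarith
  have hwx : 1 - p ≤ ‖1 - w * x‖ := by
    have := norm_sub_norm_le (1 : ℂ) (w * x)
    rw [norm_one, norm_mul, hw, one_mul] at this
    nlinarith
  have e1 : (1 : ℂ) - z * x = (1 - w * x) - (z - w) * x := by ring
  have b1 : ‖1 - z * x‖ ≤ ‖1 - w * x‖ + ε * p ^ 2 := by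
    rw [e1]
    refine (norm_sub_le _ _).trans ?_
    rw [norm_mul]
    gcongr
  have b2 : ε * p ^ 2 ≤ (√ε * (p / √(1 - p))) ^ 2 * ‖1 - w * x‖ := by
    rw [mul_pow, Real.sq_sqrt hε0, div_pow, Real.sq_sqrt h1p.le]
    have : p ^ 2 ≤ p ^ 2 / (1 - p) * ‖1 - w * x‖ := by
      rw [div_mul_eq_mul_div, le_div_iff₀ h1p]
      gcongr
    rw [mul_assoc]
    gcongr
  set y := √ε * (p / √(1 - p)) with hy
  have hy0 : 0 ≤ y := by positivity
  have b3 : 1 + y ^ 2 ≤ Real.exp (2 * y) := by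
    have := Real.add_one_le_exp y
    have e : Real.exp (2 * y) = Real.exp y ^ 2 := by rw [← Real.exp_nat_mul]; norm_num
    rw [e]
    nlinarith
  have e2 : 2 * √ε * (p / √(1 - p)) = 2 * y := by rw [hy]; ring
  rw [e2]
  nlinarith [norm_nonneg (1 - w * x)]

/-- A bound for the kernel on the real line which is useful near the integers, where its expansion
fails: there the numerator and the denominator are close to each other. -/
lemma norm_kernel_ofReal_le {τ : ℂ} (hτ : 0 < τ.im) (hτ1 : τ.im ≤ 1) (v : ℝ) :
    ‖kernel τ v‖ ≤ Real.exp (8 * √‖cyc v - cyc (-v)‖ / τ.im) := by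
  have hπ := Real.pi_pos
  set s := Real.exp (-(Real.pi * τ.im / 2)) with hs
  have hs0 : 0 < s := Real.exp_pos _
  have hs1 : s < 1 := Real.exp_lt_one_iff.mpr (neg_neg_of_pos (by positivity))
  set ε := ‖cyc v - cyc (-v)‖ with hε
  set Q := cyc (τ / 2) with hQ
  set q := cyc τ with hq
  have hq1 : ‖q‖ < 1 := norm_cyc_lt_one hτ
  have hw : ‖cyc (-v)‖ = 1 := by
    have := norm_cyc_ofReal (-v)
    push_cast at this
    exact this
  have hx : ∀ j : ℕ, ‖Q * q ^ j‖ ≤ (s ^ (j + 1)) ^ 2 := by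
    intro j
    have h1 : Q * q ^ j = cyc ((j + 1 / 2) * τ) := by
      rw [hq, hQ, ← cyc_nat_mul, ← cyc_add]; congr 1; ring
    have h2 : ((j + 1 / 2 : ℂ) * τ).im = (j + 1 / 2) * τ.im := by
      have : (j + 1 / 2 : ℂ) = ((j + 1 / 2 : ℝ) : ℂ) := by push_cast; ring
      rw [this, Complex.im_ofReal_mul]
    rw [h1, norm_cyc, h2, ← pow_mul, hs, ← Real.exp_nat_mul]
    apply Real.exp_le_exp.mpr
    push_cast
    have : 0 ≤ (j : ℝ) * (Real.pi * τ.im) := by positivity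
    nlinarith
  have hfin : ∀ n : ℕ, ‖∏ j ∈ Finset.range n, (1 - cyc v * Q * q ^ j)‖ ≤
      Real.exp (2 * √ε * (2 / (1 - s))) * ‖∏ j ∈ Finset.range n, (1 - cyc (-v) * Q * q ^ j)‖ := by
    intro n
    rw [norm_prod, norm_prod]
    have h1 : ∏ j ∈ Finset.range n, ‖1 - cyc v * Q * q ^ j‖ ≤ ∏ j ∈ Finset.range n,
        (Real.exp (2 * √ε * (s ^ (j + 1) / √(1 - s ^ (j + 1)))) * ‖1 - cyc (-v) * Q * q ^ j‖) := by
      refine Finset.prod_le_prod (fun j _ => norm_nonneg _) fun j _ => ?_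
      rw [mul_assoc (cyc v), mul_assoc (cyc (-v))]
      exact norm_one_sub_mul_le hw (by positivity)
        (pow_lt_one₀ hs0.le hs1 (Nat.succ_ne_zero j)) (hx j)
    refine h1.trans ?_
    rw [Finset.prod_mul_distrib, ← Real.exp_sum, ← Finset.mul_sum]
    gcongr
    exact sum_pow_div_sqrt_le hs0 hs1 n
  have hlim := le_of_tendsto_of_tendsto' (tendsto_prod_one_sub_mul_pow hq1 (cyc v * Q)).norm
    ((tendsto_prod_one_sub_mul_pow hq1 (cyc (-v) * Q)).norm.const_mul
      (Real.exp (2 * √ε * (2 / (1 - s))))) hfin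
  rw [← halfPoch_eq, ← halfPoch_eq] at hlim
  have hne : halfPoch τ (-v) ≠ 0 := halfPoch_ne_zero_of_im hτ (by simp; linarith)
  rw [kernel, norm_div, div_le_iff₀ (norm_pos_iff.mpr hne)]
  refine hlim.trans (mul_le_mul_of_nonneg_right (Real.exp_le_exp.mpr ?_) (norm_nonneg _))
  have h1s : τ.im / 2 ≤ 1 - s := by
    have h1 := Real.add_one_le_exp (Real.pi * τ.im / 2)
    have h2 : s * Real.exp (Real.pi * τ.im / 2) = 1 := by
      rw [hs, ← Real.exp_add, neg_add_cancel, Real.exp_zero]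
    have h3 := Real.pi_gt_three
    nlinarith [mul_pos hπ hτ]
  have : 2 / (1 - s) ≤ 4 / τ.im := by
    rw [div_le_div_iff₀ (by linarith) hτ]; linarith
  calc 2 * √ε * (2 / (1 - s)) ≤ 2 * √ε * (4 / τ.im) := by gcongr
    _ = _ := by ring

lemma norm_cyc_sub_cyc_neg_le (v : ℝ) : ‖cyc v - cyc (-v)‖ ≤ 4 * Real.pi * |v| := by
  have e : cyc v - cyc (-v) = 2 * Complex.I * (Real.sin (2 * Real.pi * v) : ℝ) := by
    have h1 := cyc_eq v
    have h2 := cyc_eq ((-v : ℝ) : ℂ)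
    rw [Complex.ofReal_im, Complex.ofReal_re] at h1 h2
    rw [show 2 * Real.pi * -v = -(2 * Real.pi * v) by ring, Real.cos_neg, Real.sin_neg] at h2
    push_cast at h1 h2 ⊢
    rw [h1, h2]
    simp
    ring
  rw [e, norm_mul, norm_mul, Complex.norm_I, Complex.norm_real, Real.norm_eq_abs, Complex.norm_two]
  have h3 := Real.abs_sin_le_abs (x := 2 * Real.pi * v)
  rw [abs_mul, abs_of_pos Real.two_pi_pos] at h3
  linarith

/-! ### Rays in the open first quadrant -/

lemma ray_mem_logRegion {η v : ℝ} (hη : 0 < η) (h0 : η ≤ v) (h1 : v ≤ 1 - η) {ω : ℂ}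
    (hω : ‖ω‖ = 1) (him : 0 < ω.im) {r t : ℝ} (hr : 0 < r) (ht : 0 ≤ t) :
    (v : ℂ) + t * (r * ω) ∈ logRegion (η * ω.im) := by
  have hi : ((v : ℂ) + t * (r * ω)).im = t * (r * ω.im) := by
    rw [Complex.add_im, Complex.ofReal_im, zero_add, Complex.im_ofReal_mul, Complex.im_ofReal_mul]
  have hi0 : 0 ≤ t * (r * ω.im) := by positivity
  refine ⟨?_, by rw [hi]; linarith, fun n => ?_⟩
  · rcases ht.eq_or_lt with rfl | ht
    · right; simp; constructor <;> linarith
    · left; rw [hi]; positivity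
  · -- The distance of `n` to the line of the ray is `|v - n| ω.im`.
    have e : ((v : ℂ) + t * (r * ω) - n) * (starRingEnd ℂ) ω =
        ((v - n : ℝ) : ℂ) * (starRingEnd ℂ) ω + ((t * r : ℝ) : ℂ) := by
      have : ω * (starRingEnd ℂ) ω = 1 := by
        rw [Complex.mul_conj, Complex.normSq_eq_norm_sq, hω]; simp
      push_cast
      linear_combination (t * r : ℂ) * this
    have h2 : |v - n| * ω.im ≤ ‖(v : ℂ) + t * (r * ω) - n‖ := by
      have h3 := Complex.abs_im_le_norm (((v : ℂ) + t * (r * ω) - n) * (starRingEnd ℂ) ω)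
      rw [norm_mul, Complex.norm_conj, hω, mul_one, e, Complex.add_im, Complex.ofReal_im,
        Complex.im_ofReal_mul, Complex.conj_im, add_zero, abs_mul, abs_neg, abs_of_pos him] at h3
      exact h3
    refine le_trans ?_ h2
    gcongr
    rcases le_or_gt n 0 with hn | hn
    · have : (n : ℝ) ≤ 0 := by exact_mod_cast hn
      exact le_trans (by linarith) (le_abs_self _)
    · have : (1 : ℝ) ≤ n := by exact_mod_cast hn
      exact le_trans (by linarith) (neg_le_abs _)

lemma ray_mem_logRegion' {η v : ℝ} (hη : 0 < η) (h0 : η ≤ v) (h1 : v ≤ 1 - η) {ω : ℂ}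
    (hω : ‖ω‖ = 1) (him : 0 < ω.im) {r t : ℝ} (hr : 0 < r) (ht : 0 ≤ t) :
    (1 : ℂ) - v + t * (r * ω) ∈ logRegion (η * ω.im) := by
  have := ray_mem_logRegion (v := 1 - v) hη (by linarith) (by linarith) hω him hr ht
  push_cast at this
  exact this

lemma exists_phase_le {δ : ℝ} (hδ : 0 < δ) : ∃ κ > 0, ∀ v ∈ Set.Icc (0 : ℝ) 1, δ ≤ |v - 1 / 6| →
    phase v ≤ phase (1 / 6) - κ := by
  have hc : IsCompact (Set.Icc (0 : ℝ) 1 ∩ {v | δ ≤ |v - 1 / 6|}) :=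
    isCompact_Icc.inter_right (isClosed_le continuous_const (by fun_prop))
  rcases (Set.Icc (0 : ℝ) 1 ∩ {v | δ ≤ |v - 1 / 6|}).eq_empty_or_nonempty with h | h
  · exact ⟨1, one_pos, fun v hv hd => absurd (Set.mem_inter hv hd) (by
      have : v ∉ (∅ : Set ℝ) := Set.notMem_empty v
      rwa [← h] at this)⟩
  · obtain ⟨v₀, hv₀, hmax⟩ := hc.exists_isMaxOn h continuous_phase.continuousOn
    refine ⟨phase (1 / 6) - phase v₀, ?_, fun v hv hd => ?_⟩
    · have hne : v₀ ≠ 1 / 6 := by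
        rintro rfl
        have := hv₀.2
        simp at this
        linarith
      linarith [phase_lt_saddle hv₀.1.1 hv₀.1.2 hne]
    · have : phase v ≤ phase v₀ := hmax ⟨hv, hd⟩
      linarith

lemma ofReal_div_ray_re {ω : ℂ} (hω : ‖ω‖ = 1) (x r : ℝ) :
    ((x : ℂ) / (r * ω)).re = x * ω.re / r := by
  have e : (x : ℂ) / (r * ω) = ((x / r : ℝ) : ℂ) * ω⁻¹ := by push_cast; rw [div_mul_eq_div_div]; ring
  rw [e, Complex.re_ofReal_mul, Complex.inv_re, Complex.normSq_eq_norm_sq, hω]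
  ring

/-- Away from the saddle point, the kernel on the real line is exponentially smaller than its
largest value. -/
lemma exists_norm_kernel_le {ω : ℂ} (hω : ‖ω‖ = 1) (him : 0 < ω.im) (hre : 0 < ω.re) {δ : ℝ}
    (hδ : 0 < δ) : ∃ C > 0, ∃ c > 0, ∀ r : ℝ, 0 < r → r ≤ 1 → ∀ v ∈ Set.Icc (0 : ℝ) 1,
      δ ≤ |v - 1 / 6| → ‖kernel (r * ω) v‖ ≤
        C * (Real.exp (phase (1 / 6) * ω.re / r) * Real.exp (-(c / r))) := by
  have hf := phase_saddle_pos
  set f := phase (1 / 6) with hfdef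
  have hπ := Real.pi_pos
  obtain ⟨κ, hκ, hκb⟩ := exists_phase_le hδ
  set b := f * ω.re * ω.im / 16 with hb
  have hb0 : 0 < b := by positivity
  -- The distance to the integers below which the bound `norm_kernel_ofReal_le` suffices, because the
  -- maximum of the kernel is exponentially large.
  set η := min (1 / 4) (b ^ 2 / (4 * Real.pi)) with hη
  have hη0 : 0 < η := by positivity
  have hη1 : η ≤ 1 / 4 := min_le_left _ _
  have hη2 : 4 * Real.pi * η ≤ b ^ 2 := by
    have := min_le_right (1 / 4) (b ^ 2 / (4 * Real.pi))
    rw [← hη, le_div_iff₀ (by positivity)] at this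
    linarith
  obtain ⟨C₁, hC₁, hk⟩ := exists_kernel_eq_exp 0 (mul_pos hη0 him)
  have him1 : ω.im ≤ 1 := by
    have := (Complex.abs_im_le_norm ω).trans hω.le
    exact (le_abs_self _).trans this
  set c := min (f * ω.re / 2) (κ * ω.re) with hc
  refine ⟨Real.exp (C₁ / ω.im), Real.exp_pos _, c, by positivity, fun r hr hr1 v hv hd => ?_⟩
  have hτi : ((r : ℂ) * ω).im = r * ω.im := Complex.im_ofReal_mul _ _
  have hτ0 : 0 < ((r : ℂ) * ω).im := by rw [hτi]; positivity
  have hτ1 : ((r : ℂ) * ω).im ≤ 1 := by rw [hτi]; nlinarith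
  have hτn : ‖(r : ℂ) * ω‖ = r := by
    rw [norm_mul, hω, mul_one, Complex.norm_real, Real.norm_of_nonneg hr.le]
  have hone : 1 ≤ Real.exp (C₁ / ω.im) := Real.one_le_exp (by positivity)
  rw [← Real.exp_add]
  by_cases hmid : η ≤ v ∧ v ≤ 1 - η
  · obtain ⟨ε, hε, he⟩ := hk (r * ω) hτ0 hτ1 v
      (fun t ht => ray_mem_logRegion hη0 hmid.1 hmid.2 hω him hr ht)
      (fun t ht => ray_mem_logRegion' hη0 hmid.1 hmid.2 hω him hr ht)
    rw [hτn, hτi] at hε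
    have hε' : ε.re ≤ C₁ / ω.im := by
      refine (Complex.re_le_norm ε).trans (hε.trans (le_of_eq ?_))
      simp only [mul_zero, zero_add, pow_one]
      field_simp
    have hw : wkb 0 (r * ω) v = (phase v : ℂ) / (r * ω) := by
      simp [wkb, phaseCoeff_zero_ofReal]
    rw [he, Complex.norm_exp, Complex.add_re, hw, ofReal_div_ray_re hω, ← Real.exp_add]
    apply Real.exp_le_exp.mpr
    have h1 := hκb v hv hd
    have h2 : phase v * ω.re / r ≤ f * ω.re / r + -(c / r) := by
      have h3 : c ≤ κ * ω.re := min_le_right _ _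
      rw [← sub_eq_add_neg, ← sub_div]
      gcongr
      nlinarith
    linarith
  · have hdist : ‖cyc v - cyc (-v)‖ ≤ b ^ 2 := by
      refine le_trans ?_ hη2
      rcases lt_or_ge v η with h | h
      · refine (norm_cyc_sub_cyc_neg_le v).trans ?_
        rw [abs_of_nonneg hv.1]
        gcongr
      · have h' : 1 - η < v := by
          by_contra hcon
          exact hmid ⟨h, not_lt.mp hcon⟩
        have h2 := norm_cyc_sub_cyc_neg_le (v - 1)
        have e1 : cyc ((v - 1 : ℝ) : ℂ) = cyc v := by
          have := cyc_add_int v (-1)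
          rw [← this]; congr 1; push_cast; ring
        have e2 : cyc (-((v - 1 : ℝ) : ℂ)) = cyc (-v) := by
          have := cyc_add_int (-v) 1
          rw [← this]; congr 1; push_cast; ring
        rw [e1, e2, abs_of_nonpos (by linarith [hv.2])] at h2
        refine h2.trans ?_
        gcongr
        linarith
    have h1 := norm_kernel_ofReal_le hτ0 hτ1 v
    have h2 : √‖cyc v - cyc (-v)‖ ≤ b := by
      rw [Real.sqrt_le_left hb0.le]; exact hdist
    refine h1.trans (le_trans (Real.exp_le_exp.mpr ?_) (le_mul_of_one_le_left (Real.exp_pos _).le hone))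
    rw [hτi, ← sub_eq_add_neg, ← sub_div, div_le_div_iff₀ (by positivity) hr]
    have h3 : c ≤ f * ω.re / 2 := min_le_left _ _
    have h4 : 8 * √‖cyc v - cyc (-v)‖ ≤ (f * ω.re - c) * ω.im := by
      have : 8 * b = f * ω.re / 2 * ω.im := by rw [hb]; ring
      nlinarith
    nlinarith

/-- The expansion of `G_0` on a ray in the open first quadrant, on which only one of the two
exponentials contributes. -/
lemma exists_G0_sub_le_of_re_pos {K : ℕ} {A : ℕ → ℂ} (hA : IsSaddleExpansion (K + 1) K A) {ω : ℂ}
    (hω : ‖ω‖ = 1) (him : 0 < ω.im) (hre : 0 < ω.re) :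
    ∃ C : ℝ, ∃ r₀ > 0, ∀ r : ℝ, 0 < r → r < r₀ →
      ‖G0 (cyc (r * ω)) - Complex.exp (phase (1 / 6) / (r * ω)) *
        ((r * ω) ^ (1 / 2 : ℂ) * ∑ j ∈ Finset.range K, A j * (r * ω) ^ j)‖ ≤
        C * (‖Complex.exp (phase (1 / 6) / (r * ω))‖ * (√r * r ^ K)) := by
  have hadm : Admissible 1 ω := by
    refine ⟨by simp, hω, ?_, by simp⟩
    rw [one_pow, one_div, Complex.inv_re, Complex.normSq_eq_norm_sq, hω]
    simpa using hre
  obtain ⟨δ₁, hδ₁, h₁⟩ := hA 1 ω hadm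
  set δ := min δ₁ (1 / 12) with hδdef
  have hδ : 0 < δ := by positivity
  have hδ12 : δ ≤ 1 / 12 := min_le_right _ _
  obtain ⟨C₀, hC₀, hk⟩ := exists_kernel_eq_exp (K + 1) (mul_pos (by norm_num : (0 : ℝ) < 1 / 12) him)
  obtain ⟨C₁, r₁, hr₁, b₁⟩ := h₁ δ hδ (min_le_left _ _) (C₀ / ω.im) (by positivity)
  obtain ⟨C₂, hC₂, c, hc, b₂⟩ := exists_norm_kernel_le hω him hre hδ
  set D := ((K + 1).factorial : ℝ) / c ^ (K + 1) with hD
  have hD0 : 0 ≤ D := by positivity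
  refine ⟨C₁ + 2 * (C₂ * D), min r₁ 1, by positivity, fun r hr hr' => ?_⟩
  have hr1 : r ≤ 1 := hr'.le.trans (min_le_right _ _)
  have him1 : ω.im ≤ 1 := (le_abs_self _).trans ((Complex.abs_im_le_norm ω).trans hω.le)
  set τ : ℂ := r * ω with hτ
  have hτi : τ.im = r * ω.im := Complex.im_ofReal_mul _ _
  have hτ0 : 0 < τ.im := by rw [hτi]; positivity
  have hτ1 : τ.im ≤ 1 := by rw [hτi]; nlinarith
  have hτn : ‖τ‖ = r := hadm.norm_mul hr
  have hP : ‖Complex.exp (phase (1 / 6) / τ)‖ = Real.exp (phase (1 / 6) * ω.re / r) := by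
    rw [Complex.norm_exp, hτ, ofReal_div_ray_re hω]
  have hcont := continuous_kernel_ofReal hτ0
  have hwin := b₁ r hr (hr'.trans_le (min_le_left _ _)) δ ⟨by linarith, le_rfl⟩ δ
    ⟨by linarith, le_rfl⟩ (fun x : ℝ => kernel τ ((1 / 6 + x : ℝ)))
    ((hcont.comp (by fun_prop : Continuous fun x : ℝ => 1 / 6 + x)).intervalIntegrable _ _) (by
      intro x hx
      have g0 : (1 / 12 : ℝ) ≤ 1 / 6 + x := by linarith [hx.1]
      have g1 : 1 / 6 + x ≤ 1 - 1 / 12 := by linarith [hx.2]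
      obtain ⟨ε, hε, he⟩ := hk τ hτ0 hτ1 ((1 / 6 + x : ℝ))
        (fun t ht => ray_mem_logRegion (by norm_num) g0 g1 hω him hr ht)
        (fun t ht => ray_mem_logRegion' (by norm_num) g0 g1 hω him hr ht)
      refine ⟨ε, hε.trans ?_, by rw [he, hτ, mul_one]; push_cast; rfl⟩
      rw [hτn, hτi, mul_div_assoc, div_mul_eq_mul_div, mul_div_assoc]
      have : r ^ (2 * (K + 1) + 1) / (r * ω.im) ≤ r ^ K / ω.im := by
        rw [pow_succ, div_le_div_iff₀ (by positivity) him]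
        have := pow_le_pow_of_le_one hr.le hr1 (show K ≤ 2 * (K + 1) by omega)
        have h5 : 0 < r * ω.im := by positivity
        nlinarith
      gcongr)
  have hw : ∫ x in (-δ)..δ, kernel τ ((1 / 6 + x : ℝ)) =
      ∫ v in (1 / 6 - δ)..(1 / 6 + δ), kernel τ v := by
    rw [intervalIntegral.integral_comp_add_left (fun v : ℝ => kernel τ v)]
    congr 1
  rw [hw, mul_one] at hwin
  -- The integral over an interval away from the saddle point.
  have hErr : ∀ x y : ℝ, x ∈ Set.Icc (0 : ℝ) 1 → y ∈ Set.Icc (0 : ℝ) 1 → x ≤ y →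
      (∀ v ∈ Set.Icc x y, δ ≤ |v - 1 / 6|) →
      ‖∫ v in x..y, kernel τ v‖ ≤ C₂ * D * (‖Complex.exp (phase (1 / 6) / τ)‖ * (√r * r ^ K)) := by
    intro x y hx hy hxy hfar
    have := intervalIntegral.norm_integral_le_of_norm_le_const (a := x) (b := y)
      (f := fun v : ℝ => kernel τ v)
      (C := C₂ * (Real.exp (phase (1 / 6) * ω.re / r) * Real.exp (-(c / r)))) (by
        intro v hv
        rw [Set.uIoc_of_le hxy] at hv
        exact b₂ r hr hr1 v ⟨hx.1.trans hv.1.le, hv.2.trans hy.2⟩ (hfar v ⟨hv.1.le, hv.2⟩))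
    refine this.trans ?_
    have h1 : |y - x| ≤ 1 := by rw [abs_of_nonneg (by linarith)]; linarith [hx.1, hy.2]
    have h2 : Real.exp (-(c / r)) ≤ D * (√r * r ^ K) := by
      refine (exp_neg_div_le hc hr (K + 1)).trans ?_
      rw [pow_succ' r K]
      gcongr
      rw [Real.le_sqrt hr.le hr.le]
      nlinarith
    rw [hP]
    calc _ ≤ C₂ * (Real.exp (phase (1 / 6) * ω.re / r) * (D * (√r * r ^ K))) * 1 := by gcongr
      _ = _ := by ring
  have hi : ∀ x y : ℝ, IntervalIntegrable (fun v : ℝ => kernel τ v) MeasureTheory.volume x y :=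
    fun x y => hcont.intervalIntegrable _ _
  have hsplit : G0 (cyc τ) = (∫ v in (0 : ℝ)..(1 / 6 - δ), kernel τ v) +
      (∫ v in (1 / 6 - δ)..(1 / 6 + δ), kernel τ v) + ∫ v in (1 / 6 + δ)..1, kernel τ v := by
    rw [G0_eq_integral hτ0, intervalIntegral.integral_add_adjacent_intervals (hi _ _) (hi _ _),
      intervalIntegral.integral_add_adjacent_intervals (hi _ _) (hi _ _)]
  have e1 := hErr 0 (1 / 6 - δ) ⟨le_rfl, zero_le_one⟩ ⟨by linarith, by linarith⟩ (by linarith)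
    (fun v hv => by rw [abs_of_nonpos (by linarith [hv.2])]; linarith [hv.2])
  have e2 := hErr (1 / 6 + δ) 1 ⟨by linarith, by linarith⟩ ⟨zero_le_one, le_rfl⟩ (by linarith)
    (fun v hv => by rw [abs_of_nonneg (by linarith [hv.1])]; linarith [hv.1])
  rw [hsplit]
  set I₁ := ∫ v in (0 : ℝ)..(1 / 6 - δ), kernel τ v
  set I₂ := ∫ v in (1 / 6 - δ)..(1 / 6 + δ), kernel τ v
  set I₃ := ∫ v in (1 / 6 + δ)..1, kernel τ v
  set M := Complex.exp (phase (1 / 6) / τ) * (τ ^ (1 / 2 : ℂ) * ∑ j ∈ Finset.range K, A j * τ ^ j)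
  calc ‖I₁ + I₂ + I₃ - M‖ = ‖(I₂ - M) + (I₁ + I₃)‖ := by congr 1; ring
    _ ≤ ‖I₂ - M‖ + (‖I₁‖ + ‖I₃‖) := (norm_add_le _ _).trans (by gcongr; exact norm_add_le _ _)
    _ ≤ _ := by linarith

/-! ### Symmetries of the kernel -/

lemma conj_tprod_one_sub_mul_pow {q : ℂ} (hq : ‖q‖ < 1) (z : ℂ) :
    (starRingEnd ℂ) (∏' j : ℕ, (1 - z * q ^ j)) =
      ∏' j : ℕ, (1 - (starRingEnd ℂ) z * (starRingEnd ℂ) q ^ j) := by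
  rw [(multipliable_one_sub_mul_pow hq z).map_tprod (starRingEnd ℂ) Complex.continuous_conj]
  simp only [map_sub, map_one, map_mul, map_pow]

lemma conj_halfPoch {τ : ℂ} (hτ : 0 < τ.im) (v : ℂ) :
    (starRingEnd ℂ) (halfPoch τ v) = halfPoch (-(starRingEnd ℂ) τ) (-(starRingEnd ℂ) v) := by
  rw [halfPoch_eq, conj_tprod_one_sub_mul_pow (norm_cyc_lt_one hτ), halfPoch_eq, map_mul,
    conj_cyc, conj_cyc, conj_cyc, map_div₀, map_ofNat, neg_div]

lemma conj_kernel {τ : ℂ} (hτ : 0 < τ.im) (v : ℂ) :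
    (starRingEnd ℂ) (kernel τ v) = kernel (-(starRingEnd ℂ) τ) (-(starRingEnd ℂ) v) := by
  rw [kernel, map_div₀, conj_halfPoch hτ, conj_halfPoch hτ, map_neg, kernel]

lemma kernel_add_one (τ v : ℂ) : kernel τ (v + 1) = kernel τ v := by
  have h1 : cyc (v + 1) = cyc v := by
    have := cyc_add_int v 1
    rw [← this]; push_cast; rfl
  have h2 : cyc (-(v + 1)) = cyc (-v) := by
    have := cyc_add_int (-v) (-1)
    rw [← this]; congr 1; push_cast; ring
  rw [kernel, kernel, halfPoch_eq, halfPoch_eq, halfPoch_eq, halfPoch_eq, h1, h2]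

lemma periodic_kernel (τ : ℂ) : Function.Periodic (fun v : ℝ => kernel τ v) 1 := by
  intro v
  have := kernel_add_one τ v
  push_cast
  exact this

/-- The series `G_0` has real coefficients. -/
lemma G0_cyc_neg_conj {τ : ℂ} (hτ : 0 < τ.im) :
    G0 (cyc (-(starRingEnd ℂ) τ)) = (starRingEnd ℂ) (G0 (cyc τ)) := by
  have hτ' : 0 < (-(starRingEnd ℂ) τ).im := by simpa using hτ
  rw [G0_eq_integral hτ', G0_eq_integral hτ]
  have h1 : ∀ v : ℝ, kernel (-(starRingEnd ℂ) τ) v = (starRingEnd ℂ) (kernel τ ((-v : ℝ) : ℂ)) := by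
    intro v
    rw [conj_kernel hτ, Complex.conj_ofReal]
    push_cast
    rw [neg_neg]
  simp only [h1]
  rw [intervalIntegral.integral_comp_neg (fun v : ℝ => (starRingEnd ℂ) (kernel τ v)),
    intervalIntegral.intervalIntegral_conj]
  congr 1
  have := (periodic_kernel τ).intervalIntegral_add_eq (-1) 0
  simpa using this

lemma halfPoch_eq_mul {τ : ℂ} (hτ : 0 < τ.im) (v : ℂ) :
    halfPoch τ v = (1 - cyc (v + τ / 2)) * halfPoch τ (v + τ) := by
  have hq := norm_cyc_lt_one hτ
  have e1 : cyc (v + τ) * cyc (τ / 2) = cyc v * cyc (τ / 2) * cyc τ := by rw [cyc_add]; ring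
  rw [halfPoch_eq, halfPoch_eq, e1, cyc_add v]
  set z := cyc v * cyc (τ / 2)
  refine tendsto_nhds_unique ((tendsto_prod_one_sub_mul_pow hq z).comp (tendsto_add_atTop_nat 1))
    (((tendsto_prod_one_sub_mul_pow hq (z * cyc τ)).const_mul (1 - z)).congr fun n => ?_)
  rw [Function.comp, Finset.prod_range_succ', pow_zero, mul_one, mul_comm]
  congr 1
  refine Finset.prod_congr rfl fun j _ => ?_
  rw [pow_succ]; ring

/-- The functional equation of the kernel. -/
lemma kernel_sub {τ : ℂ} (hτ : 0 < τ.im) {v : ℂ} (hv : 1 - cyc (-(v - τ / 2)) ≠ 0) :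
    kernel τ (v - τ) = (1 - cyc (v - τ / 2)) * (1 - cyc (-(v - τ / 2))) * kernel τ v := by
  have h1 := halfPoch_eq_mul hτ (v - τ)
  have h2 := halfPoch_eq_mul hτ (-v)
  rw [show v - τ + τ / 2 = v - τ / 2 by ring, sub_add_cancel] at h1
  rw [show -v + τ / 2 = -(v - τ / 2) by ring, show -v + τ = -(v - τ) by ring] at h2
  rw [kernel, kernel, h1, h2]
  generalize 1 - cyc (-(v - τ / 2)) = x at hv ⊢
  generalize 1 - cyc (v - τ / 2) = y
  rw [mul_comm x, ← div_div, mul_div_assoc]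
  generalize halfPoch τ v / halfPoch τ (-(v - τ)) = k
  field_simp

/-- The modulus of the factor in the functional equation of the kernel. -/
lemma norm_one_sub_cyc_mul (w : ℂ) : ‖1 - cyc w‖ * ‖1 - cyc (-w)‖ =
    2 * Real.cosh (2 * Real.pi * w.im) - 2 * Real.cos (2 * Real.pi * w.re) := by
  have hsq : ∀ z : ℂ, ‖1 - z‖ ^ 2 = 1 - 2 * z.re + ‖z‖ ^ 2 := by
    intro z
    rw [← Complex.normSq_eq_norm_sq, ← Complex.normSq_eq_norm_sq, Complex.normSq_apply,
      Complex.normSq_apply]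
    simp
    ring
  set E := Real.exp (2 * Real.pi * w.im) with hE
  have hE0 : 0 < E := Real.exp_pos _
  have e1 : (cyc w).re = E⁻¹ * Real.cos (2 * Real.pi * w.re) := by
    rw [cyc_re, Real.exp_neg]
  have e2 : (cyc (-w)).re = E * Real.cos (2 * Real.pi * w.re) := by
    rw [cyc_re, Complex.neg_im, Complex.neg_re, mul_neg, mul_neg, neg_neg, Real.cos_neg]
  have n1 : ‖cyc w‖ = E⁻¹ := by rw [norm_cyc, Real.exp_neg]
  have n2 : ‖cyc (-w)‖ = E := by rw [norm_cyc, Complex.neg_im, mul_neg, neg_neg]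
  have hc : 2 * Real.cosh (2 * Real.pi * w.im) = E + E⁻¹ := by
    rw [Real.cosh_eq, Real.exp_neg]; ring
  have hcos := Real.cos_le_one (2 * Real.pi * w.re)
  have hcosh := Real.one_le_cosh (2 * Real.pi * w.im)
  refine (pow_left_inj₀ (by positivity) (by linarith) two_ne_zero).mp ?_
  rw [mul_pow, hsq, hsq, e1, e2, n1, n2, hc]
  field_simp
  ring

section imaginary
variable {t : ℝ}

lemma neg_conj_mul_I (t : ℝ) : -(starRingEnd ℂ) (t * Complex.I) = t * Complex.I := by
  simp

lemma im_mul_I (t : ℝ) : ((t : ℂ) * Complex.I).im = t := by simp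

lemma conj_kernel_I (ht : 0 < t) (v : ℂ) : (starRingEnd ℂ) (kernel (t * Complex.I) v) =
    kernel (t * Complex.I) (-(starRingEnd ℂ) v) := by
  rw [conj_kernel (by rw [im_mul_I]; exact ht), neg_conj_mul_I]

/-- On the imaginary axis the kernel has modulus one on the whole real line, so the path of integration
has to be deformed. -/
lemma norm_kernel_I_ofReal (ht : 0 < t) (u : ℝ) : ‖kernel (t * Complex.I) u‖ = 1 := by
  have hτ : 0 < ((t : ℂ) * Complex.I).im := by rw [im_mul_I]; exact ht
  have h1 := conj_halfPoch hτ u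
  rw [neg_conj_mul_I, Complex.conj_ofReal] at h1
  have hne : halfPoch (t * Complex.I) (-u) ≠ 0 :=
    halfPoch_ne_zero_of_im hτ (by rw [im_mul_I]; simp; linarith)
  rw [kernel, norm_div, ← h1, Complex.norm_conj, div_self]
  rw [← h1] at hne
  simpa using hne

/-- The functional equation bounds the kernel below the real line by a product of `m` factors. -/
lemma norm_kernel_I_sub_le (ht : 0 < t) {u l : ℝ} (m : ℕ)
    (hl : ∀ y : ℝ, 0 ≤ y → y ≤ m * t →
      2 * Real.cosh (2 * Real.pi * y) - 2 * Real.cos (2 * Real.pi * u) ≤ l) :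
    ‖kernel (t * Complex.I) (u - m * t * Complex.I)‖ ≤ l ^ m := by
  have hτ : 0 < ((t : ℂ) * Complex.I).im := by rw [im_mul_I]; exact ht
  induction m with
  | zero => simp [norm_kernel_I_ofReal ht]
  | succ m ih =>
    push_cast at hl ⊢
    have hm : (0 : ℝ) ≤ m := m.cast_nonneg
    have ih' := ih fun y h0 h1 => hl y h0 (by nlinarith)
    set w : ℂ := u - m * t * Complex.I - t * Complex.I / 2 with hw
    have hwr : w.re = u := by simp [hw]
    have hwi : w.im = -((m + 1 / 2) * t) := by simp [hw]; ring
    have hne : 1 - cyc (-w) ≠ 0 := by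
      intro h
      have h1 := norm_cyc_lt_one (w := -w) (by rw [Complex.neg_im, hwi, neg_neg]; positivity)
      rw [← sub_eq_zero.mp h, norm_one] at h1
      exact lt_irrefl _ h1
    have hk := kernel_sub hτ hne
    rw [show (u : ℂ) - (m + 1) * t * Complex.I = u - m * t * Complex.I - t * Complex.I by ring, hk,
      norm_mul, norm_mul, norm_one_sub_cyc_mul, hwr, hwi, pow_succ', mul_neg, Real.cosh_neg]
    have h2 := hl ((m + 1 / 2) * t) (by positivity) (by nlinarith)
    have h3 : 0 ≤ l := by
      refine le_trans ?_ h2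
      have hcos := Real.cos_le_one (2 * Real.pi * u)
      have hcosh := Real.one_le_cosh (2 * Real.pi * ((m + 1 / 2) * t))
      linarith
    gcongr

/-- The functional equation bounds the kernel above the real line by a product of `m` factors. -/
lemma norm_kernel_I_add_le (ht : 0 < t) {u l : ℝ} (m : ℕ) (hl0 : 0 < l)
    (hl : l ≤ 2 - 2 * Real.cos (2 * Real.pi * u)) :
    ‖kernel (t * Complex.I) (u + m * t * Complex.I)‖ ≤ l⁻¹ ^ m := by
  have hτ : 0 < ((t : ℂ) * Complex.I).im := by rw [im_mul_I]; exact ht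
  induction m with
  | zero => simp [norm_kernel_I_ofReal ht]
  | succ m ih =>
    push_cast
    set w : ℂ := u + (m + 1) * t * Complex.I - t * Complex.I / 2 with hw
    have hwr : w.re = u := by simp [hw]
    have hφ := norm_one_sub_cyc_mul w
    rw [hwr] at hφ
    have h1 : l ≤ ‖1 - cyc w‖ * ‖1 - cyc (-w)‖ := by
      rw [hφ]
      have hcosh := Real.one_le_cosh (2 * Real.pi * w.im)
      linarith
    have hne : 1 - cyc (-w) ≠ 0 := by
      intro h
      rw [h, norm_zero, mul_zero] at h1
      linarith
    have hk := congrArg norm (kernel_sub hτ hne)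
    rw [show (u : ℂ) + (m + 1) * t * Complex.I - t * Complex.I = u + m * t * Complex.I by ring,
      norm_mul, norm_mul] at hk
    rw [pow_succ', ← div_eq_inv_mul, le_div_iff₀ hl0]
    refine le_trans ?_ (hk.symm.le.trans ih)
    rw [mul_comm]
    gcongr

/-- On the imaginary axis, `G_0` is twice the real part of half of the integral. -/
lemma G0_I_eq (ht : 0 < t) : G0 (cyc (t * Complex.I)) =
    (∫ v in (0 : ℝ)..(1 / 2), kernel (t * Complex.I) v) +
      (starRingEnd ℂ) (∫ v in (0 : ℝ)..(1 / 2), kernel (t * Complex.I) v) := by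
  have hτ : 0 < ((t : ℂ) * Complex.I).im := by rw [im_mul_I]; exact ht
  have hi : ∀ x y : ℝ, IntervalIntegrable (fun v : ℝ => kernel (t * Complex.I) v)
      MeasureTheory.volume x y := fun x y => (continuous_kernel_ofReal hτ).intervalIntegrable _ _
  have h1 := (periodic_kernel (t * Complex.I)).intervalIntegral_add_eq 0 (-(1 / 2))
  rw [zero_add, show (-(1 / 2) + 1 : ℝ) = 1 / 2 by norm_num] at h1
  have h2 : ∫ v in (-(1 / 2 : ℝ))..0, kernel (t * Complex.I) v =
      ∫ v in (0 : ℝ)..(1 / 2), kernel (t * Complex.I) ((-v : ℝ) : ℂ) := by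
    rw [intervalIntegral.integral_comp_neg (fun v : ℝ => kernel (t * Complex.I) v), neg_zero]
  have h3 : ∀ v : ℝ, kernel (t * Complex.I) ((-v : ℝ) : ℂ) =
      (starRingEnd ℂ) (kernel (t * Complex.I) v) := by
    intro v
    rw [conj_kernel_I ht, Complex.conj_ofReal]
    push_cast
    rfl
  simp only [h3] at h2
  rw [intervalIntegral.intervalIntegral_conj] at h2
  rw [G0_eq_integral hτ, h1, ← intervalIntegral.integral_add_adjacent_intervals (hi _ 0) (hi 0 _), h2,
    add_comm]

end imaginary

/-! ### The imaginary axis -/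

/-- The direction `e^{πi/4}` of steepest descent at the saddle point when `τ` is on the imaginary
axis. -/
noncomputable def diagDir : ℂ := Complex.exp ((Real.pi / 4 : ℝ) * Complex.I)

lemma diagDir_eq : diagDir = ((√2 / 2 : ℝ) : ℂ) + ((√2 / 2 : ℝ) : ℂ) * Complex.I := by
  rw [diagDir, Complex.exp_mul_I, ← Complex.ofReal_cos, ← Complex.ofReal_sin, Real.cos_pi_div_four,
    Real.sin_pi_div_four]

lemma diagDir_sq : diagDir ^ 2 = Complex.I := by
  rw [diagDir, ← Complex.exp_nat_mul]
  refine Eq.trans ?_ Complex.exp_pi_div_two_mul_I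
  congr 1
  push_cast
  ring

lemma admissible_diagDir : Admissible diagDir Complex.I := by
  refine ⟨Complex.norm_exp_ofReal_mul_I _, Complex.norm_I, ?_, ?_⟩
  · rw [diagDir_sq, div_self Complex.I_ne_zero]; simp
  · rw [diagDir_sq, div_self Complex.I_ne_zero, inv_one, Complex.one_cpow, mul_one,
      Complex.cpow_def_of_ne_zero Complex.I_ne_zero, Complex.log_I, diagDir]
    congr 1
    push_cast
    ring

/-- A convex region to the right of the poles of the kernel on the positive imaginary axis, and to
the left of those above `1`. -/
def contourRegion (t : ℝ) : Set ℂ := {v | v.im < v.re + t / 4 ∧ v.re < 1}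

lemma convex_contourRegion (t : ℝ) : Convex ℝ (contourRegion t) := by
  intro x hx y hy a b ha hb hab
  have hx1 := hx.1
  have hx2 := hx.2
  have hy1 := hy.1
  have hy2 := hy.2
  simp only [contourRegion, Set.mem_ofPred_eq, Complex.add_im, Complex.add_re, Complex.real_smul,
    Complex.re_ofReal_mul, Complex.im_ofReal_mul]
  have hb' : b = 1 - a := by linarith
  subst hb'
  rcases ha.eq_or_lt with rfl | ha
  · constructor <;> nlinarith
  · constructor <;> nlinarith [mul_pos ha (sub_pos.mpr hx1), mul_nonneg hb (sub_pos.mpr hy1).le,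
      mul_pos ha (sub_pos.mpr hx2), mul_nonneg hb (sub_pos.mpr hy2).le]

lemma differentiableOn_kernel_contourRegion {t : ℝ} (ht : 0 < t) :
    DifferentiableOn ℂ (kernel (t * Complex.I)) (contourRegion t) := by
  have hτ : 0 < ((t : ℂ) * Complex.I).im := by rw [im_mul_I]; exact ht
  intro v hv
  refine (differentiableAt_kernel hτ (halfPoch_ne_zero hτ fun j n h => ?_)).differentiableWithinAt
  have hre := congrArg Complex.re h
  have him := congrArg Complex.im h
  have hj : (0 : ℝ) ≤ j := j.cast_nonneg
  have e1 : ((j : ℂ) + 1 / 2) * (t * Complex.I) = (((j + 1 / 2) * t : ℝ) : ℂ) * Complex.I := by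
    push_cast; ring
  rw [e1] at hre him
  simp at hre him
  have h1 := hv.1
  have h2 := hv.2
  have h3 : (-1 : ℝ) < n := by linarith
  have h4 : -1 < n := by exact_mod_cast h3
  have h5 : (0 : ℝ) ≤ n := by
    have : 0 ≤ n := by omega
    exact_mod_cast this
  nlinarith [mul_nonneg hj ht.le]

section contour
variable {t : ℝ} {g : ℂ → ℂ}

lemma integral_line_eq (hg : ∀ v ∈ contourRegion t,
      HasDerivWithinAt g (kernel (t * Complex.I) v) (contourRegion t) v) (ht : 0 < t)
    {z d : ℂ} {a b : ℝ} (hab : a ≤ b) (h : ∀ x ∈ Set.Icc a b, z + x * d ∈ contourRegion t) :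
    (∫ x in a..b, kernel (t * Complex.I) (z + x * d) * d) = g (z + b * d) - g (z + a * d) := by
  have hopen : IsOpen (contourRegion t) :=
    (isOpen_lt Complex.continuous_im (by fun_prop)).inter
      (isOpen_lt Complex.continuous_re continuous_const)
  have hline : ∀ x : ℝ, HasDerivAt (fun x : ℝ => z + x * d) d x := fun x => by
    simpa using ((Complex.ofRealCLM.hasDerivAt (x := x)).mul_const d).const_add z
  refine intervalIntegral.integral_eq_sub_of_hasDerivAt (f := fun x : ℝ => g (z + x * d)) ?_ ?_
  · intro x hx
    rw [Set.uIcc_of_le hab] at hx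
    exact ((hg _ (h x hx)).hasDerivAt (hopen.mem_nhds (h x hx))).comp x (hline x)
  · refine ContinuousOn.intervalIntegrable ?_
    rw [Set.uIcc_of_le hab]
    exact ((differentiableOn_kernel_contourRegion ht).continuousOn.comp
      (Continuous.continuousOn (by fun_prop)) h).mul continuousOn_const

/-- The kernel is real on the vertical lines with real part in `ℤ/2`, so the integral along a
segment of such a line is purely imaginary. -/
lemma integral_vertical_add_conj {z : ℂ}
    (hz : ∀ x : ℝ, (starRingEnd ℂ) (kernel (t * Complex.I) (z + x * Complex.I)) =
      kernel (t * Complex.I) (z + x * Complex.I)) (a b : ℝ) :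
    (∫ x in a..b, kernel (t * Complex.I) (z + x * Complex.I) * Complex.I) +
      (starRingEnd ℂ) (∫ x in a..b, kernel (t * Complex.I) (z + x * Complex.I) * Complex.I) = 0 := by
  rw [← intervalIntegral.intervalIntegral_conj]
  simp only [map_mul, hz, Complex.conj_I, mul_neg]
  rw [intervalIntegral.integral_neg, add_neg_cancel]

/-- Deformation of the contour: up to an imaginary quantity, the integral over `[0, 1/2]` is the sum
of an integral over a diagonal segment through the saddle point and of two integrals over horizontal
segments. -/
lemma G0_I_eq_contour (ht : 0 < t) {R η : ℝ} (hη : η = R * (√2 / 2)) (hR : 0 < R)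
    (hη1 : η ≤ 1 / 12) : ∃ H : ℂ,
      H = (∫ x in (0 : ℝ)..(1 / 6 - η), kernel (t * Complex.I) (-(η * Complex.I) + x * 1) * 1) +
        (∫ x in (-R)..R, kernel (t * Complex.I) (1 / 6 + x * diagDir) * diagDir) +
        ∫ x in (1 / 6 + η)..(1 / 2), kernel (t * Complex.I) (η * Complex.I + x * 1) * 1 ∧
      G0 (cyc (t * Complex.I)) = H + (starRingEnd ℂ) H := by
  refine ⟨_, rfl, ?_⟩
  obtain ⟨g, hg⟩ := (convex_contourRegion t).exists_forall_hasDerivWithinAt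
    (differentiableOn_kernel_contourRegion ht)
  have hη0 : 0 < η := by rw [hη]; positivity
  have hτ : ∀ z : ℂ, (starRingEnd ℂ) (kernel (t * Complex.I) z) =
    kernel (t * Complex.I) (-(starRingEnd ℂ) z) := conj_kernel_I ht
  have hRe : (R : ℂ) * diagDir = η + η * Complex.I := by
    rw [diagDir_eq, hη]; push_cast; ring
  have v1 := integral_vertical_add_conj (t := t) (z := 0) (fun x => by
    rw [hτ]; congr 1; simp) (-η) 0
  have v2 := integral_vertical_add_conj (t := t) (z := 1 / 2) (fun x => by
    rw [hτ, ← kernel_add_one]; congr 1; simp [map_ofNat]; ring) 0 η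
  have g1 := integral_line_eq hg ht (z := 0) (d := Complex.I) (a := -η) (b := 0) (by linarith) (by
    intro x hx
    constructor <;> simp
    linarith [hx.2])
  have g2 := integral_line_eq hg ht (z := -(η * Complex.I)) (d := 1) (a := 0) (b := 1 / 6 - η)
    (by linarith) (by
    intro x hx
    constructor <;> simp <;> linarith [hx.1, hx.2])
  have g3 := integral_line_eq hg ht (z := 1 / 6) (d := diagDir) (a := -R) (b := R)
    (by linarith) (by
    intro x hx
    have h1 : x * (√2 / 2) ≤ R * (√2 / 2) := by gcongr; exact hx.2
    have e : (1 / 6 : ℂ) + x * diagDir =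
        ((1 / 6 + x * (√2 / 2) : ℝ) : ℂ) + ((x * (√2 / 2) : ℝ) : ℂ) * Complex.I := by
      rw [diagDir_eq]; push_cast; ring
    rw [e]
    constructor
    · simp; linarith
    · rw [← hη] at h1
      simp only [Complex.add_re, Complex.ofReal_re, Complex.re_ofReal_mul, Complex.I_re, mul_zero,
        add_zero]
      linarith)
  have g4 := integral_line_eq hg ht (z := η * Complex.I) (d := 1) (a := 1 / 6 + η) (b := 1 / 2)
    (by linarith) (by
    intro x hx
    constructor <;> simp <;> linarith [hx.1, hx.2])
  have g5 := integral_line_eq hg ht (z := 1 / 2) (d := Complex.I) (a := 0) (b := η) hη0.le (by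
    intro x hx
    constructor <;> simp
    · linarith [hx.2]
    · norm_num)
  have g6 := integral_line_eq hg ht (z := 0) (d := 1) (a := 0) (b := 1 / 2) (by norm_num) (by
    intro x hx
    constructor <;> simp <;> linarith [hx.1, hx.2])
  have hJ : ∫ v in (0 : ℝ)..(1 / 2), kernel (t * Complex.I) v =
      ∫ v in (0 : ℝ)..(1 / 2), kernel (t * Complex.I) (0 + v * 1) * 1 := by simp
  rw [G0_I_eq ht, hJ]
  -- The end points of consecutive segments agree.
  have p1 : (-(η * Complex.I) + ((0 : ℝ) : ℂ) * 1 : ℂ) = 0 + ((-η : ℝ) : ℂ) * Complex.I := by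
    push_cast; ring
  have p2 : (1 / 6 + ((-R : ℝ) : ℂ) * diagDir : ℂ) =
      -(η * Complex.I) + ((1 / 6 - η : ℝ) : ℂ) * 1 := by
    push_cast; linear_combination -hRe
  have p3 : (1 / 6 + (R : ℂ) * diagDir : ℂ) = η * Complex.I + ((1 / 6 + η : ℝ) : ℂ) * 1 := by
    push_cast; linear_combination hRe
  have p4 : (1 / 2 + (η : ℂ) * Complex.I : ℂ) = η * Complex.I + ((1 / 2 : ℝ) : ℂ) * 1 := by
    push_cast; ring
  have p5 : (0 + ((1 / 2 : ℝ) : ℂ) * 1 : ℂ) = 1 / 2 + ((0 : ℝ) : ℂ) * Complex.I := by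
    push_cast; ring
  have p6 : (0 + ((0 : ℝ) : ℂ) * 1 : ℂ) = 0 + ((0 : ℝ) : ℂ) * Complex.I := by
    push_cast; ring
  rw [p1] at g2
  rw [p2, p3] at g3
  rw [p4] at g5
  rw [p5, p6] at g6
  set V₁ := ∫ x in (-η)..0, kernel (t * Complex.I) (0 + x * Complex.I) * Complex.I
  set V₂ := ∫ x in (0 : ℝ)..η, kernel (t * Complex.I) (1 / 2 + x * Complex.I) * Complex.I
  set H₁ := ∫ x in (0 : ℝ)..(1 / 6 - η), kernel (t * Complex.I) (-(η * Complex.I) + x * 1) * 1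
  set D := ∫ x in (-R)..R, kernel (t * Complex.I) (1 / 6 + x * diagDir) * diagDir
  set H₂ := ∫ x in (1 / 6 + η)..(1 / 2), kernel (t * Complex.I) (η * Complex.I + x * 1) * 1
  have hsum : ∫ v in (0 : ℝ)..(1 / 2), kernel (t * Complex.I) (0 + v * 1) * 1 =
      (H₁ + D + H₂) - V₁ - V₂ := by
    rw [g6, g1, g2, g3, g4, g5]; ring
  rw [hsum, map_sub, map_sub]
  linear_combination -v1 - v2

end contour

/-- The factor in the functional equation of the kernel is less than one to the left of the saddle
point. -/
lemma cosh_sub_cos_le {δ ε x y : ℝ} (hδ : 0 ≤ δ) (hδε : δ ≤ ε) (hε : ε ≤ 1 / 2) (hy : |y| ≤ ε)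
    (hx0 : 0 ≤ x) (hx : x ≤ Real.pi / 3 - ε) :
    2 * Real.cosh y - 2 * Real.cos x ≤ 1 - δ / 4 := by
  have hε0 : 0 ≤ ε := hδ.trans hδε
  have h1 : Real.cosh y ≤ 1 + ε ^ 2 := by
    have h2 : y ^ 2 ≤ ε ^ 2 := by rw [← sq_abs]; gcongr
    have h3 : y ^ 2 / 2 ≤ 1 := by nlinarith
    have h4 := Real.abs_exp_sub_one_le (x := y ^ 2 / 2) (by rw [abs_of_nonneg (by positivity)]; exact h3)
    have h5 := (le_abs_self _).trans h4
    rw [abs_of_nonneg (by positivity)] at h5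
    linarith [Real.cosh_le_exp_half_sq y]
  have hπ := Real.pi_gt_three
  have h2 : Real.cos (Real.pi / 3 - ε) ≤ Real.cos x :=
    Real.cos_le_cos_of_nonneg_of_le_pi hx0 (by linarith) hx
  have h3 : Real.cos (Real.pi / 3 - ε) = 1 / 2 * Real.cos ε + √3 / 2 * Real.sin ε := by
    rw [Real.cos_sub, Real.cos_pi_div_three, Real.sin_pi_div_three]
  have h4 := Real.one_sub_sq_div_two_le_cos (x := ε)
  have h5 : ε - ε ^ 3 / 6 ≤ Real.sin ε := by
    rcases hε0.eq_or_lt with h | h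
    · rw [← h]; simp
    · exact (Real.sin_gt_sub_cube h).le
  have h6 : (17 / 10 : ℝ) ≤ √3 := by
    rw [Real.le_sqrt (by norm_num) (by norm_num)]; norm_num
  have h7 : ε ^ 3 ≤ ε / 4 := by nlinarith [mul_nonneg hε0 hε0]
  have h8 : 17 / 10 * (ε * (23 / 24)) ≤ √3 * Real.sin ε := by
    have : ε * (23 / 24) ≤ Real.sin ε := by linarith
    have h0 : 0 ≤ ε * (23 / 24) := by positivity
    gcongr
  have h9 : ε ^ 2 ≤ ε / 2 := by nlinarith
  nlinarith

/-- Exponential decay of the powers that bound the kernel on the horizontal segments. -/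
lemma exists_pow_floor_le {l d : ℝ} (hl0 : 0 < l) (hl1 : l < 1) (hd : 0 < d) :
    ∃ c > 0, ∀ t : ℝ, 0 < t → l ^ ⌊d / t⌋₊ ≤ l⁻¹ * Real.exp (-(c / t)) := by
  have hlog : Real.log l < 0 := Real.log_neg hl0 hl1
  refine ⟨-Real.log l * d, mul_pos (by linarith) hd, fun t ht => ?_⟩
  have h1 := (Nat.lt_floor_add_one (d / t)).le
  have e : l⁻¹ = Real.exp (-Real.log l) := by rw [Real.exp_neg, Real.exp_log hl0]
  rw [← Real.rpow_natCast, Real.rpow_def_of_pos hl0, e, ← Real.exp_add]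
  apply Real.exp_le_exp.mpr
  have e2 : -Real.log l * d / t = -Real.log l * (d / t) := by ring
  rw [e2]
  nlinarith

lemma vertical_ray_mem_logRegion {ρ : ℝ} (hρ : 0 < ρ) {z : ℂ} (h0 : ρ ≤ z.re) (h1 : z.re ≤ 1 - ρ)
    (him : -1 ≤ z.im) {t s : ℝ} (ht : 0 < t) (hs : 0 ≤ s) :
    z + s * (t * Complex.I) ∈ logRegion ρ := by
  have e : z + s * (t * Complex.I) = z + ((s * t : ℝ) : ℂ) * Complex.I := by push_cast; ring
  have hre : (z + s * (t * Complex.I)).re = z.re := by rw [e]; simp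
  have hi : (z + s * (t * Complex.I)).im = z.im + s * t := by rw [e]; simp
  have hst : 0 ≤ s * t := by positivity
  refine ⟨Or.inr (by rw [hre]; constructor <;> linarith), by rw [hi]; linarith, fun n => ?_⟩
  refine le_trans ?_ (Complex.abs_re_le_norm _)
  rw [Complex.sub_re, hre, Complex.intCast_re]
  rcases le_or_gt n 0 with hn | hn
  · have : (n : ℝ) ≤ 0 := by exact_mod_cast hn
    exact le_trans (by linarith) (le_abs_self _)
  · have : (1 : ℝ) ≤ n := by exact_mod_cast hn
    exact le_trans (by linarith) (neg_le_abs _)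

/-- The expansion of `G_0` on the imaginary axis, where the contributions of the two saddle points
are complex conjugates of each other. -/
lemma exists_G0_sub_le_I {K : ℕ} {A : ℕ → ℂ} (hA : IsSaddleExpansion (K + 1) K A) :
    ∃ C : ℝ, ∃ r₀ > 0, ∀ r : ℝ, 0 < r → r < r₀ → ∃ M : ℂ,
      M = Complex.exp (phase (1 / 6) / (r * Complex.I)) * ((r * Complex.I) ^ (1 / 2 : ℂ) *
        ∑ j ∈ Finset.range K, A j * (r * Complex.I) ^ j) ∧
      ‖G0 (cyc (r * Complex.I)) - (M + (starRingEnd ℂ) M)‖ ≤ C * (√r * r ^ K) := by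
  have hadm := admissible_diagDir
  obtain ⟨δ₁, hδ₁, h₁⟩ := hA diagDir Complex.I hadm
  set δ := min δ₁ (1 / 16) with hδdef
  have hδ : 0 < δ := by positivity
  have hδ16 : δ ≤ 1 / 16 := min_le_right _ _
  obtain ⟨C₀, hC₀, hk⟩ := exists_kernel_eq_exp (K + 1) (ρ := 1 / 12) (by norm_num)
  obtain ⟨C₁, r₁, hr₁, b₁⟩ := h₁ δ hδ (min_le_left _ _) C₀ hC₀.le
  have hs2 : √2 * √2 = 2 := Real.mul_self_sqrt (by norm_num)
  have hs0 : 0 < √2 := by positivity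
  have hs1 : (1 : ℝ) ≤ √2 := by rw [Real.le_sqrt (by norm_num) (by norm_num)]; norm_num
  have hs3 : √2 ≤ 2 := by rw [Real.sqrt_le_left (by norm_num)]; norm_num
  have hπ := Real.pi_gt_three
  have hπ4 := Real.pi_lt_four
  -- The bounds of the factors on the two horizontal segments.
  set l₂ := 2 - 2 * Real.cos (Real.pi / 3 + δ / 4) with hl₂
  have hl₂1 : 1 < l₂ := by
    have := Real.cos_lt_cos_of_nonneg_of_le_pi (x := Real.pi / 3) (y := Real.pi / 3 + δ / 4)
      (by linarith) (by linarith) (by linarith)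
    rw [Real.cos_pi_div_three] at this
    rw [hl₂]; linarith
  set l := max (1 - δ / 4 / 4) l₂⁻¹ with hl
  have hl0 : 0 < l := lt_max_of_lt_right (inv_pos.mpr (by linarith))
  have hl1 : l < 1 := max_lt (by linarith) (inv_lt_one_of_one_lt₀ hl₂1)
  set d := δ * (√2 / 2) with hd
  have hd0 : 0 < d := by positivity
  have hdδ : d ≤ δ := mul_le_of_le_one_right hδ.le (by linarith)
  obtain ⟨c, hc, hcb⟩ := exists_pow_floor_le hl0 hl1 hd0
  set D := ((K + 1).factorial : ℝ) / c ^ (K + 1) with hD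
  have hD0 : 0 ≤ D := by positivity
  refine ⟨2 * (C₁ + 2 * (l⁻¹ * D)), min r₁ (δ / 8), by positivity, fun t ht ht' => ⟨_, rfl, ?_⟩⟩
  have htr : t < r₁ := ht'.trans_le (min_le_left _ _)
  have htδ : t < δ / 8 := ht'.trans_le (min_le_right _ _)
  have ht1 : t ≤ 1 := by linarith
  -- The height of the horizontal segments is a multiple of the step of the functional equation.
  set m := ⌊d / t⌋₊ with hm
  set η : ℝ := m * t with hη
  have m1 : η ≤ d := by
    have := Nat.floor_le (a := d / t) (by positivity)
    rwa [← hm, le_div_iff₀ ht] at this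
  have m2 : d - t ≤ η := by
    have := (Nat.lt_floor_add_one (d / t)).le
    rw [← hm, div_le_iff₀ ht] at this
    linarith
  set R := η * √2 with hR
  have hηR : η = R * (√2 / 2) := by rw [hR]; linear_combination (-η / 2) * hs2
  have hdR : d * √2 = δ := by rw [hd]; linear_combination (δ / 2) * hs2
  have R1 : R ≤ δ := by rw [hR, ← hdR]; gcongr
  have R2 : δ / 2 ≤ R := by
    have h1 : (d - t) * √2 ≤ R := by rw [hR]; gcongr
    have h2 : t * √2 ≤ t * 2 := by gcongr
    rw [sub_mul, hdR] at h1
    linarith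
  have hη4 : δ / 4 ≤ η := by
    have h1 : δ / 2 * (1 / 2) ≤ R * (√2 / 2) := by gcongr
    rw [hηR]
    linarith
  have hη16 : η ≤ 1 / 16 := m1.trans (hdδ.trans hδ16)
  have hη0 : 0 ≤ η := (by positivity : 0 ≤ δ / 4).trans hη4
  have hη2π : η ≤ 2 * Real.pi * η := le_mul_of_one_le_left hη0 (by linarith)
  obtain ⟨H, hH, hG⟩ := G0_I_eq_contour ht hηR (by linarith) (by linarith)
  have hτ0 : 0 < ((t : ℂ) * Complex.I).im := by rw [im_mul_I]; exact ht
  have hτ1 : ((t : ℂ) * Complex.I).im ≤ 1 := by rw [im_mul_I]; exact ht1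
  have hτn : ‖(t : ℂ) * Complex.I‖ = t := hadm.norm_mul ht
  have hpt : ∀ x : ℝ, (1 / 6 : ℂ) + x * diagDir =
      ((1 / 6 + x * (√2 / 2) : ℝ) : ℂ) + ((x * (√2 / 2) : ℝ) : ℂ) * Complex.I := by
    intro x
    rw [diagDir_eq]; push_cast; ring
  have hxb : ∀ x ∈ Set.Icc (-R) R, |x * (√2 / 2)| ≤ 1 / 12 := by
    intro x hx
    rw [abs_mul, abs_of_pos (by positivity : 0 < √2 / 2)]
    have : |x| ≤ R := abs_le.mpr hx
    exact (mul_le_of_le_one_right (abs_nonneg x) (by linarith)).trans (by linarith)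
  have hre : ∀ x : ℝ, ((1 / 6 : ℂ) + x * diagDir).re = 1 / 6 + x * (√2 / 2) := by
    intro x; rw [hpt]; simp
  have him : ∀ x : ℝ, ((1 / 6 : ℂ) + x * diagDir).im = x * (√2 / 2) := by
    intro x; rw [hpt]; simp
  have hτd : ∀ x ∈ Set.Icc (-R) R, DifferentiableAt ℂ (kernel (t * Complex.I)) (1 / 6 + x * diagDir) := by
    intro x hx
    refine differentiableAt_kernel hτ0 (halfPoch_ne_zero hτ0 fun j n h => ?_)
    have h2 := abs_le.mp (hxb x hx)
    have := congrArg Complex.re h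
    have e1 : ((j : ℂ) + 1 / 2) * (t * Complex.I) = (((j + 1 / 2) * t : ℝ) : ℂ) * Complex.I := by
      push_cast; ring
    rw [e1, Complex.add_re, Complex.neg_re, hre, Complex.re_ofReal_mul, Complex.I_re, mul_zero,
      add_zero, Complex.intCast_re] at this
    have h3 : (n : ℝ) < 0 := by linarith
    have h4 : (-1 : ℝ) < n := by linarith
    have h5 : n < 0 := by exact_mod_cast h3
    have h6 : -1 < n := by exact_mod_cast h4
    omega
  have hdiag := b₁ t ht htr R ⟨R2, R1⟩ R ⟨R2, R1⟩
    (fun x : ℝ => kernel (t * Complex.I) (1 / 6 + x * diagDir)) (by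
      refine ContinuousOn.intervalIntegrable fun x hx => ?_
      rw [Set.uIcc_of_le (by linarith)] at hx
      exact (ContinuousAt.comp (f := fun x : ℝ => (1 / 6 : ℂ) + x * diagDir)
        (hτd x hx).continuousAt (by fun_prop)).continuousWithinAt) (by
      intro x hx
      have h2 := abs_le.mp (hxb x hx)
      obtain ⟨ε, hε, he⟩ := hk (t * Complex.I) hτ0 hτ1 (1 / 6 + x * diagDir)
        (fun s hs => vertical_ray_mem_logRegion (by norm_num) (by rw [hre]; linarith)
          (by rw [hre]; linarith) (by rw [him]; linarith) ht hs)
        (fun s hs => vertical_ray_mem_logRegion (by norm_num)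
          (by rw [Complex.sub_re, hre, Complex.one_re]; linarith)
          (by rw [Complex.sub_re, hre, Complex.one_re]; linarith)
          (by rw [Complex.sub_im, him, Complex.one_im]; linarith) ht hs)
      refine ⟨ε, hε.trans ?_, he⟩
      rw [hτn, im_mul_I, pow_succ, ← mul_assoc, mul_div_assoc, div_self ht.ne', mul_one]
      have := pow_le_pow_of_le_one ht.le ht1 (show K ≤ 2 * (K + 1) by omega)
      gcongr)
  have hexp1 : ‖Complex.exp (phase (1 / 6) / (t * Complex.I))‖ = 1 := by
    rw [Complex.norm_exp, ofReal_div_ray_re Complex.norm_I]; simp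
  rw [hexp1, one_mul, ← intervalIntegral.integral_mul_const] at hdiag
  have hsmall : l ^ m ≤ l⁻¹ * D * (√t * t ^ K) := by
    refine (hcb t ht).trans ?_
    rw [mul_assoc]
    refine mul_le_mul_of_nonneg_left ((exp_neg_div_le hc ht (K + 1)).trans ?_) (inv_pos.mpr hl0).le
    rw [pow_succ' t K]
    gcongr
    rw [Real.le_sqrt ht.le ht.le, sq]
    exact mul_le_of_le_one_left ht.le ht1
  have hH₁ : ‖∫ x in (0 : ℝ)..(1 / 6 - η), kernel (t * Complex.I) (-(η * Complex.I) + x * 1) * 1‖ ≤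
      l ^ m := by
    have := intervalIntegral.norm_integral_le_of_norm_le_const (a := 0) (b := 1 / 6 - η)
      (f := fun x : ℝ => kernel (t * Complex.I) (-(η * Complex.I) + x * 1) * 1) (C := l ^ m) (by
        intro x hx
        rw [Set.uIoc_of_le (by linarith)] at hx
        have e : (-(η * Complex.I) + x * 1 : ℂ) = x - m * t * Complex.I := by
          rw [hη]; push_cast; ring
        rw [e, mul_one]
        refine norm_kernel_I_sub_le ht m fun y hy0 hy1 => le_trans ?_ (le_max_left _ _)
        refine cosh_sub_cos_le (ε := 2 * Real.pi * η) (by positivity) (hη4.trans hη2π) ?_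
          ?_ (by have := hx.1; positivity) ?_
        · have : 2 * Real.pi * η ≤ 8 * (1 / 16) := by
            refine mul_le_mul ?_ hη16 hη0 (by norm_num)
            linarith
          linarith
        · rw [abs_of_nonneg (by positivity)]; gcongr
        · have : 2 * Real.pi * x ≤ 2 * Real.pi * (1 / 6 - η) := by
            have := hx.2; gcongr
          linarith)
    refine this.trans (mul_le_of_le_one_right (by positivity) ?_)
    rw [abs_of_nonneg (by linarith)]; linarith
  have hH₂ : ‖∫ x in (1 / 6 + η)..(1 / 2), kernel (t * Complex.I) (η * Complex.I + x * 1) * 1‖ ≤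
      l ^ m := by
    have := intervalIntegral.norm_integral_le_of_norm_le_const (a := 1 / 6 + η) (b := 1 / 2)
      (f := fun x : ℝ => kernel (t * Complex.I) (η * Complex.I + x * 1) * 1) (C := l ^ m) (by
        intro x hx
        rw [Set.uIoc_of_le (by linarith)] at hx
        have e : (η * Complex.I + x * 1 : ℂ) = x + m * t * Complex.I := by
          rw [hη]; push_cast; ring
        rw [e, mul_one]
        refine (norm_kernel_I_add_le (l := l₂) ht m (by linarith) ?_).trans ?_
        · have h1 : 2 * Real.pi * (1 / 6 + η) ≤ 2 * Real.pi * x := by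
            have := hx.1.le; gcongr
          have h2 : 2 * Real.pi * x ≤ 2 * Real.pi * (1 / 2) := by
            have := hx.2; gcongr
          have := Real.cos_le_cos_of_nonneg_of_le_pi (x := Real.pi / 3 + δ / 4)
            (y := 2 * Real.pi * x) (by positivity) (by linarith) (by linarith)
          rw [hl₂]; linarith
        · have h0 : 0 ≤ l₂⁻¹ := inv_nonneg.mpr (by linarith)
          gcongr
          exact le_max_right _ _)
    refine this.trans (mul_le_of_le_one_right (by positivity) ?_)
    rw [abs_of_nonneg (by linarith)]; linarith
  set M := Complex.exp (phase (1 / 6) / (t * Complex.I)) * ((t * Complex.I) ^ (1 / 2 : ℂ) *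
        ∑ j ∈ Finset.range K, A j * (t * Complex.I) ^ j) with hM
  have hHM : ‖H - M‖ ≤ (C₁ + 2 * (l⁻¹ * D)) * (√t * t ^ K) := by
    rw [hH]
    set X₁ := ∫ x in (0 : ℝ)..(1 / 6 - η), kernel (t * Complex.I) (-(η * Complex.I) + x * 1) * 1
    set X₂ := ∫ x in (-R)..R, kernel (t * Complex.I) (1 / 6 + x * diagDir) * diagDir
    set X₃ := ∫ x in (1 / 6 + η)..(1 / 2), kernel (t * Complex.I) (η * Complex.I + x * 1) * 1
    calc ‖X₁ + X₂ + X₃ - M‖ = ‖(X₂ - M) + (X₁ + X₃)‖ := by congr 1; ring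
      _ ≤ ‖X₂ - M‖ + (‖X₁‖ + ‖X₃‖) := (norm_add_le _ _).trans (by gcongr; exact norm_add_le _ _)
      _ ≤ _ := by linarith
  rw [hG, show H + (starRingEnd ℂ) H - (M + (starRingEnd ℂ) M) =
    (H - M) + (starRingEnd ℂ) (H - M) by rw [map_sub]; ring]
  refine (norm_add_le _ _).trans ?_
  rw [Complex.norm_conj]
  linarith

/-! ### Uniqueness of the Kashaev series -/

/-- A polynomial in a null sequence which is smaller than its degree permits vanishes. -/
lemma eq_zero_of_sum_isBigO {ι : Type*} {l : Filter ι} [l.NeBot] {x : ι → ℂ}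
    (hx : Tendsto x l (𝓝[≠] 0)) {K : ℕ} {c : ℕ → ℂ}
    (h : (fun i => ∑ j ∈ Finset.range K, c j * x i ^ j) =O[l] fun i => x i ^ K) :
    ∀ j < K, c j = 0 := by
  induction K generalizing c with
  | zero => intro j hj; omega
  | succ K ih =>
    have hx0 : Tendsto x l (𝓝 0) := hx.mono_right nhdsWithin_le_nhds
    have hne : ∀ᶠ i in l, x i ≠ 0 := (tendsto_nhdsWithin_iff.mp hx).2
    have e : ∀ i, ∑ j ∈ Finset.range (K + 1), c j * x i ^ j =
        x i * ∑ j ∈ Finset.range K, c (j + 1) * x i ^ j + c 0 := by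
      intro i
      rw [Finset.sum_range_succ', Finset.mul_sum, pow_zero, mul_one]
      congr 1
      exact Finset.sum_congr rfl fun j _ => by ring
    have t1 : Tendsto (fun i => ∑ j ∈ Finset.range (K + 1), c j * x i ^ j) l (𝓝 0) := by
      refine h.trans_tendsto ?_
      simpa using hx0.pow (K + 1)
    have t2 : Tendsto (fun i => ∑ j ∈ Finset.range (K + 1), c j * x i ^ j) l (𝓝 (c 0)) := by
      have : Tendsto (fun i => x i * ∑ j ∈ Finset.range K, c (j + 1) * x i ^ j + c 0) l
          (𝓝 (0 * ∑ j ∈ Finset.range K, c (j + 1) * 0 ^ j + c 0)) :=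
        (hx0.mul (tendsto_finsetSum _ fun j _ => (hx0.pow j).const_mul _)).add_const _
      rw [zero_mul, zero_add] at this
      exact this.congr fun i => (e i).symm
    have c0 : c 0 = 0 := tendsto_nhds_unique t2 t1
    have h' : (fun i => ∑ j ∈ Finset.range K, c (j + 1) * x i ^ j) =O[l] fun i => x i ^ K := by
      have := (Asymptotics.isBigO_refl (fun i => (x i)⁻¹) l).mul h
      refine this.congr' ?_ ?_
      · filter_upwards [hne] with i hi
        rw [e, c0, add_zero, inv_mul_cancel_left₀ hi]
      · filter_upwards [hne] with i hi
        rw [pow_succ', inv_mul_cancel_left₀ hi]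
    intro j hj
    rcases j with _ | j
    · exact c0
    · exact ih h' j (by omega)

/-- The value `h = 2πi/N` of the expansion parameter belonging to the Kashaev invariant at `N`. -/
noncomputable def kashaevParam (N : ℕ) : ℂ := 2 * Real.pi * Complex.I / N

/-- The coefficients `c` give the expansion of the Kashaev invariant up to a relative error
`O(N^{-K})`. -/
def IsKashaevExpansion (K : ℕ) (c : ℕ → ℂ) : Prop :=
  (fun N : ℕ => (kashaev N : ℂ) - (((N : ℝ) ^ (3 / 2 : ℝ) : ℝ) : ℂ) *
      (expFactor (kashaevParam N) * ∑ j ∈ Finset.range K, c j * kashaevParam N ^ j))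
    =O[atTop] fun N : ℕ => (N : ℝ) ^ (3 / 2 : ℝ) * ‖expFactor (kashaevParam N)‖ * ((N : ℝ)⁻¹) ^ K

lemma isKashaevSeries_iff {Φ : PowerSeries ℂ} :
    IsKashaevSeries Φ ↔ ∀ K, IsKashaevExpansion K fun j => PowerSeries.coeff j Φ := Iff.rfl

lemma kashaevParam_eq (N : ℕ) :
    kashaevParam N = 2 * Real.pi * Complex.I * ((1 / N : ℝ) : ℂ) := by
  rw [kashaevParam]; push_cast; ring

lemma norm_kashaevParam (N : ℕ) : ‖kashaevParam N‖ = 2 * Real.pi * (N : ℝ)⁻¹ := by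
  rw [kashaevParam_eq]
  simp [abs_of_pos Real.pi_pos]

lemma kashaevParam_ne_zero {N : ℕ} (hN : N ≠ 0) : kashaevParam N ≠ 0 := by
  rw [← norm_ne_zero_iff, norm_kashaevParam]
  positivity

lemma tendsto_kashaevParam : Tendsto kashaevParam atTop (𝓝[≠] 0) := by
  refine tendsto_nhdsWithin_iff.mpr ⟨?_, ?_⟩
  · rw [tendsto_zero_iff_norm_tendsto_zero]
    simp_rw [norm_kashaevParam]
    simpa using (tendsto_inv_atTop_nhds_zero_nat (𝕜 := ℝ)).const_mul (2 * Real.pi)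
  · filter_upwards [eventually_ne_atTop 0] with N hN using kashaevParam_ne_zero hN

lemma inv_pow_isBigO_kashaevParam_pow (K : ℕ) :
    (fun N : ℕ => ((N : ℝ)⁻¹) ^ K) =O[atTop] fun N => kashaevParam N ^ K := by
  refine Asymptotics.IsBigO.of_bound 1 (Eventually.of_forall fun N => ?_)
  rw [norm_pow, norm_pow, norm_kashaevParam, one_mul, Real.norm_of_nonneg (by positivity)]
  gcongr
  exact le_mul_of_one_le_left (by positivity) (by linarith [Real.pi_gt_three])

lemma kashaevParam_pow_isBigO_inv_pow (K : ℕ) :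
    (fun N => kashaevParam N ^ K) =O[atTop] fun N : ℕ => ((N : ℝ)⁻¹) ^ K := by
  refine Asymptotics.IsBigO.of_bound ((2 * Real.pi) ^ K) (Eventually.of_forall fun N => ?_)
  rw [norm_pow, norm_pow, norm_kashaevParam, Real.norm_of_nonneg (by positivity), mul_pow]

lemma IsKashaevExpansion.eq {K : ℕ} {c d : ℕ → ℂ} (hc : IsKashaevExpansion K c)
    (hd : IsKashaevExpansion K d) {j : ℕ} (hj : j < K) : c j = d j := by
  have h := hd.sub hc
  have h2 : (fun N : ℕ => ∑ j ∈ Finset.range K, (c j - d j) * kashaevParam N ^ j) =O[atTop]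
      fun N => kashaevParam N ^ K := by
    refine Asymptotics.IsBigO.trans ?_ (inv_pow_isBigO_kashaevParam_pow K)
    have := (Asymptotics.isBigO_refl (fun N : ℕ => ((((N : ℝ) ^ (3 / 2 : ℝ) : ℝ) : ℂ) *
      expFactor (kashaevParam N))⁻¹) atTop).norm_right.mul h
    have h0 : ∀ᶠ N : ℕ in atTop, (((N : ℝ) ^ (3 / 2 : ℝ) : ℝ) : ℂ) ≠ 0 := by
      filter_upwards [eventually_gt_atTop 0] with N hN
      have hN' : (0 : ℝ) < N := by exact_mod_cast hN
      exact_mod_cast (Real.rpow_pos_of_pos hN' _).ne'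
    refine (this.congr' (f₂ := fun N : ℕ =>
      ∑ j ∈ Finset.range K, (c j - d j) * kashaevParam N ^ j) ?_ EventuallyEq.rfl).trans ?_
    · filter_upwards [h0] with N hN
      have he : expFactor (kashaevParam N) ≠ 0 := Complex.exp_ne_zero _
      simp_rw [sub_mul, Finset.sum_sub_distrib]
      field_simp
      ring
    · refine Asymptotics.IsBigO.of_bound 1 ?_
      filter_upwards [h0] with N hN
      have he : ‖expFactor (kashaevParam N)‖ ≠ 0 := norm_ne_zero_iff.mpr (Complex.exp_ne_zero _)
      have hN' := norm_ne_zero_iff.mpr hN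
      rw [Complex.norm_real] at hN'
      simp only [norm_mul, norm_inv, norm_norm, Complex.norm_real, one_mul]
      refine le_of_eq ?_
      field_simp
  exact sub_eq_zero.mp (eq_zero_of_sum_isBigO tendsto_kashaevParam h2 j hj)

lemma IsKashaevExpansion.congr {K : ℕ} {c d : ℕ → ℂ} (hc : IsKashaevExpansion K c)
    (h : ∀ j < K, c j = d j) : IsKashaevExpansion K d := by
  refine Asymptotics.IsBigO.congr_left hc fun N => ?_
  rw [Finset.sum_congr rfl fun j hj => by rw [h j (Finset.mem_range.mp hj)]]

lemma IsKashaevExpansion.of_succ {K : ℕ} {c : ℕ → ℂ} (hc : IsKashaevExpansion (K + 1) c) :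
    IsKashaevExpansion K c := by
  have h1 : (fun N : ℕ => (N : ℝ) ^ (3 / 2 : ℝ) * ‖expFactor (kashaevParam N)‖ *
      ((N : ℝ)⁻¹) ^ (K + 1)) =O[atTop] fun N : ℕ => (N : ℝ) ^ (3 / 2 : ℝ) *
      ‖expFactor (kashaevParam N)‖ * ((N : ℝ)⁻¹) ^ K := by
    refine (Asymptotics.isBigO_refl _ _).mul (Asymptotics.IsBigO.of_bound 1 ?_)
    refine Eventually.of_forall fun N => ?_
    rw [Real.norm_of_nonneg (by positivity), Real.norm_of_nonneg (by positivity), one_mul]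
    exact pow_le_pow_of_le_one (by positivity) (Nat.cast_inv_le_one N) (Nat.le_succ K)
  have h2 : (fun N : ℕ => (((N : ℝ) ^ (3 / 2 : ℝ) : ℝ) : ℂ) * expFactor (kashaevParam N) *
      (c K * kashaevParam N ^ K)) =O[atTop] fun N : ℕ => (N : ℝ) ^ (3 / 2 : ℝ) *
      ‖expFactor (kashaevParam N)‖ * ((N : ℝ)⁻¹) ^ K := by
    refine ((Asymptotics.IsBigO.of_bound 1 (Eventually.of_forall fun N => ?_)).mul
      (Asymptotics.IsBigO.of_bound 1 (Eventually.of_forall fun N => ?_))).mul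
      ((kashaevParam_pow_isBigO_inv_pow K).const_mul_left _)
    · rw [Complex.norm_real, one_mul]
    · rw [norm_norm, one_mul]
  refine ((Asymptotics.IsBigO.trans hc h1).add h2).congr_left fun N => ?_
  rw [Finset.sum_range_succ]
  ring

lemma IsKashaevExpansion.mono {K L : ℕ} (hKL : K ≤ L) {c : ℕ → ℂ} (hc : IsKashaevExpansion L c) :
    IsKashaevExpansion K c := by
  induction L, hKL using Nat.le_induction with
  | base => exact hc
  | succ L _ ih => exact ih hc.of_succ

lemma expFactor_two_pi_I_mul (τ : ℂ) :
    expFactor (2 * Real.pi * Complex.I * τ) = Complex.exp (phase (1 / 6) / τ) := by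
  rw [expFactor, phase_saddle]
  congr 1
  push_cast
  rcases eq_or_ne τ 0 with rfl | hτ
  · simp
  · have := Real.pi_ne_zero
    field_simp [Complex.I_ne_zero]

lemma expFactor_kashaevParam (N : ℕ) :
    expFactor (kashaevParam N) = ((Real.exp (phase (1 / 6) * N) : ℝ) : ℂ) := by
  rw [kashaevParam_eq, expFactor_two_pi_I_mul]
  rw [Complex.ofReal_exp, Complex.ofReal_mul, Complex.ofReal_div, Complex.ofReal_one,
    div_div_eq_mul_div, div_one, Complex.ofReal_natCast]

/-- The Kashaev invariant is real, so its expansion is invariant under complex conjugation. -/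
lemma IsKashaevExpansion.conj {K : ℕ} {c : ℕ → ℂ} (hc : IsKashaevExpansion K c) :
    IsKashaevExpansion K fun j => (starRingEnd ℂ) (c j) * (-1) ^ j := by
  refine Asymptotics.IsBigO.trans (Asymptotics.IsBigO.of_bound 1 (Eventually.of_forall fun N => ?_)) hc
  rw [one_mul, ← Complex.norm_conj]
  refine le_of_eq (congrArg _ ?_)
  have hh : (starRingEnd ℂ) (kashaevParam N) = -kashaevParam N := by
    rw [kashaevParam_eq]; simp [map_ofNat]
  simp only [map_sub, map_mul, map_sum, map_pow, Complex.conj_ofReal, Complex.conj_conj, map_neg,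
    map_one, hh, expFactor_kashaevParam]
  congr 3
  refine Finset.sum_congr rfl fun j _ => ?_
  rw [neg_pow (kashaevParam N) j, mul_assoc, ← mul_assoc ((-1) ^ j), ← mul_pow]
  simp

/-- The coefficients of a power of `h = 2πiτ` in terms of those of the same power of `τ`. -/
lemma div_two_pi_I_pow_mul (A : ℕ → ℂ) (j : ℕ) (τ : ℂ) :
    A j / (2 * Real.pi * Complex.I) ^ j * (2 * Real.pi * Complex.I * τ) ^ j = A j * τ ^ j := by
  have := Complex.two_pi_I_ne_zero
  rw [mul_pow _ τ, ← mul_assoc, div_mul_cancel₀ _ (pow_ne_zero _ this)]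

lemma IsSaddleExpansion.isKashaevExpansion {K : ℕ} {A : ℕ → ℂ}
    (hA : IsSaddleExpansion (K + 1) K A) :
    IsKashaevExpansion K fun j => A j / (2 * Real.pi * Complex.I) ^ j := by
  obtain ⟨C, N₀, h⟩ := exists_kashaev_sub_le hA
  refine Asymptotics.IsBigO.of_bound C ?_
  filter_upwards [eventually_ge_atTop N₀, eventually_gt_atTop 0] with N hN hN0
  have hN1 : (0 : ℝ) < N := by exact_mod_cast hN0
  have hp : (N : ℝ) ^ (3 / 2 : ℝ) = N ^ 2 * √(1 / N) := by
    rw [one_div, Real.sqrt_inv, Real.sqrt_eq_rpow, ← Real.rpow_natCast, ← Real.rpow_neg hN1.le,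
      ← Real.rpow_add hN1]
    norm_num
  have hq : (((1 / N : ℝ) : ℂ)) ^ (1 / 2 : ℂ) = ((√(1 / N) : ℝ) : ℂ) := by
    rw [Real.sqrt_eq_rpow, Complex.ofReal_cpow (by positivity)]
    push_cast; rfl
  have hs := h N hN
  have hsum : ∑ j ∈ Finset.range K, A j / (2 * Real.pi * Complex.I) ^ j * kashaevParam N ^ j =
      ∑ j ∈ Finset.range K, A j * ((1 / N : ℝ) : ℂ) ^ j :=
    Finset.sum_congr rfl fun j _ => by rw [kashaevParam_eq, div_two_pi_I_pow_mul]
  rw [hsum, expFactor_kashaevParam, Complex.norm_real, Real.norm_of_nonneg (by positivity),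
    Real.norm_of_nonneg (Real.exp_pos _).le, hp]
  rw [hq] at hs
  convert hs using 1
  · congr 2
    push_cast
    ring
  · rw [inv_eq_one_div]; ring

/-- A Kashaev series exists, and it gives the coefficients of the saddle point to every order; these
are real. Saddle expansions of different orders have the same coefficients because the expansion of
the Kashaev invariant is unique. -/
lemma exists_kashaevSeries : ∃ Φ : PowerSeries ℂ, IsKashaevSeries Φ ∧ ∀ K, ∃ A : ℕ → ℂ,
    IsSaddleExpansion (K + 1) K A ∧
    ∀ j < K, PowerSeries.coeff j Φ = A j / (2 * Real.pi * Complex.I) ^ j ∧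
      (starRingEnd ℂ) (A j) = A j := by
  choose A hA using fun K => exists_isSaddleExpansion (K + 1) K
  have hE := fun K => (hA K).isKashaevExpansion
  have hcoh : ∀ K, ∀ j < K, A (j + 1) j / (2 * Real.pi * Complex.I) ^ j =
      A K j / (2 * Real.pi * Complex.I) ^ j := fun K j hj =>
    (hE (j + 1)).eq ((hE K).mono hj) (Nat.lt_succ_self j)
  refine ⟨PowerSeries.mk fun j => A (j + 1) j / (2 * Real.pi * Complex.I) ^ j, ?_, fun K =>
    ⟨A K, hA K, fun j hj => ⟨?_, ?_⟩⟩⟩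
  · rw [isKashaevSeries_iff]
    intro K
    exact (hE K).congr fun j hj => by rw [PowerSeries.coeff_mk, hcoh K j hj]
  · rw [PowerSeries.coeff_mk, hcoh K j hj]
  · have h := (hE K).eq (hE K).conj hj
    simp only [map_div₀, map_pow, map_mul, Complex.conj_I, Complex.conj_ofReal, map_ofNat] at h
    rw [show (2 * (Real.pi : ℂ) * -Complex.I) ^ j =
      (2 * (Real.pi : ℂ) * Complex.I) ^ j * (-1) ^ j by rw [← mul_pow]; ring] at h
    have h1 : ((-1 : ℂ)) ^ j ≠ 0 := pow_ne_zero _ (by norm_num)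
    have h2 : (2 * (Real.pi : ℂ) * Complex.I) ^ j ≠ 0 := pow_ne_zero _ Complex.two_pi_I_ne_zero
    rw [div_mul_eq_mul_div, mul_div_mul_right _ _ h1] at h
    exact (mul_right_cancel₀ (inv_ne_zero h2) (by simpa [div_eq_mul_inv] using h)).symm

lemma IsKashaevSeries.unique {Φ Ψ : PowerSeries ℂ} (hΦ : IsKashaevSeries Φ)
    (hΨ : IsKashaevSeries Ψ) : Ψ = Φ :=
  PowerSeries.ext fun j => (isKashaevSeries_iff.mp hΨ (j + 1)).eq (isKashaevSeries_iff.mp hΦ (j + 1))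
    (Nat.lt_succ_self j)

/-! ### The expansion of `G₀` on an arbitrary ray -/

/-- The truncated contribution of one saddle point, without the factor `√τ`. -/
noncomputable def saddleSum (K : ℕ) (A : ℕ → ℂ) (τ : ℂ) : ℂ :=
  Complex.exp (phase (1 / 6) / τ) * ∑ j ∈ Finset.range K, A j * τ ^ j

/-- The sum of the truncated contributions of both saddle points. -/
noncomputable def twoSaddleSum (K : ℕ) (A : ℕ → ℂ) (τ : ℂ) : ℂ :=
  τ ^ (1 / 2 : ℂ) * (saddleSum K A τ - Complex.I * saddleSum K A (-τ))

lemma conj_saddleSum {K : ℕ} {A : ℕ → ℂ} (hA : ∀ j < K, (starRingEnd ℂ) (A j) = A j) (τ : ℂ) :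
    (starRingEnd ℂ) (saddleSum K A τ) = saddleSum K A ((starRingEnd ℂ) τ) := by
  rw [saddleSum, saddleSum, map_mul, ← Complex.exp_conj, map_div₀, Complex.conj_ofReal, map_sum]
  congr 1
  refine Finset.sum_congr rfl fun j hj => ?_
  rw [map_mul, map_pow, hA j (Finset.mem_range.mp hj)]

/-- For `τ` in the upper half-plane, the principal square roots of `τ` and of its reflection in the
imaginary axis are related by `conj √τ = -i √(-conj τ)`. This is the origin of the factor `-i`. -/
lemma conj_cpow_half {τ : ℂ} (hτ : 0 < τ.im) :
    (starRingEnd ℂ) (τ ^ (1 / 2 : ℂ)) = -Complex.I * (-(starRingEnd ℂ) τ) ^ (1 / 2 : ℂ) := by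
  have hne : τ ≠ 0 := by rintro rfl; simp at hτ
  have hn : -(starRingEnd ℂ) τ ≠ 0 := by simpa using hne
  have hlog : Complex.log (-(starRingEnd ℂ) τ) = (starRingEnd ℂ) (Complex.log τ) +
      Real.pi * Complex.I := by
    have h1 : (-(starRingEnd ℂ) τ).arg = Real.pi - τ.arg := by
      rw [Complex.arg_neg_eq_arg_add_pi_of_im_neg (by simpa using hτ), Complex.arg_conj,
        if_neg (fun h => by rw [Complex.arg_eq_pi_iff] at h; exact hτ.ne' h.2)]
      ring
    rw [Complex.log, Complex.log, h1, norm_neg, Complex.norm_conj]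
    simp only [map_add, map_mul, Complex.conj_ofReal, Complex.conj_I]
    push_cast
    ring
  rw [Complex.cpow_def_of_ne_zero hne, Complex.cpow_def_of_ne_zero hn, ← Complex.exp_conj, hlog,
    add_mul, Complex.exp_add,
    show (Real.pi : ℂ) * Complex.I * (1 / 2) = (Real.pi / 2) * Complex.I by ring,
    Complex.exp_pi_div_two_mul_I, mul_comm (Complex.exp _) Complex.I, ← mul_assoc]
  simp [map_ofNat]

/-- The two contributions are exchanged by the reflection of `τ` in the imaginary axis. -/
lemma conj_twoSaddleSum {K : ℕ} {A : ℕ → ℂ} (hA : ∀ j < K, (starRingEnd ℂ) (A j) = A j) {τ : ℂ}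
    (hτ : 0 < τ.im) :
    (starRingEnd ℂ) (twoSaddleSum K A τ) = twoSaddleSum K A (-(starRingEnd ℂ) τ) := by
  rw [twoSaddleSum, twoSaddleSum, map_mul, conj_cpow_half hτ, map_sub, map_mul, conj_saddleSum hA,
    conj_saddleSum hA, Complex.conj_I, map_neg, neg_neg]
  linear_combination (-(-(starRingEnd ℂ) τ) ^ (1 / 2 : ℂ) *
    saddleSum K A (-(starRingEnd ℂ) τ)) * Complex.I_sq

/-- The expansion of `G₀` along the ray of direction `ω` with a remainder relative to the sum of the
sizes of the two exponential factors. -/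
def HasTwoSaddleExpansion (K : ℕ) (A : ℕ → ℂ) (ω : ℂ) : Prop :=
  ∃ C : ℝ, ∃ r₀ > 0, ∀ r : ℝ, 0 < r → r < r₀ →
    ‖G0 (cyc (r * ω)) - twoSaddleSum K A (r * ω)‖ ≤ C * (√r *
      (‖Complex.exp (phase (1 / 6) / (r * ω))‖ + ‖Complex.exp (phase (1 / 6) / -(r * ω))‖) * r ^ K)

lemma HasTwoSaddleExpansion.reflect {K : ℕ} {A : ℕ → ℂ} {ω : ℂ}
    (hA : ∀ j < K, (starRingEnd ℂ) (A j) = A j) (him : 0 < ω.im)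
    (h : HasTwoSaddleExpansion K A ω) : HasTwoSaddleExpansion K A (-(starRingEnd ℂ) ω) := by
  obtain ⟨C, r₀, hr₀, h⟩ := h
  refine ⟨C, r₀, hr₀, fun r hr hr' => ?_⟩
  have hτ : 0 < ((r : ℂ) * ω).im := by rw [Complex.im_ofReal_mul]; positivity
  have e : (r : ℂ) * -(starRingEnd ℂ) ω = -(starRingEnd ℂ) (r * ω) := by
    rw [map_mul, Complex.conj_ofReal]; ring
  have hn : ∀ z : ℂ, ‖Complex.exp (phase (1 / 6) / (starRingEnd ℂ) z)‖ =
      ‖Complex.exp (phase (1 / 6) / z)‖ := fun z => by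
    rw [← Complex.norm_conj, ← Complex.exp_conj, map_div₀, Complex.conj_ofReal, Complex.conj_conj]
  rw [e, neg_neg, hn, ← map_neg, hn, map_neg, G0_cyc_neg_conj hτ, ← conj_twoSaddleSum hA hτ,
    ← map_sub, Complex.norm_conj, add_comm ‖Complex.exp (phase (1 / 6) / -(r * ω))‖]
  exact h r hr hr'

lemma IsSaddleExpansion.hasTwoSaddleExpansion_of_re_pos {K : ℕ} {A : ℕ → ℂ}
    (hA : IsSaddleExpansion (K + 1) K A) {ω : ℂ} (hω : ‖ω‖ = 1) (him : 0 < ω.im)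
    (hre : 0 < ω.re) : HasTwoSaddleExpansion K A ω := by
  obtain ⟨C, r₀, hr₀, h⟩ := exists_G0_sub_le_of_re_pos hA hω him hre
  have hf := phase_saddle_pos
  have hc : 0 < phase (1 / 6) * ω.re := by positivity
  set D := (K.factorial : ℝ) / (phase (1 / 6) * ω.re) ^ K with hD
  set S := ∑ j ∈ Finset.range K, ‖A j‖ with hS
  have hS0 : 0 ≤ S := Finset.sum_nonneg fun j _ => norm_nonneg _
  refine ⟨|C| + D * S, min r₀ 1, by positivity, fun r hr hr' => ?_⟩
  have hr1 : r ≤ 1 := hr'.le.trans (min_le_right _ _)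
  set τ : ℂ := r * ω with hτ
  have hτn : ‖τ‖ = r := by rw [hτ, norm_mul, hω, mul_one, Complex.norm_of_nonneg hr.le]
  have hsq : ‖τ ^ (1 / 2 : ℂ)‖ = √r := by
    have := Complex.norm_cpow_real τ (1 / 2)
    push_cast at this
    rw [this, hτn, Real.sqrt_eq_rpow]
  have hP : ‖Complex.exp (phase (1 / 6) / τ)‖ = Real.exp (phase (1 / 6) * ω.re / r) := by
    rw [Complex.norm_exp, hτ, ofReal_div_ray_re hω]
  have hQ : ‖Complex.exp (phase (1 / 6) / -τ)‖ = Real.exp (-(phase (1 / 6) * ω.re / r)) := by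
    rw [div_neg, Complex.exp_neg, norm_inv, hP, Real.exp_neg]
  have hP1 : 1 ≤ ‖Complex.exp (phase (1 / 6) / τ)‖ := by
    rw [hP]; exact Real.one_le_exp (by positivity)
  -- On this ray the second exponential is smaller than every power of `r`.
  have hsub : ‖saddleSum K A (-τ)‖ ≤ D * S * r ^ K := by
    have h1 : ‖∑ j ∈ Finset.range K, A j * (-τ) ^ j‖ ≤ S := by
      refine norm_sum_le_of_le _ fun j _ => ?_
      rw [norm_mul, norm_pow, norm_neg, hτn]
      exact mul_le_of_le_one_right (norm_nonneg _) (pow_le_one₀ hr.le hr1)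
    rw [saddleSum, norm_mul, hQ]
    calc _ ≤ D * r ^ K * S := by
          gcongr
          exact exp_neg_div_le hc hr K
      _ = _ := by ring
  have hmain := h r hr (hr'.trans_le (min_le_left _ _))
  rw [show G0 (cyc τ) - twoSaddleSum K A τ = (G0 (cyc τ) - Complex.exp (phase (1 / 6) / τ) *
    (τ ^ (1 / 2 : ℂ) * ∑ j ∈ Finset.range K, A j * τ ^ j)) +
    τ ^ (1 / 2 : ℂ) * (Complex.I * saddleSum K A (-τ)) by
      rw [twoSaddleSum, saddleSum]; ring]
  refine (norm_add_le _ _).trans ?_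
  rw [norm_mul (τ ^ (1 / 2 : ℂ)), norm_mul Complex.I, Complex.norm_I, one_mul, hsq]
  set P := ‖Complex.exp (phase (1 / 6) / τ)‖
  set Q := ‖Complex.exp (phase (1 / 6) / -τ)‖
  have hQ0 : 0 ≤ Q := norm_nonneg _
  have hD0 : 0 ≤ D := by positivity
  calc _ ≤ |C| * (P * (√r * r ^ K)) + √r * (D * S * r ^ K) := by
        gcongr
        exact hmain.trans (mul_le_mul_of_nonneg_right (le_abs_self C) (by positivity))
    _ = |C| * (√r * P * r ^ K) + D * S * (√r * 1 * r ^ K) := by ring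
    _ ≤ |C| * (√r * (P + Q) * r ^ K) + D * S * (√r * (P + Q) * r ^ K) := by
        gcongr <;> linarith
    _ = _ := by ring

lemma IsSaddleExpansion.hasTwoSaddleExpansion_I {K : ℕ} {A : ℕ → ℂ}
    (hA : IsSaddleExpansion (K + 1) K A) (hr : ∀ j < K, (starRingEnd ℂ) (A j) = A j) :
    HasTwoSaddleExpansion K A Complex.I := by
  obtain ⟨C, r₀, hr₀, h⟩ := exists_G0_sub_le_I hA
  refine ⟨|C|, r₀, hr₀, fun r hr0 hr' => ?_⟩
  obtain ⟨M, hM, hb⟩ := h r hr0 hr'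
  have hτ : 0 < ((r : ℂ) * Complex.I).im := by rw [im_mul_I]; exact hr0
  set τ : ℂ := r * Complex.I with hτd
  have hc : (starRingEnd ℂ) τ = -τ := neg_eq_iff_eq_neg.mp (neg_conj_mul_I r)
  have hM' : M = τ ^ (1 / 2 : ℂ) * saddleSum K A τ := by rw [hM, saddleSum]; ring
  have e : M + (starRingEnd ℂ) M = twoSaddleSum K A τ := by
    rw [hM', map_mul, conj_cpow_half hτ, conj_saddleSum hr, hc, neg_neg, twoSaddleSum]
    ring
  have hP : ‖Complex.exp (phase (1 / 6) / τ)‖ = 1 := by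
    rw [Complex.norm_exp, hτd, ofReal_div_ray_re Complex.norm_I]; simp
  rw [e] at hb
  refine hb.trans ?_
  rw [hP]
  have hQ := norm_nonneg (Complex.exp (phase (1 / 6) / -τ))
  calc C * (√r * r ^ K) ≤ |C| * (√r * 1 * r ^ K) := by
        rw [mul_one]; exact mul_le_mul_of_nonneg_right (le_abs_self C) (by positivity)
    _ ≤ _ := by gcongr; linarith

/-- Rays in the second quadrant are reflected to the first. -/
lemma hasTwoSaddleExpansion {K : ℕ} {A : ℕ → ℂ} (hA : IsSaddleExpansion (K + 1) K A)
    (hr : ∀ j < K, (starRingEnd ℂ) (A j) = A j) {ω : ℂ} (hω : ‖ω‖ = 1) (him : 0 < ω.im) :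
    HasTwoSaddleExpansion K A ω := by
  rcases lt_trichotomy ω.re 0 with hre | hre | hre
  · have := (hA.hasTwoSaddleExpansion_of_re_pos (ω := -(starRingEnd ℂ) ω) (by simpa using hω)
      (by simpa using him) (by simpa using hre)).reflect hr (by simpa using him)
    simpa using this
  · have : ω = Complex.I := by
      refine Complex.ext (by simpa using hre) ?_
      have h := Complex.sq_norm_sub_sq_re ω
      rw [hω, hre] at h
      rw [Complex.I_im]
      nlinarith
    rw [this]
    exact hA.hasTwoSaddleExpansion_I hr
  · exact hA.hasTwoSaddleExpansion_of_re_pos hω him hre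

/-- The truncated completed series in the variable `h = 2πiτ`. -/
lemma completedTrunc_two_pi_I_mul {Φ : PowerSeries ℂ} {K : ℕ} {A : ℕ → ℂ}
    (h : ∀ j < K, PowerSeries.coeff j Φ = A j / (2 * Real.pi * Complex.I) ^ j) (τ : ℂ) :
    completedTrunc Φ K (2 * Real.pi * Complex.I * τ) = saddleSum K A τ := by
  rw [completedTrunc, saddleSum, expFactor_two_pi_I_mul]
  congr 1
  refine Finset.sum_congr rfl fun j hj => ?_
  rw [h j (Finset.mem_range.mp hj), div_two_pi_I_pow_mul]

lemma hasRayExpansion_of_hasTwoSaddleExpansion {Φ : PowerSeries ℂ} {θ : ℝ}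
    (h : ∀ K, ∃ A : ℕ → ℂ, HasTwoSaddleExpansion K A (Complex.exp (θ * Complex.I)) ∧
      ∀ j < K, PowerSeries.coeff j Φ = A j / (2 * Real.pi * Complex.I) ^ j) :
    HasRayExpansion Φ θ := by
  intro K
  obtain ⟨A, ⟨C, r₀, hr₀, hb⟩, hA⟩ := h K
  refine ⟨C, r₀, hr₀, fun r hr hr' τ hτ => ?_⟩
  have hτn : ‖τ‖ = r := by
    rw [hτ, norm_mul, Complex.norm_exp_ofReal_mul_I, mul_one, Complex.norm_of_nonneg hr.le]
  have hsq : ‖τ ^ (1 / 2 : ℂ)‖ = √r := by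
    have := Complex.norm_cpow_real τ (1 / 2)
    push_cast at this
    rw [this, hτn, Real.sqrt_eq_rpow]
  have := hb r hr hr'
  rw [← hτ, twoSaddleSum] at this
  rw [← mul_neg, completedTrunc_two_pi_I_mul hA, completedTrunc_two_pi_I_mul hA,
    expFactor_two_pi_I_mul, expFactor_two_pi_I_mul, hsq, hτn]
  exact this

end FigureEight

theorem mainTheorem5 :
    ∃ Φ : PowerSeries ℂ,
      (∀ Ψ : PowerSeries ℂ, FigureEight.IsKashaevSeries Ψ ↔ Ψ = Φ) ∧
      ∀ θ : ℝ, 0 < θ → θ < Real.pi → FigureEight.HasRayExpansion Φ θ := by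
  obtain ⟨Φ, hΦ, hA⟩ := FigureEight.exists_kashaevSeries
  refine ⟨Φ, fun Ψ => ⟨fun h => FigureEight.IsKashaevSeries.unique hΦ h, fun h => h ▸ hΦ⟩,
    fun θ h0 h1 => FigureEight.hasRayExpansion_of_hasTwoSaddleExpansion fun K => ?_⟩
  obtain ⟨A, hs, h⟩ := hA K
  exact ⟨A, FigureEight.hasTwoSaddleExpansion hs (fun j hj => (h j hj).2)
    (Complex.norm_exp_ofReal_mul_I θ)
    (by rw [Complex.exp_ofReal_mul_I_im]; exact Real.sin_pos_of_pos_of_lt_pi h0 h1),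
    fun j hj => (h j hj).1⟩
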